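/- Let $\mathcal X,\mathcal Y,\mathcal Z,\mathcal W$ be finite alphabets, let $\mu_Z$ be a probability distribution on $\mathcal Z$ and let $\mu_{XW|Z}$, $\mu_{Y|XZ}$ be conditional probability distributions. Let $(X,Y,Z,W)$ have the joint distribution $\mu_{XW|Z}(x,w|z)\,\mu_{Y|XZ}(y|x,z)\,\mu_Z(z)$. The state is i.i.d. with law $\mu_Z$, the channel $\mu_{Y|XZ}$ is stationary and memoryless, $\mu(\boldsymbol u|\boldsymbol v)=\prod_i\mu(u_i|v_i)$ for sequences, and $\log$ has base $2$. Put $\zeta_{\mathcal U}(\gamma)=\gamma-\sqrt{2\gamma}\,\log\frac{\sqrt{2\gamma}}{|\mathcal U|}$. **Hash property.** For every $n\ge1$ let $\mathcal A$ be a set of functions from a finite set $\mathcal U_n$ to a finite set $\overline{\mathcal U}_n$, with a probability distribution $p_A$ on $\mathcal A$, and let $\mathrm{Im}\,\mathcal A=\bigcup_{A\in\mathcal A}A(\mathcal U_n)$. The ensemble $(\mathcal A,p_A)$ has the *hash property* if $\frac1n\log\frac{|\overline{\mathcal U}_n|}{|\mathrm{Im}\,\mathcal A|}\to0$ and there are real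 sequences $\alpha(n)\to1$, $\beta(n)\to0$ such that for all $n\ge 1$ and all $\mathcal T,\mathcal T'\subset\mathcal U_n$ $$\sum_{\boldsymbol u\in\mathcal T,\ \boldsymbol u'\in\mathcal T'}p_A(\{A:A\boldsymbol u=A\boldsymbol u'\})\le|\mathcal T\cap\mathcal T'|+\frac{|\mathcal T||\mathcal T'|\alpha(n)}{|\mathrm{Im}\,\mathcal A|}+\min\{|\mathcal T|,|\mathcal T'|\}\beta(n).$$ For the joint ensemble $(\mathcal A\times\mathcal B,p_A\times p_B)$ of the functions $\boldsymbol u\mapsto(A\boldsymbol u,B\boldsymbol u)$ the image is understood to be $\mathrm{Im}\,\mathcal A\times\mathrm{Im}\,\mathcal B$. **Code.** Let $\varepsilon_{\mathcal A},\varepsilon_{\mathcal B},\varepsilon_{\widehat{\mathcal A}}>0$. Let $\mathcal A,\mathcal B,\widehat{\mathcal A}$ be ensembles of (not necessarily linear) functions $A:\mathcal W^n\to\mathcal W^{l_{\mathcal A}}$, $B:\mathcal W^n\to\mathcal W^{l_{\mathcal B}}$, $\widehat A:\mathcal X^n\to\mathcal X^{l_{\widehat{\mathcal A}}}$, where $$l_{\mathcal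 A}=\frac{n[H(W|Y)+\varepsilon_{\mathcal A}]}{\log|\mathcal W|},\qquad l_{\mathcal B}=\frac{n[I(W;Y)-I(W;Z)-\varepsilon_{\mathcal B}]}{\log|\mathcal W|},\qquad l_{\widehat{\mathcal A}}=\frac{n[H(X|Z,W)-\varepsilon_{\widehat{\mathcal A}}]}{\log|\mathcal X|},$$ each rounded up or down to an integer, and taken to be $0$ if the expression is negative or its denominator is $0$. For vectors $\boldsymbol c\in\mathrm{Im}A$, $\widehat{\boldsymbol c}\in\mathrm{Im}\widehat A$ the encoder and the decoder are $\varphi(\boldsymbol m|\boldsymbol z)=g_{\widehat A}(\widehat{\boldsymbol c}|\boldsymbol z,g_{AB}(\boldsymbol c,\boldsymbol m|\boldsymbol z))$ and $\varphi^{-1}(\boldsymbol y)=B\,g_A(\boldsymbol c|\boldsymbol y)$, with the maximum-likelihood coding functions $$g_{AB}(\boldsymbol c,\boldsymbol m|\boldsymbol z)=\arg\max_{\boldsymbol w:\,A\boldsymbol w=\boldsymbol c,\,B\boldsymbol w=\boldsymbol m}\mu_{W|Z}(\boldsymbol w|\boldsymbol z),\quad g_{\widehat A}(\widehat{\boldsymbol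 c}|\boldsymbol z,\boldsymbol w)=\arg\max_{\boldsymbol x:\,\widehat A\boldsymbol x=\widehat{\boldsymbol c}}\mu_{X|ZW}(\boldsymbol x|\boldsymbol z,\boldsymbol w),\quad g_A(\boldsymbol c|\boldsymbol y)=\arg\max_{\boldsymbol w:\,A\boldsymbol w=\boldsymbol c}\mu_{W|Y}(\boldsymbol w|\boldsymbol y).$$ Ties in $g_{AB}$ and $g_{\widehat A}$ are broken by arbitrary fixed total orders of $\mathcal W^n$ and $\mathcal X^n$ (given before the functions and vectors are chosen); ties in $g_A$, and the value of $g_{AB}$ where no candidate exists, are arbitrary. The message is uniform on $\mathrm{Im}\,\mathcal B$ and independent of the state, the rate is $R(B)=\frac1n\log|\mathrm{Im}\,\mathcal B|$, and $\mathrm{Error}_{Y|XZ}(A,B,\widehat A,\boldsymbol c,\widehat{\boldsymbol c})$ is the probability that $\varphi^{-1}(\boldsymbol y)\ne\boldsymbol m$. **Theorem.** Let $\varepsilon_{\mathcal A},\varepsilon_{\mathcal B},\varepsilon_{\widehat{\mathcal A}}>0$ satisfy $\varepsilon_{\mathcal B}>\varepsilon_{\mathcal A}$ and $$\varepsilon_{\mathcal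 B}-\varepsilon_{\mathcal A}\le\sqrt{6[\varepsilon_{\mathcal B}-\varepsilon_{\mathcal A}]}\,\log|\mathcal X|<\varepsilon_{\widehat{\mathcal A}},\qquad 2\zeta_{\mathcal Y\times\mathcal W}(6\varepsilon_{\widehat{\mathcal A}})<\varepsilon_{\mathcal A},\tag{$*$}$$ and assume that $(\mathcal A,p_A)$, $(\mathcal A\times\mathcal B,p_A\times p_B)$ and $(\widehat{\mathcal A},p_{\widehat A})$ have the hash property. Then for all $\delta>0$ and all sufficiently large $n$, for all tie-breaking orders, there are $A\in\mathcal A$, $B\in\mathcal B$, $\widehat A\in\widehat{\mathcal A}$, $\boldsymbol c\in\mathrm{Im}A$ and $\widehat{\boldsymbol c}\in\mathrm{Im}\widehat A$ such that $$R(B)\ge I(W;Y)-I(W;Z)-\varepsilon_{\mathcal B}-\delta,\qquad \mathrm{Error}_{Y|XZ}(A,B,\widehat A,\boldsymbol c,\widehat{\boldsymbol c})<\delta .$$ Moreover, suppose that $\mu_{XW|Z}$ attains the Gel'fand–Pinsker capacity $C$, the supremum of $I(W;Y)-I(W;Z)$ over all finite alphabets of $W$ and all $\mu_{XW|Z}$.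 Then the codes approach $C$: for every $\eta>0$ there is $\varepsilon_0>0$ such that, for all $\varepsilon_{\mathcal A},\varepsilon_{\mathcal B},\varepsilon_{\widehat{\mathcal A}}$ as above with $\varepsilon_{\mathcal B}<\varepsilon_0$ and all ensembles as above, for all sufficiently large $n$ and all tie-breaking orders there are such $A,B,\widehat A,\boldsymbol c,\widehat{\boldsymbol c}$ with $R(B)\ge C-\eta$ and error probability below $\eta$; and if $|\mathcal X|\ge2$, positive triples satisfying $\varepsilon_{\mathcal B}>\varepsilon_{\mathcal A}$ and $(*)$ exist with $\varepsilon_{\mathcal B}$ arbitrarily small. -/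

import Mathlib

namespace GP

/-! ### Finite random variables: laws, entropies (base-two logarithm) -/

section Information

variable {Ω U V : Type*} [Fintype Ω] [Fintype U] [Fintype V]

open scoped Classical in
/-- The law of the random variable `S : Ω → U` when the sample space has the probability mass
function `p`. -/
noncomputable def law (p : Ω → ℝ) (S : Ω → U) (u : U) : ℝ :=
  ∑ ω, if S ω = u then p ω else 0

/-- The conditional probability `μ_{S|T}(u|v)` (with value `0` where `μ_T(v) = 0`). -/
noncomputable def condProb (p : Ω → ℝ) (S : Ω → U) (T : Ω → V) (u : U) (v : V) : ℝ :=
  law p (fun ω => (S ω, T ω)) (u, v) / law p T v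

/-- The entropy `H(S)` in bits. -/
noncomputable def entropy (p : Ω → ℝ) (S : Ω → U) : ℝ :=
  ∑ u, law p S u * Real.logb 2 (1 / law p S u)

/-- The conditional entropy `H(S|T)` in bits. -/
noncomputable def condEntropy (p : Ω → ℝ) (S : Ω → U) (T : Ω → V) : ℝ :=
  ∑ u, ∑ v, condProb p S T u v * law p T v * Real.logb 2 (1 / condProb p S T u v)

/-- The mutual information `I(S;T) = H(S) - H(S|T)`. -/
noncomputable def mutualInfo (p : Ω → ℝ) (S : Ω → U) (T : Ω → V) : ℝ :=
  entropy p S - condEntropy p S T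

/-- The memoryless extension `∏ᵢ μ_{S|T}(uᵢ|vᵢ)` of a conditional distribution. -/
noncomputable def condProbSeq (p : Ω → ℝ) (S : Ω → U) (T : Ω → V) {n : ℕ}
    (v : Fin n → V) (u : Fin n → U) : ℝ :=
  ∏ i, condProb p S T (u i) (v i)

end Information

/-- `ζ_𝒰(γ) = γ - √(2γ) log (√(2γ) / |𝒰|)` for an alphabet of size `k`. -/
noncomputable def zeta (k : ℕ) (γ : ℝ) : ℝ :=
  γ - Real.sqrt (2 * γ) * Real.logb 2 (Real.sqrt (2 * γ) / k)

/-! ### Ensembles of functions and the hash property -/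

open scoped Classical in
/-- An ensemble: a set of functions `Ω → V` with a probability distribution on it. -/
structure Ensemble (Ω V : Type*) [Fintype Ω] [Fintype V] where
  carrier : Set (Ω → V)
  prob : (Ω → V) → ℝ
  prob_nonneg : ∀ f, 0 ≤ prob f
  prob_eq_zero : ∀ f, f ∉ carrier → prob f = 0
  prob_sum : ∑ f, prob f = 1

namespace Ensemble

variable {Ω V V' : Type*} [Fintype Ω] [Fintype V] [Fintype V']

/-- `Im 𝒜`: the union of the ranges of the functions of the ensemble. -/
def image (E : Ensemble Ω V) : Set V := {v | ∃ f ∈ E.carrier, ∃ u, f u = v}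

open scoped Classical in
/-- The probability that a function drawn from the ensemble takes the same value at `u`
and `u'`. -/
noncomputable def collision (E : Ensemble Ω V) (u u' : Ω) : ℝ :=
  ∑ f, if f u = f u' then E.prob f else 0

open scoped Classical in
/-- The joint ensemble of the functions `u ↦ (A u, B u)`, with `A` and `B` drawn
independently. -/
noncomputable def prod (E : Ensemble Ω V) (F : Ensemble Ω V') : Ensemble Ω (V × V') where
  carrier := {f | (fun u => (f u).1) ∈ E.carrier ∧ (fun u => (f u).2) ∈ F.carrier}
  prob f := E.prob (fun u => (f u).1) * F.prob (fun u => (f u).2)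
  prob_nonneg f := mul_nonneg (E.prob_nonneg _) (F.prob_nonneg _)
  prob_eq_zero f hf := by
    by_cases h : (fun u => (f u).1) ∈ E.carrier
    · have h' : (fun u => (f u).2) ∉ F.carrier := fun h2 => hf ⟨h, h2⟩
      rw [F.prob_eq_zero _ h', mul_zero]
    · rw [E.prob_eq_zero _ h, zero_mul]
  prob_sum := by
    rw [Fintype.sum_equiv (Equiv.arrowProdEquivProdArrow Ω (fun _ => V) (fun _ => V'))
      (fun f => E.prob (fun u => (f u).1) * F.prob (fun u => (f u).2))
      (fun q => E.prob q.1 * F.prob q.2) (fun f => rfl)]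
    rw [Fintype.sum_prod_type, ← Finset.sum_mul_sum, E.prob_sum, F.prob_sum, mul_one]

end Ensemble

open scoped Classical in
/-- The hash property of a sequence of ensembles, where `R n` is the set that plays the part of
the image of the `n`-th ensemble. -/
def HashPropertyOn {Ω V : ℕ → Type*} [∀ n, Fintype (Ω n)] [∀ n, Fintype (V n)]
    (E : ∀ n, Ensemble (Ω n) (V n)) (R : ∀ n, Set (V n)) : Prop :=
  Filter.Tendsto (fun n : ℕ => Real.logb 2 ((Fintype.card (V n) : ℝ) / (R n).ncard) / n)
    Filter.atTop (nhds 0) ∧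
  ∃ α β : ℕ → ℝ, Filter.Tendsto α Filter.atTop (nhds 1) ∧
    Filter.Tendsto β Filter.atTop (nhds 0) ∧
    ∀ n, 1 ≤ n → ∀ T T' : Finset (Ω n),
      ∑ u ∈ T, ∑ u' ∈ T', (E n).collision u u' ≤
        ((T ∩ T').card : ℝ) + (T.card : ℝ) * T'.card * α n / (R n).ncard
          + (min T.card T'.card : ℕ) * β n

/-- The hash property of a sequence of ensembles. -/
def HasHashProperty {Ω V : ℕ → Type*} [∀ n, Fintype (Ω n)] [∀ n, Fintype (V n)]
    (E : ∀ n, Ensemble (Ω n) (V n)) : Prop :=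
  HashPropertyOn E (fun n => (E n).image)

/-- The hash property of the joint ensemble `𝒜 × ℬ` of independent ensembles on the same domain;
its image is read as `Im 𝒜 × Im ℬ`, so that it has `|Im 𝒜| |Im ℬ|` elements. -/
def HasJointHashProperty {Ω V V' : ℕ → Type*} [∀ n, Fintype (Ω n)] [∀ n, Fintype (V n)]
    [∀ n, Fintype (V' n)] (E : ∀ n, Ensemble (Ω n) (V n)) (F : ∀ n, Ensemble (Ω n) (V' n)) :
    Prop :=
  HashPropertyOn (fun n => (E n).prod (F n)) (fun n => (E n).image ×ˢ (F n).image)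

/-! ### Maximum-likelihood coding functions -/

/-- `u` maximizes `f` over the set `C`. -/
def IsMaximizer {Ω : Type*} (f : Ω → ℝ) (C : Set Ω) (u : Ω) : Prop :=
  u ∈ C ∧ ∀ u' ∈ C, f u' ≤ f u

/-- `u` maximizes `f` over `C` and has the least rank among all maximizers. -/
def IsFirstMaximizer {Ω : Type*} (rank : Ω → ℕ) (f : Ω → ℝ) (C : Set Ω) (u : Ω) : Prop :=
  IsMaximizer f C u ∧ ∀ u', IsMaximizer f C u' → rank u ≤ rank u'

/-! ### The channel with state and its code -/

section Channel

variable {X Y Z W : Type*} [Fintype X] [Fintype Y] [Fintype Z] [Fintype W]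

/-- The joint distribution
`μ_{XYZW}(x,y,z,w) = μ_{XW|Z}(x,w|z) μ_{Y|XZ}(y|x,z) μ_Z(z)`. -/
def joint (μZ : Z → ℝ) (μXW : Z → X × W → ℝ) (μY : X → Z → Y → ℝ) : X × Y × Z × W → ℝ :=
  fun ω => μXW ω.2.2.1 (ω.1, ω.2.2.2) * μY ω.1 ω.2.2.1 ω.2.1 * μZ ω.2.2.1

/-- The random variable `X`. -/
def rvX : X × Y × Z × W → X := fun ω => ω.1
/-- The random variable `Y`. -/
def rvY : X × Y × Z × W → Y := fun ω => ω.2.1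
/-- The random variable `Z`. -/
def rvZ : X × Y × Z × W → Z := fun ω => ω.2.2.1
/-- The random variable `W`. -/
def rvW : X × Y × Z × W → W := fun ω => ω.2.2.2
/-- The pair `(Z, W)`. -/
def rvZW : X × Y × Z × W → Z × W := fun ω => (ω.2.2.1, ω.2.2.2)

/-- `I(W;Y) - I(W;Z)`. -/
noncomputable def gain (μZ : Z → ℝ) (μXW : Z → X × W → ℝ) (μY : X → Z → Y → ℝ) : ℝ :=
  mutualInfo (joint μZ μXW μY) rvW rvY - mutualInfo (joint μZ μXW μY) rvW rvZ

/-- The Gel'fand-Pinsker capacity: the supremum of `I(W;Y) - I(W;Z)` over all finite alphabets of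
`W` and all conditional distributions `μ_{XW|Z}`. -/
noncomputable def capacity (μZ : Z → ℝ) (μY : X → Z → Y → ℝ) : ℝ :=
  sSup {r | ∃ (k : ℕ) (κ : Z → X × Fin k → ℝ),
    (∀ z, κ z ∈ stdSimplex ℝ (X × Fin k)) ∧ r = gain μZ κ μY}

/-- The natural number `l` is the real number `x` rounded down or up; it is `0` if `x ≤ 0`. -/
def IsRounding (l : ℕ) (x : ℝ) : Prop := l = ⌊x⌋₊ ∨ l = ⌈x⌉₊

/-- The numbers of output symbols of the functions `A`, `B`, `Â` at every block length `n`. -/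
def IsLengths (μZ : Z → ℝ) (μXW : Z → X × W → ℝ) (μY : X → Z → Y → ℝ) (εA εB εA' : ℝ)
    (lA lB lA' : ℕ → ℕ) : Prop :=
  ∀ n : ℕ,
    IsRounding (lA n)
      (n * (condEntropy (joint μZ μXW μY) rvW rvY + εA) / Real.logb 2 (Fintype.card W)) ∧
    IsRounding (lB n)
      (n * (gain μZ μXW μY - εB) / Real.logb 2 (Fintype.card W)) ∧
    IsRounding (lA' n)
      (n * (condEntropy (joint μZ μXW μY) rvX rvZW - εA') / Real.logb 2 (Fintype.card X))

/-- The conditions on `ε_𝒜`, `ε_ℬ`, `ε_𝒜̂` for alphabets `𝒳`, `𝒴`, `𝒲` of sizes `x`, `y`, `w`. -/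
def Admissible (x y w : ℕ) (εA εB εA' : ℝ) : Prop :=
  0 < εA ∧ 0 < εB ∧ 0 < εA' ∧ 0 < εB - εA ∧
  εB - εA ≤ Real.sqrt (6 * (εB - εA)) * Real.logb 2 x ∧
  Real.sqrt (6 * (εB - εA)) * Real.logb 2 x < εA' ∧
  2 * zeta (y * w) (6 * εA') < εA

/-- The rate `log |Im ℬ| / n`. -/
noncomputable def rate {n l : ℕ} (ℬ : Ensemble (Fin n → W) (Fin l → W)) : ℝ :=
  Real.logb 2 (ℬ.image.ncard) / n

open scoped Classical in
/-- The error probability when the message is uniform on the set `M`, the state sequence is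
independent of it and i.i.d. with law `μZ`, and the channel is memoryless. -/
noncomputable def errorProb (μZ : Z → ℝ) (μY : X → Z → Y → ℝ) {n l : ℕ}
    (M : Set (Fin l → W)) (enc : (Fin l → W) → (Fin n → Z) → (Fin n → X))
    (dec : (Fin n → Y) → (Fin l → W)) : ℝ :=
  ∑ m : Fin l → W, ∑ y : Fin n → Y, ∑ z : Fin n → Z,
    (if m ∈ M then 1 / (M.ncard : ℝ) else 0) * (∏ i, μZ (z i)) *
      (∏ i, μY (enc m z i) (z i) (y i)) * (if dec y ≠ m then 1 else 0)

/-- There are functions `A`, `B`, `Â` of the ensembles and vectors `c ∈ Im A`, `ĉ ∈ Im Â` whose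
code has rate at least `ρ` and error probability below `δ`.  The encoder is
`g_Â(ĉ | z, g_AB(c, m | z))` and the decoder is `B g_A(c | y)`, with maximum-likelihood coding
functions `g_AB`, `g_Â`, `g_A`.  The encoder breaks ties by the given ranks of the sequences; ties
of the decoder, and the value of `g_AB` where there is no candidate, are arbitrary. -/
def ExistsCode (μZ : Z → ℝ) (μXW : Z → X × W → ℝ) (μY : X → Z → Y → ℝ) {n lA lB lA' : ℕ}
    (𝒜 : Ensemble (Fin n → W) (Fin lA → W)) (ℬ : Ensemble (Fin n → W) (Fin lB → W))
    (𝒜' : Ensemble (Fin n → X) (Fin lA' → X))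
    (rankW : (Fin n → W) → ℕ) (rankX : (Fin n → X) → ℕ) (ρ δ : ℝ) : Prop :=
  ∃ A ∈ 𝒜.carrier, ∃ B ∈ ℬ.carrier, ∃ A' ∈ 𝒜'.carrier,
    ∃ c ∈ Set.range A, ∃ c' ∈ Set.range A',
      ρ ≤ rate ℬ ∧
      ∀ (gAB : (Fin lB → W) → (Fin n → Z) → (Fin n → W))
        (gA' : (Fin n → Z) → (Fin n → W) → (Fin n → X))
        (gA : (Fin n → Y) → (Fin n → W)),
        (∀ m z, {w | A w = c ∧ B w = m}.Nonempty →
          IsFirstMaximizer rankW (condProbSeq (joint μZ μXW μY) rvW rvZ z)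
            {w | A w = c ∧ B w = m} (gAB m z)) →
        (∀ z w, IsFirstMaximizer rankX
          (condProbSeq (joint μZ μXW μY) rvX rvZW (fun i => (z i, w i)))
            {x | A' x = c'} (gA' z w)) →
        (∀ y, IsMaximizer (condProbSeq (joint μZ μXW μY) rvW rvY y) {w | A w = c} (gA y)) →
        errorProb μZ μY ℬ.image (fun m z => gA' z (gAB m z)) (fun y => B (gA y)) < δ

end Channel

end GP

namespace GP

/-! The proof is random coding with bins. The functions `A`, `B`, `Â` are drawn from their ensembles
and `c`, `m`, `ĉ` uniformly from the images. For a state sequence `z` that is not exceptional, let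
`T z` be the initial segment, in the encoder's order (decreasing likelihood, ties by rank), of about
`K |Im 𝒜| |Im ℬ|` words, with `K` a constant. This set is fixed before the code is drawn. If the bin
of `(c, m)` meets `T z`, the encoder's maximizer lies in `T z` (`IsBest.mem_of_isFirstMaximizer`),
and by the second moment bound `missProbOn_le` the hash property makes a miss unlikely. The same is
done with a set `S z w` of channel inputs and the bins of `Â`.

A word lies in the random bin with probability `1 / (|Im 𝒜| |Im ℬ|)` whatever `A` is, since `c` is
uniform (`avg_bin`). So summing over `T z` costs only the factor `K + 1`, and `A` is still random
when its collisions are estimated. Since `|Im 𝒜| |Im ℬ|` is about `2 ^ (n (H(W|Z) - (εB - εA)))`,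
the segment `T z` is no larger than the set of typical words and inherits their likelihood
(`exists_isBest_of_large`). Hence the code's choice of `w` is dominated by the memoryless law up to
a factor of exponent about `εB - εA`, and similarly for `x` (`sum_state_word_le`, `sum_input_le`).
Events whose memoryless probability has a larger exponent stay negligible for the code. Two are
needed: the entropy of `X` along `(z, w)` is far from its mean (`tail_entX_le`), and `w` is unlikely
given `y` (`sum_prod_ind_condProb_lt_le`). The conditions on the parameters let these exponents win.

If `w` is likely given `y`, at most about `2 ^ (n (H(W|Y) + εA))` words are as likely, fewer than
`|Im 𝒜|` by an exponential factor, so another one in the bin of `w` is improbable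
(`HashPropertyOn.eventually_collision_le`).

The estimates are added in `exists_code_of_bounds`, turned into a statement on every admissible
encoder and decoder in `error_lt_of_cost_lt`, collected with abstract exponents in
`eventually_existsCode`, and given actual exponents in `eventually_existsCode_of_admissible`. For
the capacity claim, half of `η` covers `εB` and half is used as `δ`; small parameters exist because
`ζ` tends to `0` at `0`. -/

open scoped Classical in
/-- The indicator of a proposition, as a real number. -/
noncomputable def ind (p : Prop) : ℝ := if p then 1 else 0

theorem ind_true {p : Prop} (h : p) : ind p = 1 := if_pos h

theorem ind_false {p : Prop} (h : ¬ p) : ind p = 0 := if_neg h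

theorem ind_nonneg (p : Prop) : 0 ≤ ind p := by
  unfold ind; split_ifs <;> norm_num

theorem ind_le_one (p : Prop) : ind p ≤ 1 := by
  unfold ind; split_ifs <;> norm_num

theorem ind_mono {p q : Prop} (h : p → q) : ind p ≤ ind q := by
  by_cases hp : p
  · rw [ind_true hp, ind_true (h hp)]
  · rw [ind_false hp]; exact ind_nonneg q

theorem ind_and (p q : Prop) : ind (p ∧ q) = ind p * ind q := by
  by_cases hp : p <;> by_cases hq : q <;> simp [ind, hp, hq]

/-! ### Averages over an ensemble and a uniformly drawn value -/

namespace Ensemble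

variable {Ω V : Type*} [Fintype Ω] [Fintype V]

theorem carrier_nonempty (E : Ensemble Ω V) : E.carrier.Nonempty := by
  by_contra h
  rw [Set.not_nonempty_iff_eq_empty] at h
  have h1 := E.prob_sum
  rw [Finset.sum_eq_zero (fun f _ => E.prob_eq_zero f (by simp [h]))] at h1
  exact zero_ne_one h1

theorem mem_image_of_mem (E : Ensemble Ω V) {f : Ω → V} (hf : f ∈ E.carrier) (u : Ω) :
    f u ∈ E.image := ⟨f, hf, u, rfl⟩

theorem image_nonempty [Nonempty Ω] (E : Ensemble Ω V) : E.image.Nonempty := by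
  obtain ⟨f, hf⟩ := E.carrier_nonempty
  exact ⟨_, E.mem_image_of_mem hf (Classical.arbitrary Ω)⟩

theorem ncard_image_pos [Nonempty Ω] (E : Ensemble Ω V) : 0 < (E.image.ncard : ℝ) := by
  have := (Set.ncard_pos (s := E.image)).2 E.image_nonempty
  exact_mod_cast this

/-- The uniform distribution on the image of the ensemble. -/
noncomputable def unif (E : Ensemble Ω V) (c : V) : ℝ := ind (c ∈ E.image) * (1 / E.image.ncard)

open scoped Classical in
/-- The expectation of a function of a random element of the ensemble. -/
noncomputable def expect (E : Ensemble Ω V) (φ : (Ω → V) → ℝ) : ℝ := ∑ f, E.prob f * φ f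

theorem expect_add (E : Ensemble Ω V) (φ ψ : (Ω → V) → ℝ) :
    E.expect (fun f => φ f + ψ f) = E.expect φ + E.expect ψ := by
  simp only [expect, mul_add, Finset.sum_add_distrib]

theorem expect_const_mul (E : Ensemble Ω V) (a : ℝ) (φ : (Ω → V) → ℝ) :
    E.expect (fun f => a * φ f) = a * E.expect φ := by
  simp only [expect, Finset.mul_sum]
  exact Finset.sum_congr rfl fun _ _ => by ring

theorem expect_const (E : Ensemble Ω V) (a : ℝ) : E.expect (fun _ => a) = a := by
  simp only [expect, ← Finset.sum_mul, E.prob_sum, one_mul]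

theorem expect_sum (E : Ensemble Ω V) {ι : Type*} (s : Finset ι) (φ : ι → (Ω → V) → ℝ) :
    E.expect (fun f => ∑ j ∈ s, φ j f) = ∑ j ∈ s, E.expect (φ j) := by
  simp only [expect, Finset.mul_sum]
  exact Finset.sum_comm

theorem expect_mono (E : Ensemble Ω V) {φ ψ : (Ω → V) → ℝ} (h : ∀ f ∈ E.carrier, φ f ≤ ψ f) :
    E.expect φ ≤ E.expect ψ := by
  refine Finset.sum_le_sum fun f _ => ?_
  by_cases hf : f ∈ E.carrier
  · exact mul_le_mul_of_nonneg_left (h f hf) (E.prob_nonneg f)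
  · simp [E.prob_eq_zero f hf]

/-- The weight of a function of the ensemble and an independent uniform point of the image. -/
noncomputable def weight (E : Ensemble Ω V) (i : (Ω → V) × V) : ℝ :=
  E.prob i.1 * E.unif i.2

open scoped Classical in
/-- The average over a function of the ensemble and an independent uniform point of the image. -/
noncomputable def avg (E : Ensemble Ω V) (F : (Ω → V) × V → ℝ) : ℝ :=
  ∑ i, E.weight i * F i

theorem weight_nonneg (E : Ensemble Ω V) (i : (Ω → V) × V) : 0 ≤ E.weight i := by
  have := E.prob_nonneg i.1
  have := ind_nonneg (i.2 ∈ E.image)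
  unfold weight unif
  positivity

theorem mem_of_weight_ne_zero (E : Ensemble Ω V) {i : (Ω → V) × V} (h : E.weight i ≠ 0) :
    i.1 ∈ E.carrier ∧ i.2 ∈ E.image := by
  unfold weight at h
  constructor
  · by_contra h'
    rw [E.prob_eq_zero _ h', zero_mul] at h
    exact h rfl
  · by_contra h'
    rw [unif, ind_false h', zero_mul, mul_zero] at h
    exact h rfl

theorem sum_unif [Nonempty Ω] (E : Ensemble Ω V) : ∑ c : V, E.unif c = 1 := by
  classical
  simp only [unif, ind, ite_mul, one_mul, zero_mul]
  rw [← Finset.sum_filter, Finset.sum_const, nsmul_eq_mul]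
  have : (Finset.univ.filter (fun c => c ∈ E.image)).card = E.image.ncard := by
    rw [← Set.ncard_coe_finset]
    congr 1
    ext; simp
  rw [this]
  have := E.ncard_image_pos
  field_simp

open scoped Classical in
theorem avg_eq (E : Ensemble Ω V) (F : (Ω → V) × V → ℝ) :
    E.avg F = E.expect (fun f => ∑ c : V, E.unif c * F (f, c)) := by
  unfold avg expect
  rw [Fintype.sum_prod_type]
  refine Finset.sum_congr rfl fun f _ => ?_
  rw [Finset.mul_sum]
  refine Finset.sum_congr rfl fun c _ => ?_
  simp only [weight, mul_assoc]

theorem avg_mono (E : Ensemble Ω V) {F G : (Ω → V) × V → ℝ}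
    (h : ∀ i, i.1 ∈ E.carrier → i.2 ∈ E.image → F i ≤ G i) : E.avg F ≤ E.avg G := by
  unfold avg
  refine Finset.sum_le_sum fun i _ => ?_
  by_cases hw : E.weight i = 0
  · rw [hw]; simp
  · obtain ⟨h1, h2⟩ := E.mem_of_weight_ne_zero hw
    exact mul_le_mul_of_nonneg_left (h i h1 h2) (E.weight_nonneg i)

theorem avg_add (E : Ensemble Ω V) (F G : (Ω → V) × V → ℝ) :
    E.avg (fun i => F i + G i) = E.avg F + E.avg G := by
  simp only [avg, mul_add, Finset.sum_add_distrib]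

theorem avg_const_mul (E : Ensemble Ω V) (a : ℝ) (F : (Ω → V) × V → ℝ) :
    E.avg (fun i => a * F i) = a * E.avg F := by
  simp only [avg, Finset.mul_sum]
  exact Finset.sum_congr rfl fun _ _ => by ring

theorem avg_const [Nonempty Ω] (E : Ensemble Ω V) (a : ℝ) : E.avg (fun _ => a) = a := by
  rw [avg_eq]
  simp only [← Finset.sum_mul, sum_unif, expect_const, one_mul]

theorem avg_sum (E : Ensemble Ω V) {ι : Type*} (s : Finset ι) (F : ι → (Ω → V) × V → ℝ) :
    E.avg (fun i => ∑ j ∈ s, F j i) = ∑ j ∈ s, E.avg (F j) := by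
  simp only [avg, Finset.mul_sum]
  exact Finset.sum_comm

theorem avg_comm {Ω' V' : Type*} [Fintype Ω'] [Fintype V'] (E : Ensemble Ω V)
    (E' : Ensemble Ω' V') (F : (Ω → V) × V → (Ω' → V') × V' → ℝ) :
    E.avg (fun i => E'.avg (F i)) = E'.avg (fun j => E.avg (fun i => F i j)) := by
  simp only [avg, Finset.mul_sum]
  rw [Finset.sum_comm]
  exact Finset.sum_congr rfl fun _ _ => Finset.sum_congr rfl fun _ _ => by ring

/-- For each fixed function exactly one value of the image puts `u` into its bin, so the average
over the value gives the same factor for every function. Bin membership thus decouples from `φ` even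
though both depend on the same function, as encoding and decoding both depend on `A`. -/
theorem avg_bin (E : Ensemble Ω V) (u : Ω) (φ : (Ω → V) → ℝ) :
    E.avg (fun i => ind (i.1 u = i.2) * φ i.1) = E.expect φ / E.image.ncard := by
  classical
  rw [avg_eq, expect, expect, Finset.sum_div]
  refine Finset.sum_congr rfl fun f _ => ?_
  by_cases hf : f ∈ E.carrier
  · rw [Finset.sum_eq_single (f u)]
    · simp [E.mem_image_of_mem hf u, ind, unif]; ring
    · intro c _ hc
      simp [hc.symm, ind]
    · simp
  · simp [E.prob_eq_zero f hf]

theorem exists_lt_of_avg_lt [Nonempty Ω] (E : Ensemble Ω V) {F : (Ω → V) × V → ℝ} {δ : ℝ}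
    (h : E.avg F < δ) : ∃ i : (Ω → V) × V, i.1 ∈ E.carrier ∧ i.2 ∈ E.image ∧ F i < δ := by
  by_contra! hc
  have := E.avg_mono (F := fun _ => δ) (G := F) (fun i h1 h2 => hc i h1 h2)
  rw [avg_const] at this
  linarith

/-- This form serves `ℬ`: the function is fixed while its value, the message, stays random. -/
theorem exists_fun_lt_of_avg_lt (E : Ensemble Ω V) {F : (Ω → V) × V → ℝ} {δ : ℝ}
    (h : E.avg F < δ) : ∃ f ∈ E.carrier, ∑ c : V, E.unif c * F (f, c) < δ := by
  by_contra! hc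
  rw [avg_eq] at h
  have := E.expect_mono (φ := fun _ => δ) hc
  rw [expect_const] at this
  linarith

end Ensemble

/-! ### One-shot random coding -/

section OneShot

variable {X Y Z W VA VB VX : Type*} [Fintype Y]

/-- The event that the decoder may confuse `w` with another word of its bin. -/
def Confusable (L : Y → W → ℝ) (A : W → VA) (w : W) (y : Y) : Prop :=
  ∃ w', w' ≠ w ∧ L y w ≤ L y w' ∧ A w' = A w

/-- A bound for the error probability once the state `z` and the auxiliary word `w` are chosen. -/
noncomputable def innerCost (PY : X → Z → Y → ℝ) (L : Y → W → ℝ) (S : Z → W → Finset X)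
    (b1 : Z → W → Prop) (b2 : W → Y → Prop) (A : W → VA) (A' : X → VX) (c' : VX) (z : Z) (w : W) :
    ℝ :=
  ind (b1 z w) + ind (¬ b1 z w) * (ind (∀ x ∈ S z w, A' x ≠ c') +
      ∑ x ∈ S z w, ind (A' x = c') * ∑ y, PY x z y *
        (ind (b2 w y) + ind (¬ b2 w y) * ind (Confusable L A w y)))

/-- A bound for the error probability of the message `m` when the state is `z`. -/
noncomputable def codeCost (PY : X → Z → Y → ℝ) (L : Y → W → ℝ) (T : Z → Finset W)
    (S : Z → W → Finset X) (bz : Z → Prop) (b1 : Z → W → Prop) (b2 : W → Y → Prop)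
    (A : W → VA) (c : VA) (B : W → VB) (m : VB) (A' : X → VX) (c' : VX) (z : Z) : ℝ :=
  ind (bz z) + ind (¬ bz z) * (ind (∀ w ∈ T z, ¬ (A w = c ∧ B w = m)) +
      ∑ w ∈ T z, ind (B w = m) * (ind (A w = c) * innerCost PY L S b1 b2 A A' c' z w))

variable (PY : X → Z → Y → ℝ) (L : Y → W → ℝ) (T : Z → Finset W)
    (S : Z → W → Finset X) (bz : Z → Prop) (b1 : Z → W → Prop) (b2 : W → Y → Prop)
    (A : W → VA) (c : VA) (B : W → VB) (m : VB) (A' : X → VX) (c' : VX)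

theorem innerCost_summand_nonneg (hPY : ∀ x z y, 0 ≤ PY x z y) (z : Z) (w : W) (x : X) :
    0 ≤ ind (A' x = c') * ∑ y, PY x z y *
        (ind (b2 w y) + ind (¬ b2 w y) * ind (Confusable L A w y)) :=
  mul_nonneg (ind_nonneg _) (Finset.sum_nonneg fun _ _ => mul_nonneg (hPY _ _ _)
    (add_nonneg (ind_nonneg _) (mul_nonneg (ind_nonneg _) (ind_nonneg _))))

theorem innerCost_nonneg (hPY : ∀ x z y, 0 ≤ PY x z y) (z : Z) (w : W) :
    0 ≤ innerCost PY L S b1 b2 A A' c' z w :=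
  add_nonneg (ind_nonneg _) (mul_nonneg (ind_nonneg _) (add_nonneg (ind_nonneg _)
    (Finset.sum_nonneg fun x _ => innerCost_summand_nonneg PY L b2 A A' c' hPY z w x)))

theorem codeCost_summand_nonneg (hPY : ∀ x z y, 0 ≤ PY x z y) (z : Z) (w : W) :
    0 ≤ ind (B w = m) * (ind (A w = c) * innerCost PY L S b1 b2 A A' c' z w) :=
  mul_nonneg (ind_nonneg _) (mul_nonneg (ind_nonneg _)
    (innerCost_nonneg PY L S b1 b2 A A' c' hPY z w))

theorem one_le_codeCost_of_bad (hPY : ∀ x z y, 0 ≤ PY x z y) (z : Z)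
    (h : bz z ∨ ∀ w ∈ T z, ¬ (A w = c ∧ B w = m)) :
    1 ≤ codeCost PY L T S bz b1 b2 A c B m A' c' z := by
  have h0 : 0 ≤ ∑ w ∈ T z, ind (B w = m) * (ind (A w = c) * innerCost PY L S b1 b2 A A' c' z w) :=
    Finset.sum_nonneg fun w _ => codeCost_summand_nonneg PY L S b1 b2 A c B m A' c' hPY z w
  unfold codeCost
  by_cases hz : bz z
  · rw [ind_true hz, ind_false (not_not.2 hz)]; simp
  · rw [ind_false hz, ind_true hz, ind_true (h.resolve_left hz)]
    linarith

theorem innerCost_le_codeCost (hPY : ∀ x z y, 0 ≤ PY x z y) (z : Z) (hz : ¬ bz z) {w : W}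
    (hw : w ∈ T z) (hA : A w = c) (hB : B w = m) :
    innerCost PY L S b1 b2 A A' c' z w ≤ codeCost PY L T S bz b1 b2 A c B m A' c' z := by
  have h1 := Finset.single_le_sum
    (fun w _ => codeCost_summand_nonneg PY L S b1 b2 A c B m A' c' hPY z w) hw
  rw [ind_true hA, ind_true hB, one_mul, one_mul] at h1
  unfold codeCost
  rw [ind_false hz, ind_true hz]
  have := ind_nonneg (∀ w ∈ T z, ¬ (A w = c ∧ B w = m))
  linarith

theorem one_le_innerCost_of_bad (hPY : ∀ x z y, 0 ≤ PY x z y) (z : Z) (w : W)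
    (h : b1 z w ∨ ∀ x ∈ S z w, A' x ≠ c') :
    1 ≤ innerCost PY L S b1 b2 A A' c' z w := by
  have h0 := Finset.sum_nonneg (s := S z w)
    fun x _ => innerCost_summand_nonneg PY L b2 A A' c' hPY z w x
  unfold innerCost
  by_cases hb : b1 z w
  · rw [ind_true hb, ind_false (not_not.2 hb)]; simp
  · rw [ind_false hb, ind_true hb, ind_true (h.resolve_left hb)]
    linarith

theorem sum_le_innerCost (hPY : ∀ x z y, 0 ≤ PY x z y) (z : Z) (w : W) (hb : ¬ b1 z w) {x : X}
    (hx : x ∈ S z w) (hA : A' x = c') (bad : Y → Prop)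
    (hbad : ∀ y, bad y → Confusable L A w y) :
    ∑ y, PY x z y * ind (bad y) ≤ innerCost PY L S b1 b2 A A' c' z w := by
  have h1 := Finset.single_le_sum
    (fun x _ => innerCost_summand_nonneg PY L b2 A A' c' hPY z w x) hx
  rw [ind_true hA, one_mul] at h1
  unfold innerCost
  rw [ind_false hb, ind_true hb]
  have h2 := ind_nonneg (∀ x ∈ S z w, A' x ≠ c')
  have h3 : ∑ y, PY x z y * ind (bad y) ≤ ∑ y, PY x z y *
        (ind (b2 w y) + ind (¬ b2 w y) * ind (Confusable L A w y)) := by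
    refine Finset.sum_le_sum fun y _ => mul_le_mul_of_nonneg_left ?_ (hPY _ _ _)
    refine (ind_mono (hbad y)).trans ?_
    by_cases h : b2 w y
    · rw [ind_true h, ind_false (not_not.2 h)]
      linarith [ind_le_one (Confusable L A w y)]
    · rw [ind_false h, ind_true h]; linarith
  linarith

end OneShot

/-! ### Averaging the cost over the random code -/

section OneShotAverage

variable {X Y Z W VA VB VX : Type*} [Fintype X] [Fintype Y] [Fintype W]
  [Fintype VA] [Fintype VB] [Fintype VX]

/-- The probability that no element of `S` lies in a random bin of the ensemble. -/
noncomputable def missProb {Ω V : Type*} [Fintype Ω] [Fintype V] (E : Ensemble Ω V)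
    (S : Finset Ω) : ℝ :=
  E.avg (fun i => ind (∀ u ∈ S, i.1 u ≠ i.2))

/-- The probability that no element of `T` lies in a random bin of two independent ensembles. -/
noncomputable def jointMissProb {Ω V V' : Type*} [Fintype Ω] [Fintype V] [Fintype V']
    (E : Ensemble Ω V) (F : Ensemble Ω V') (T : Finset Ω) : ℝ :=
  E.avg (fun i => F.avg (fun j => ind (∀ u ∈ T, ¬ (i.1 u = i.2 ∧ j.1 u = j.2))))

variable (PY : X → Z → Y → ℝ) (L : Y → W → ℝ) (T : Z → Finset W)
    (S : Z → W → Finset X) (bz : Z → Prop) (b1 : Z → W → Prop) (b2 : W → Y → Prop)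

omit [Fintype W] [Fintype VA] in
theorem avg_innerCost [Nonempty X] (EX : Ensemble X VX) (A : W → VA) (z : Z) (w : W) :
    EX.avg (fun i => innerCost PY L S b1 b2 A i.1 i.2 z w) =
      ind (b1 z w) + ind (¬ b1 z w) * (missProb EX (S z w) + (∑ x ∈ S z w, ∑ y, PY x z y *
        (ind (b2 w y) + ind (¬ b2 w y) * ind (Confusable L A w y))) / EX.image.ncard) := by
  unfold innerCost
  rw [EX.avg_add, EX.avg_const, EX.avg_const_mul, EX.avg_add, EX.avg_sum, Finset.sum_div]
  congr 3
  refine Finset.sum_congr rfl fun x _ => ?_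
  rw [EX.avg_bin x (fun _ => ∑ y, PY x z y *
        (ind (b2 w y) + ind (¬ b2 w y) * ind (Confusable L A w y))), EX.expect_const]

theorem avg_bin_bin (EA : Ensemble W VA) (EB : Ensemble W VB) (w : W) (J : (W → VA) → ℝ) :
    EA.avg (fun a => EB.avg (fun b => ind (b.1 w = b.2) * (ind (a.1 w = a.2) * J a.1))) =
      EA.expect J / (EA.image.ncard * EB.image.ncard) := by
  have hB : ∀ a : (W → VA) × VA, EB.avg (fun b => ind (b.1 w = b.2) * (ind (a.1 w = a.2) * J a.1))
        = (1 / (EB.image.ncard : ℝ)) * (ind (a.1 w = a.2) * J a.1) := by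
    intro a
    rw [EB.avg_bin w (fun _ => ind (a.1 w = a.2) * J a.1), EB.expect_const]
    ring
  simp only [hB]
  rw [EA.avg_const_mul, EA.avg_bin w J, mul_comm (EA.image.ncard : ℝ), ← div_div]
  ring

/-- The unknown choices of the encoder are replaced by sums over all of `T z` and `S z w`. Each term
carries a bin indicator that averages to the inverse number of bins, after which only the
expectation of the confusion event over `A` is left. -/
theorem avg_codeCost_le [Nonempty X] [Nonempty W] (hPY : ∀ x z y, 0 ≤ PY x z y)
    (EA : Ensemble W VA) (EB : Ensemble W VB) (EX : Ensemble X VX) {σ₁ σ₂ σ₅ : ℝ} (z : Z)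
    (h1 : ¬ bz z → jointMissProb EA EB (T z) ≤ σ₁)
    (h2 : ∀ w ∈ T z, ¬ bz z → ¬ b1 z w → missProb EX (S z w) ≤ σ₂)
    (h5 : ∀ w y, ¬ b2 w y → EA.expect (fun f => ind (Confusable L f w y)) ≤ σ₅) (hσ₅ : 0 ≤ σ₅) :
    EA.avg (fun a => EB.avg (fun b => EX.avg (fun x =>
      codeCost PY L T S bz b1 b2 a.1 a.2 b.1 b.2 x.1 x.2 z))) ≤
      ind (bz z) + ind (¬ bz z) * (σ₁ + (∑ w ∈ T z, (ind (b1 z w) + ind (¬ b1 z w) * (σ₂ +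
        (∑ x ∈ S z w, ∑ y, PY x z y * (ind (b2 w y) + σ₅)) / EX.image.ncard)))
          / (EA.image.ncard * EB.image.ncard)) := by
  unfold codeCost
  by_cases hz : bz z
  · simp only [ind_true hz, ind_false (not_not.2 hz), zero_mul, add_zero, Ensemble.avg_const]
    exact le_rfl
  simp only [ind_false hz, ind_true hz, zero_add, one_mul]
  simp only [EX.avg_add, EX.avg_const, EX.avg_sum, EX.avg_const_mul, avg_innerCost]
  simp only [EB.avg_add, EA.avg_add, EB.avg_sum, EA.avg_sum]
  refine add_le_add (h1 hz) ?_
  rw [Finset.sum_div]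
  refine Finset.sum_le_sum fun w hw => ?_
  rw [avg_bin_bin EA EB w (fun f => ind (b1 z w) + ind (¬ b1 z w) *
    (missProb EX (S z w) + (∑ x ∈ S z w, ∑ y, PY x z y *
        (ind (b2 w y) + ind (¬ b2 w y) * ind (Confusable L f w y))) / EX.image.ncard))]
  refine div_le_div_of_nonneg_right ?_ (by positivity)
  by_cases hb : b1 z w
  · simp [ind_true hb, ind_false (not_not.2 hb), EA.expect_const]
  simp only [ind_false hb, ind_true hb, zero_add, one_mul, div_eq_inv_mul]
  rw [EA.expect_add, EA.expect_const, EA.expect_const_mul, EA.expect_sum]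
  refine add_le_add (h2 w hw hz hb) (mul_le_mul_of_nonneg_left ?_ (by positivity))
  refine Finset.sum_le_sum fun x _ => ?_
  rw [EA.expect_sum]
  refine Finset.sum_le_sum fun y _ => ?_
  rw [EA.expect_const_mul, EA.expect_add, EA.expect_const, EA.expect_const_mul]
  refine mul_le_mul_of_nonneg_left (add_le_add le_rfl ?_) (hPY _ _ _)
  by_cases hb2 : b2 w y
  · simpa [ind_false (not_not.2 hb2)] using hσ₅
  · simpa [ind_true hb2] using h5 w y hb2

/-- One-shot random coding: some code costs no more than the bound for the average. -/
theorem exists_code_of_bounds [Fintype Z] [Nonempty X] [Nonempty W] (PZ : Z → ℝ)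
    (hPZ : ∀ z, 0 ≤ PZ z) (hPZ1 : ∑ z, PZ z = 1)
    (hPY : ∀ x z y, 0 ≤ PY x z y) (hPY1 : ∀ x z, ∑ y, PY x z y = 1)
    (EA : Ensemble W VA) (EB : Ensemble W VB) (EX : Ensemble X VX)
    {σ₀ σ₁ σ₂ σ₃ σ₄ σ₅ κ κ' δ : ℝ}
    (h0 : ∑ z, PZ z * ind (bz z) ≤ σ₀)
    (h1 : ∀ z, ¬ bz z → jointMissProb EA EB (T z) ≤ σ₁)
    (h2 : ∀ z, ∀ w ∈ T z, ¬ bz z → ¬ b1 z w → missProb EX (S z w) ≤ σ₂)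
    (h3 : ∑ z, PZ z * (ind (¬ bz z) * ((∑ w ∈ T z, ind (b1 z w)) /
      (EA.image.ncard * EB.image.ncard))) ≤ σ₃)
    (h4 : ∑ z, PZ z * (ind (¬ bz z) * ((∑ w ∈ T z, ind (¬ b1 z w) * ((∑ x ∈ S z w, ∑ y,
      PY x z y * ind (b2 w y)) / EX.image.ncard)) / (EA.image.ncard * EB.image.ncard))) ≤ σ₄)
    (h5 : ∀ w y, ¬ b2 w y → EA.expect (fun f => ind (Confusable L f w y)) ≤ σ₅)
    (hσ₁ : 0 ≤ σ₁) (hσ₂ : 0 ≤ σ₂) (hσ₅ : 0 ≤ σ₅) (hκ : 0 ≤ κ) (hκ' : 0 ≤ κ')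
    (hT : ∀ z, ¬ bz z → ((T z).card : ℝ) ≤ κ * (EA.image.ncard * EB.image.ncard))
    (hS : ∀ z, ∀ w ∈ T z, ¬ bz z → ¬ b1 z w → ((S z w).card : ℝ) ≤ κ' * EX.image.ncard)
    (hδ : σ₀ + σ₁ + σ₃ + κ * (σ₂ + κ' * σ₅) + σ₄ < δ) :
    ∃ A ∈ EA.carrier, ∃ c : VA, ∃ B ∈ EB.carrier, ∃ A' ∈ EX.carrier, ∃ c' : VX,
      ∑ m, EB.unif m * ∑ z, PZ z * codeCost PY L T S bz b1 b2 A c B m A' c' z < δ := by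
  have hrA := EA.ncard_image_pos
  have hrB := EB.ncard_image_pos
  have hrX := EX.ncard_image_pos
  have key : EA.avg (fun a => EB.avg (fun b => EX.avg (fun x =>
      ∑ z, PZ z * codeCost PY L T S bz b1 b2 a.1 a.2 b.1 b.2 x.1 x.2 z))) < δ := by
    simp only [EX.avg_sum, EB.avg_sum, EA.avg_sum, EX.avg_const_mul, EB.avg_const_mul,
      EA.avg_const_mul]
    refine lt_of_le_of_lt (Finset.sum_le_sum fun z _ => mul_le_mul_of_nonneg_left
      (avg_codeCost_le PY L T S bz b1 b2 hPY EA EB EX z (h1 z) (h2 z) h5 hσ₅) (hPZ z)) ?_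
    refine lt_of_le_of_lt ?_ hδ
    have hz : ∀ z, ind (bz z) + ind (¬ bz z) * (σ₁ + (∑ w ∈ T z, (ind (b1 z w) + ind (¬ b1 z w) *
        (σ₂ + (∑ x ∈ S z w, ∑ y, PY x z y * (ind (b2 w y) + σ₅)) / EX.image.ncard)))
          / (EA.image.ncard * EB.image.ncard)) ≤ ind (bz z) +
        ind (¬ bz z) * ((∑ w ∈ T z, ind (b1 z w)) / (EA.image.ncard * EB.image.ncard)) +
        ind (¬ bz z) * ((∑ w ∈ T z, ind (¬ b1 z w) * ((∑ x ∈ S z w, ∑ y,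
          PY x z y * ind (b2 w y)) / EX.image.ncard)) / (EA.image.ncard * EB.image.ncard)) +
        (σ₁ + κ * (σ₂ + κ' * σ₅)) := by
      intro z
      by_cases hb : bz z
      · simp only [ind_true hb, ind_false (not_not.2 hb), zero_mul, add_zero]
        have : 0 ≤ σ₁ + κ * (σ₂ + κ' * σ₅) := by positivity
        linarith
      simp only [ind_true hb, ind_false hb, one_mul, zero_add]
      have hw : ∀ w ∈ T z, ind (b1 z w) + ind (¬ b1 z w) *
          (σ₂ + (∑ x ∈ S z w, ∑ y, PY x z y * (ind (b2 w y) + σ₅)) / EX.image.ncard) ≤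
          ind (b1 z w) + ind (¬ b1 z w) * ((∑ x ∈ S z w, ∑ y,
          PY x z y * ind (b2 w y)) / EX.image.ncard) + (σ₂ + κ' * σ₅) := by
        intro w hwT
        by_cases h1 : b1 z w
        · simp only [ind_true h1, ind_false (not_not.2 h1), zero_mul, add_zero]
          have : 0 ≤ σ₂ + κ' * σ₅ := by positivity
          linarith
        simp only [ind_true h1, ind_false h1, one_mul, zero_add]
        have e : ∑ x ∈ S z w, ∑ y, PY x z y * (ind (b2 w y) + σ₅) =
            ∑ x ∈ S z w, ∑ y, PY x z y * ind (b2 w y) + (S z w).card * σ₅ := by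
          simp only [mul_add, Finset.sum_add_distrib, ← Finset.sum_mul, hPY1]
          simp
        rw [e, add_div]
        have : (S z w).card * σ₅ / EX.image.ncard ≤ κ' * σ₅ := by
          rw [div_le_iff₀ hrX]
          calc (S z w).card * σ₅ ≤ (κ' * EX.image.ncard) * σ₅ :=
                mul_le_mul_of_nonneg_right (hS z w hwT hb h1) hσ₅
            _ = _ := by ring
        linarith
      have h6 := div_le_div_of_nonneg_right (Finset.sum_le_sum hw)
        (show (0 : ℝ) ≤ EA.image.ncard * EB.image.ncard by positivity)
      rw [Finset.sum_add_distrib (g := fun _ => σ₂ + κ' * σ₅), Finset.sum_const, nsmul_eq_mul,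
        add_div, Finset.sum_add_distrib (g := fun w => ind (¬ b1 z w) * ((∑ x ∈ S z w, ∑ y,
          PY x z y * ind (b2 w y)) / EX.image.ncard)), add_div] at h6
      have h7 : (T z).card * (σ₂ + κ' * σ₅) / ((EA.image.ncard : ℝ) * EB.image.ncard) ≤
          κ * (σ₂ + κ' * σ₅) := by
        rw [div_le_iff₀ (by positivity)]
        calc (T z).card * (σ₂ + κ' * σ₅) ≤ (κ * (EA.image.ncard * EB.image.ncard)) *
              (σ₂ + κ' * σ₅) := mul_le_mul_of_nonneg_right (hT z hb) (by positivity)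
          _ = _ := by ring
      linarith
    refine (Finset.sum_le_sum fun z _ => mul_le_mul_of_nonneg_left (hz z) (hPZ z)).trans ?_
    simp only [mul_add, Finset.sum_add_distrib, ← Finset.sum_mul, hPZ1, one_mul]
    simp only [mul_add] at *
    linarith
  obtain ⟨a, ha, -, h⟩ := EA.exists_lt_of_avg_lt key
  -- The pairs `(A, c)` and `(Â, ĉ)` are fixed before `B`, so that the message alone remains
  -- averaged at the end.
  rw [EB.avg_comm] at h
  obtain ⟨x, hx, -, h⟩ := EX.exists_lt_of_avg_lt h
  obtain ⟨B, hB, h⟩ := EB.exists_fun_lt_of_avg_lt h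
  exact ⟨a.1, ha, a.2, B, hB, x.1, hx, x.2, h⟩

end OneShotAverage
-- Initial segments of the encoder's order, and the error of a cheap code
section Deterministic

variable {X Y Z W VA VB VX : Type*} [Fintype Y] [Fintype Z] [Fintype W] [Fintype VB]

/-- `S` consists of the best elements: every element of `S` comes before every element outside `S`
in the order by decreasing `f`, with ties broken by the rank. -/
def IsBest {Ω : Type*} (rank : Ω → ℕ) (f : Ω → ℝ) (S : Finset Ω) : Prop :=
  ∀ u ∈ S, ∀ u', u' ∉ S → f u' < f u ∨ (f u' = f u ∧ rank u < rank u')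

/-- An element outside an initial segment never precedes one inside. This is where a tie-breaking
order given in advance matters: the segment must not depend on the bin. -/
theorem IsBest.mem_of_isFirstMaximizer {Ω : Type*} {rank : Ω → ℕ} {f : Ω → ℝ} {S : Finset Ω}
    (hS : IsBest rank f S) {C : Set Ω} {g u : Ω} (hg : IsFirstMaximizer rank f C g) (hu : u ∈ S)
    (huC : u ∈ C) : g ∈ S := by
  by_contra h
  rcases hS u hu g h with h1 | ⟨h1, h2⟩
  · exact absurd (hg.1.2 u huC) (not_le.2 h1)
  · exact absurd (hg.2 u ⟨huC, fun u' hu' => h1 ▸ hg.1.2 u' hu'⟩) (not_le.2 h2)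

/-- Greedy construction: the next element has maximal `f` among those left and, among these, minimal
rank; injectivity makes the rank comparison strict. -/
theorem exists_isBest {Ω : Type*} [Fintype Ω] (rank : Ω → ℕ) (hr : Function.Injective rank)
    (f : Ω → ℝ) (N : ℕ) (hN : N ≤ Fintype.card Ω) : ∃ S : Finset Ω, S.card = N ∧
      IsBest rank f S := by
  classical
  induction N with
  | zero => exact ⟨∅, rfl, fun u hu => absurd hu (Finset.notMem_empty u)⟩
  | succ N ih =>
    obtain ⟨S, hS, hb⟩ := ih (Nat.le_of_succ_le hN)
    have hne : (Finset.univ \ S).Nonempty := by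
      rw [← Finset.card_pos, Finset.card_sdiff_of_subset (Finset.subset_univ S), hS,
        Finset.card_univ]
      omega
    obtain ⟨a, ha, hmax⟩ := Finset.exists_max_image (Finset.univ \ S) f hne
    have hne2 : ((Finset.univ \ S).filter (fun u => f u = f a)).Nonempty :=
      ⟨a, Finset.mem_filter.2 ⟨ha, rfl⟩⟩
    obtain ⟨b, hb1, hmin⟩ := Finset.exists_min_image _ rank hne2
    rw [Finset.mem_filter] at hb1
    have hbS : b ∉ S := (Finset.mem_sdiff.1 hb1.1).2
    refine ⟨insert b S, by rw [Finset.card_insert_of_notMem hbS, hS], ?_⟩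
    intro u hu u' hu'
    rw [Finset.mem_insert, not_or] at hu'
    rcases Finset.mem_insert.1 hu with rfl | hu
    · have h1 : f u' ≤ f u := by
        rw [hb1.2]; exact hmax u' (Finset.mem_sdiff.2 ⟨Finset.mem_univ _, hu'.2⟩)
      rcases h1.lt_or_eq with h2 | h2
      · exact Or.inl h2
      · refine Or.inr ⟨h2, lt_of_le_of_ne (hmin u' ?_) fun h => hu'.1 (hr h).symm⟩
        exact Finset.mem_filter.2 ⟨Finset.mem_sdiff.2 ⟨Finset.mem_univ _, hu'.2⟩,
          h2.trans hb1.2⟩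
    · exact hb u hu u' hu'.2

/-- An element of `S` below the level `t` would come after all of `G`, forcing `G ⊆ S`; by
cardinality `G = S`, which contains no such element. -/
theorem IsBest.le_of_card_le {Ω : Type*} {rank : Ω → ℕ} {f : Ω → ℝ} {S : Finset Ω}
    (hS : IsBest rank f S) {G : Finset Ω} {t : ℝ} (hG : ∀ u ∈ G, t ≤ f u)
    (hc : S.card ≤ G.card) {u : Ω} (hu : u ∈ S) : t ≤ f u := by
  by_contra h
  have hsub : G ⊆ S := by
    intro u' hu'
    by_contra h'
    have := hG u' hu'
    rcases hS u hu u' h' with h1 | ⟨h1, _⟩ <;> linarith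
  have := Finset.eq_of_subset_of_card_le hsub hc
  exact h (hG u (this ▸ hu))

variable (PY : X → Z → Y → ℝ) (L : Y → W → ℝ) (T : Z → Finset W)
    (S : Z → W → Finset X) (bz : Z → Prop) (b1 : Z → W → Prop) (b2 : W → Y → Prop)

/-- A random code of small cost has a small error probability, whatever the choices left to the
encoder and the decoder. -/
theorem error_lt_of_cost_lt [Nonempty W] (PZ : Z → ℝ)
    (hPZ : ∀ z, 0 ≤ PZ z) (hPZ1 : ∑ z, PZ z = 1)
    (hPY : ∀ x z y, 0 ≤ PY x z y) (hPY1 : ∀ x z, ∑ y, PY x z y = 1) (EB : Ensemble W VB)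
    (LW : Z → W → ℝ) (LX : Z → W → X → ℝ) (rankW : W → ℕ) (rankX : X → ℕ)
    (hT : ∀ z, ¬ bz z → IsBest rankW (LW z) (T z))
    (hS : ∀ z, ∀ w ∈ T z, ¬ bz z → ¬ b1 z w → IsBest rankX (LX z w) (S z w))
    {A : W → VA} {c : VA} {B : W → VB} {A' : X → VX} {c' : VX} {δ : ℝ} (hδ : δ ≤ 1)
    (h : ∑ m, EB.unif m * ∑ z, PZ z * codeCost PY L T S bz b1 b2 A c B m A' c' z < δ) :
    c ∈ Set.range A ∧ c' ∈ Set.range A' ∧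
    ∀ (gAB : VB → Z → W) (gA' : Z → W → X) (gA : Y → W),
      (∀ m z, {w | A w = c ∧ B w = m}.Nonempty →
        IsFirstMaximizer rankW (LW z) {w | A w = c ∧ B w = m} (gAB m z)) →
      (∀ z w, IsFirstMaximizer rankX (LX z w) {x | A' x = c'} (gA' z w)) →
      (∀ y, IsMaximizer (L y) {w | A w = c} (gA y)) →
      ∑ m, EB.unif m * ∑ z, PZ z * ∑ y, PY (gA' z (gAB m z)) z y * ind (B (gA y) ≠ m) < δ := by
  have hunif : ∀ m, 0 ≤ EB.unif m := fun m =>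
    mul_nonneg (ind_nonneg _) (by positivity)
  -- Since `δ ≤ 1`, some message and state cost less than `1`. If `c` or `c'` were outside the
  -- range, every bin would be missed and every cost would be at least `1`.
  have hlarge : ¬ ∀ m z, 1 ≤ codeCost PY L T S bz b1 b2 A c B m A' c' z := by
    intro hc
    have h1 : ∑ m, EB.unif m * ∑ z, PZ z * 1 ≤
        ∑ m, EB.unif m * ∑ z, PZ z * codeCost PY L T S bz b1 b2 A c B m A' c' z :=
      Finset.sum_le_sum fun m _ => mul_le_mul_of_nonneg_left (Finset.sum_le_sum fun z _ =>
        mul_le_mul_of_nonneg_left (hc m z) (hPZ z)) (hunif m)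
    simp only [mul_one, hPZ1, EB.sum_unif] at h1
    linarith
  refine ⟨?_, ?_, ?_⟩
  · by_contra hc
    refine hlarge fun m z => one_le_codeCost_of_bad PY L T S bz b1 b2 A c B m A' c' hPY z
      (Or.inr fun w _ hw => hc ⟨w, hw.1⟩)
  · by_contra hc
    refine hlarge fun m z => ?_
    by_cases hb : bz z ∨ ∀ w ∈ T z, ¬ (A w = c ∧ B w = m)
    · exact one_le_codeCost_of_bad PY L T S bz b1 b2 A c B m A' c' hPY z hb
    · push Not at hb
      obtain ⟨hz, w, hw, hA, hB⟩ := hb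
      exact (one_le_innerCost_of_bad PY L S b1 b2 A A' c' hPY z w
        (Or.inr fun x _ hx => hc ⟨x, hx⟩)).trans
        (innerCost_le_codeCost PY L T S bz b1 b2 A c B m A' c' hPY z hz hw hA hB)
  · intro gAB gA' gA hAB hA' hA
    refine lt_of_le_of_lt (Finset.sum_le_sum fun m _ => mul_le_mul_of_nonneg_left
      (Finset.sum_le_sum fun z _ => mul_le_mul_of_nonneg_left ?_ (hPZ z)) (hunif m)) h
    have hle1 : ∑ y, PY (gA' z (gAB m z)) z y * ind (B (gA y) ≠ m) ≤ 1 := by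
      rw [← hPY1 (gA' z (gAB m z)) z]
      exact Finset.sum_le_sum fun y _ => mul_le_of_le_one_right (hPY _ _ _) (ind_le_one _)
    by_cases hb : bz z ∨ ∀ w ∈ T z, ¬ (A w = c ∧ B w = m)
    · exact hle1.trans (one_le_codeCost_of_bad PY L T S bz b1 b2 A c B m A' c' hPY z hb)
    push Not at hb
    obtain ⟨hz, w, hw, hAw, hBw⟩ := hb
    have hg := hAB m z ⟨w, hAw, hBw⟩
    have hgT := (hT z hz).mem_of_isFirstMaximizer hg hw ⟨hAw, hBw⟩
    have hgC := hg.1.1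
    refine le_trans ?_ (innerCost_le_codeCost PY L T S bz b1 b2 A c B m A' c' hPY z hz hgT
      hgC.1 hgC.2)
    by_cases hb : b1 z (gAB m z) ∨ ∀ x ∈ S z (gAB m z), A' x ≠ c'
    · exact hle1.trans (one_le_innerCost_of_bad PY L S b1 b2 A A' c' hPY z _ hb)
    push Not at hb
    obtain ⟨hb1, x, hx, hxc⟩ := hb
    have hg' := hA' z (gAB m z)
    refine sum_le_innerCost PY L S b1 b2 A A' c' hPY z _ hb1
      ((hS z _ hgT hz hb1).mem_of_isFirstMaximizer hg' hx hxc) hg'.1.1 _ ?_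
    intro y hy
    -- A wrong message forces the decoder's word to be a different word of the same `A`-bin, at
    -- least as likely given `y`. The comparison is not strict, so decoder ties may be broken in any
    -- way.
    refine ⟨gA y, fun he => hy ?_, (hA y).2 _ hgC.1, (hA y).1.trans hgC.1.symm⟩
    rw [he]; exact hgC.2

end Deterministic

/-! ### Consequences of the hash property -/

section Hash

variable {Ω V V' : Type*} [Fintype Ω] [Fintype V] [Fintype V']

theorem Ensemble.collision_eq (E : Ensemble Ω V) (u u' : Ω) :
    E.collision u u' = E.expect (fun f => ind (f u = f u')) := by
  classical
  unfold Ensemble.collision Ensemble.expect ind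
  refine Finset.sum_congr rfl fun f _ => ?_
  by_cases h : f u = f u' <;> simp [h]

/-- The probability that no element of `T` lies in a random bin, where the index of the bin is
uniformly drawn from `R`. -/
noncomputable def missProbOn (E : Ensemble Ω V) (R : Set V) (T : Finset Ω) : ℝ :=
  E.expect (fun f => (∑ c, ind (c ∈ R) * ind (∀ u ∈ T, f u ≠ c)) / R.ncard)

theorem missProb_eq (E : Ensemble Ω V) (T : Finset Ω) :
    missProb E T = missProbOn E E.image T := by
  unfold missProb missProbOn
  rw [E.avg_eq]
  congr 1
  funext f
  rw [Finset.sum_div]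
  refine Finset.sum_congr rfl fun c _ => ?_
  simp only [Ensemble.unif]
  ring

open scoped Classical in
theorem Ensemble.expect_prod (E : Ensemble Ω V) (F : Ensemble Ω V') (φ : (Ω → V × V') → ℝ) :
    (E.prod F).expect φ = E.expect (fun f => F.expect (fun g => φ (fun u => (f u, g u)))) := by
  unfold Ensemble.expect
  rw [Fintype.sum_equiv (Equiv.arrowProdEquivProdArrow Ω (fun _ => V) (fun _ => V'))
      (fun f => (E.prod F).prob f * φ f)
      (fun q => (E.prob q.1 * F.prob q.2) * φ (fun u => (q.1 u, q.2 u))) (fun f => rfl)]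
  rw [Fintype.sum_prod_type]
  refine Finset.sum_congr rfl fun f _ => ?_
  rw [Finset.mul_sum]
  exact Finset.sum_congr rfl fun g _ => by ring

/-- Two independent uniform values form one uniform value of the product of the images. The set of
values is kept as a parameter of `missProbOn` because the range of the joint functions may be
smaller than this product. -/
theorem jointMissProb_eq (E : Ensemble Ω V) (F : Ensemble Ω V') (T : Finset Ω) :
    jointMissProb E F T = missProbOn (E.prod F) (E.image ×ˢ F.image) T := by
  unfold jointMissProb missProbOn
  rw [E.expect_prod, E.avg_eq]
  congr 1
  funext f
  simp only [F.avg_eq]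
  simp only [← F.expect_const_mul, ← F.expect_sum]
  congr 1
  funext g
  rw [Finset.sum_div, Fintype.sum_prod_type]
  refine Finset.sum_congr rfl fun c _ => ?_
  rw [Finset.mul_sum]
  refine Finset.sum_congr rfl fun m _ => ?_
  simp only [Ensemble.unif, Set.mem_prod, Prod.mk.injEq, ne_eq, Set.ncard_prod, ind_and,
    Nat.cast_mul]
  ring

/-- A second moment bound for the probability that a bin is missed. -/
theorem missProbOn_le (E : Ensemble Ω V) (R : Set V) (hR : ∀ f ∈ E.carrier, ∀ u, f u ∈ R)
    (hr : 0 < R.ncard) (T : Finset Ω) (hT : T.Nonempty) :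
    missProbOn E R T ≤
      R.ncard * (∑ u ∈ T, ∑ u' ∈ T, E.collision u u') / (T.card : ℝ) ^ 2 - 1 := by
  classical
  have hr' : (0 : ℝ) < R.ncard := by exact_mod_cast hr
  have hT' : (0 : ℝ) < T.card := by exact_mod_cast hT.card_pos
  simp only [E.collision_eq, ← E.expect_sum]
  have hRc : ∑ c : V, ind (c ∈ R) = R.ncard := by
    simp only [ind]
    rw [Finset.sum_boole]
    congr 1
    rw [← Set.ncard_coe_finset]
    congr 1
    ext; simp
  have hpt : ∀ f ∈ E.carrier, (∑ c, ind (c ∈ R) * ind (∀ u ∈ T, f u ≠ c)) / R.ncard ≤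
      R.ncard / (T.card : ℝ) ^ 2 * (∑ u ∈ T, ∑ u' ∈ T, ind (f u = f u')) + (-1) := by
    intro f hf
    set N : V → ℝ := fun c => ∑ u ∈ T, ind (f u = c) with hN
    have h1 : ∑ c, ind (c ∈ R) * N c = T.card := by
      simp only [hN, Finset.mul_sum]
      rw [Finset.sum_comm, Finset.card_eq_sum_ones]
      push_cast
      refine Finset.sum_congr rfl fun u _ => ?_
      rw [Finset.sum_eq_single (f u)]
      · rw [ind_true (hR f hf u), ind_true rfl, one_mul]
      · intro c _ hc; rw [ind_false hc.symm, mul_zero]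
      · simp
    have h2 : ∑ c, ind (c ∈ R) * N c ^ 2 = ∑ u ∈ T, ∑ u' ∈ T, ind (f u = f u') := by
      simp only [hN, sq, Finset.sum_mul_sum]
      simp only [Finset.mul_sum]
      rw [Finset.sum_comm]
      refine Finset.sum_congr rfl fun u _ => ?_
      rw [Finset.sum_comm]
      refine Finset.sum_congr rfl fun u' _ => ?_
      rw [Finset.sum_eq_single (f u)]
      · rw [ind_true (hR f hf u), ind_true rfl, one_mul, one_mul]
        exact congrArg ind (propext eq_comm)
      · intro c _ hc; rw [ind_false hc.symm]; ring
      · simp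
    have h3 : ∀ c, ind (c ∈ R) * ind (∀ u ∈ T, f u ≠ c) * (T.card / R.ncard : ℝ) ^ 2 ≤
        ind (c ∈ R) * N c ^ 2 - 2 * (T.card / R.ncard : ℝ) * (ind (c ∈ R) * N c)
          + (T.card / R.ncard : ℝ) ^ 2 * ind (c ∈ R) := by
      intro c
      -- Chebyshev's argument: `N c` counts the elements of `T` in the bin `c` and has mean `|T| /
      -- |R|`, so an empty bin deviates by the whole mean; the second moment of `N` counts
      -- collisions.
      have h4 : ind (∀ u ∈ T, f u ≠ c) * (T.card / R.ncard : ℝ) ^ 2 ≤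
          (N c - T.card / R.ncard) ^ 2 := by
        by_cases h : ∀ u ∈ T, f u ≠ c
        · have : N c = 0 := Finset.sum_eq_zero fun u hu => ind_false (h u hu)
          rw [ind_true h, this]; apply le_of_eq; ring
        · rw [ind_false h, zero_mul]; positivity
      have := mul_le_mul_of_nonneg_left h4 (ind_nonneg (c ∈ R))
      linarith
    have h5 := Finset.sum_le_sum (s := Finset.univ) fun c _ => h3 c
    rw [Finset.sum_add_distrib, Finset.sum_sub_distrib, ← Finset.sum_mul, ← Finset.mul_sum,
      ← Finset.mul_sum, h1, h2, hRc] at h5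
    rw [div_le_iff₀ hr']
    have h6 : (∑ c, ind (c ∈ R) * ind (∀ u ∈ T, f u ≠ c)) ≤
        (∑ u ∈ T, ∑ u' ∈ T, ind (f u = f u') - T.card ^ 2 / R.ncard) /
          (T.card / R.ncard : ℝ) ^ 2 := by
      rw [le_div_iff₀ (by positivity)]
      refine h5.trans (le_of_eq ?_)
      field_simp
      ring
    refine h6.trans (le_of_eq ?_)
    field_simp
    ring
  have := E.expect_mono hpt
  rw [E.expect_add, E.expect_const_mul, E.expect_const] at this
  refine this.trans (le_of_eq ?_)
  ring

/-- The probability that another element of `G` lies in the bin of `w`. -/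
theorem expect_exists_collision_le (E : Ensemble Ω V) (G : Finset Ω) (w : Ω) (p : Ω → Prop)
    (hp : ∀ w', p w' → w' ∈ G) [DecidableEq Ω] :
    E.expect (fun f => ind (∃ w', w' ≠ w ∧ p w' ∧ f w' = f w)) ≤
      ∑ u ∈ {w}, ∑ u' ∈ G.erase w, E.collision u u' := by
  rw [Finset.sum_singleton]
  simp only [E.collision_eq, ← E.expect_sum]
  refine E.expect_mono fun f _ => ?_
  by_cases h : ∃ w', w' ≠ w ∧ p w' ∧ f w' = f w
  · obtain ⟨w', h1, h2, h3⟩ := h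
    have := Finset.single_le_sum (f := fun u' => ind (f w = f u')) (fun u' _ => ind_nonneg _)
      (Finset.mem_erase.2 ⟨h1, hp w' h2⟩)
    refine (ind_le_one _).trans (le_trans (le_of_eq ?_) this)
    rw [ind_true h3.symm]
  · rw [ind_false h]
    exact Finset.sum_nonneg fun _ _ => ind_nonneg _

end Hash

section HashSequence

variable {Ω V : ℕ → Type*} [∀ n, Fintype (Ω n)] [∀ n, Fintype (V n)]

open Filter in
/-- Sets that are large compared with the number of bins meet almost all bins. -/
theorem HashPropertyOn.eventually_missProbOn_le {E : ∀ n, Ensemble (Ω n) (V n)}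
    {R : ∀ n, Set (V n)} (h : HashPropertyOn E R) (hR : ∀ n, ∀ f ∈ (E n).carrier, ∀ u, f u ∈ R n)
    (hr : ∀ n, 0 < (R n).ncard) {K : ℝ} (hK : 1 ≤ K) :
    ∀ᶠ n in atTop, ∀ T : Finset (Ω n), K * (R n).ncard ≤ T.card →
      missProbOn (E n) (R n) T ≤ 3 / K := by
  classical
  obtain ⟨-, α, β, hα, hβ, hh⟩ := h
  have hK0 : 0 < K := by linarith
  have hK1 : 0 < 1 / K := by positivity
  filter_upwards [hα.eventually (gt_mem_nhds (show (1 : ℝ) < 1 + 1 / K by linarith)),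
    hβ.eventually (gt_mem_nhds (show (0 : ℝ) < 1 by norm_num)), eventually_ge_atTop 1]
    with n h1 h2 h3 T hT
  have hr' : (0 : ℝ) < (R n).ncard := by exact_mod_cast hr n
  have hTc : (0 : ℝ) < T.card := lt_of_lt_of_le (by positivity) hT
  have hTn : T.Nonempty := Finset.card_pos.1 (by exact_mod_cast hTc)
  refine (missProbOn_le (E n) (R n) (hR n) (hr n) T hTn).trans ?_
  have h4 := hh n h3 T T
  rw [Finset.inter_self, min_self] at h4
  have h5 : (R n).ncard * (∑ u ∈ T, ∑ u' ∈ T, (E n).collision u u') / (T.card : ℝ) ^ 2 ≤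
      (R n).ncard * ((T.card : ℝ) + (T.card : ℝ) * T.card * α n / (R n).ncard
        + T.card * β n) / (T.card : ℝ) ^ 2 := by gcongr
  have h6 : (R n).ncard * ((T.card : ℝ) + (T.card : ℝ) * T.card * α n / (R n).ncard
        + T.card * β n) / (T.card : ℝ) ^ 2 = α n + (R n).ncard / T.card * (1 + β n) := by
    field_simp
    ring
  have h7 : ((R n).ncard : ℝ) / T.card ≤ 1 / K := by
    rw [div_le_div_iff₀ hTc hK0]; linarith
  have h8 : ((R n).ncard : ℝ) / T.card * (1 + β n) ≤ 1 / K * 2 :=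
    (mul_le_mul_of_nonneg_left (by linarith) (by positivity)).trans
      (mul_le_mul_of_nonneg_right h7 (by norm_num))
  have h9 : 3 / K = 1 / K + 1 / K * 2 := by ring
  linarith

open Filter in
/-- Sets that are small compared with the number of bins hardly collide with a given element. -/
theorem HashPropertyOn.eventually_collision_le {E : ∀ n, Ensemble (Ω n) (V n)}
    {R : ∀ n, Set (V n)} (h : HashPropertyOn E R) {σ : ℝ} (hσ : 0 < σ) :
    ∀ᶠ n in atTop, ∀ (G : Finset (Ω n)) (w : Ω n) (p : Ω n → Prop), (∀ w', p w' → w' ∈ G) →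
      (E n).expect (fun f => ind (∃ w', w' ≠ w ∧ p w' ∧ f w' = f w)) ≤
        2 * (G.card / (R n).ncard) + σ := by
  classical
  obtain ⟨-, α, β, hα, hβ, hh⟩ := h
  filter_upwards [hα.eventually (gt_mem_nhds (show (1 : ℝ) < 2 by norm_num)),
    hα.eventually (lt_mem_nhds (show (0 : ℝ) < 1 by norm_num)),
    hβ.eventually (gt_mem_nhds hσ), eventually_ge_atTop 1] with n h1 h1' h2 h3 G w p hp
  -- The two sets are disjoint, so the term `|T ∩ T'|` of the hash property vanishes, and the
  -- minimum of their sizes is at most `1`.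
  refine (expect_exists_collision_le (E n) G w p hp).trans ((hh n h3 {w} (G.erase w)).trans ?_)
  have e1 : ({w} ∩ G.erase w : Finset (Ω n)).card = 0 := by
    rw [Finset.card_eq_zero]
    ext u; simp
  rw [e1, Finset.card_singleton]
  have h4 : ((G.erase w).card : ℝ) ≤ G.card := by exact_mod_cast Finset.card_erase_le
  have h5 : ((min 1 (G.erase w).card : ℕ) : ℝ) * β n ≤ σ := by
    have h6 : ((min 1 (G.erase w).card : ℕ) : ℝ) ≤ 1 := by exact_mod_cast min_le_left _ _
    rcases le_total (β n) 0 with h7 | h7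
    · exact (mul_nonpos_of_nonneg_of_nonpos (by positivity) h7).trans hσ.le
    · calc _ ≤ 1 * β n := mul_le_mul_of_nonneg_right h6 h7
        _ ≤ σ := by linarith
  have h8 : ((1 : ℕ) : ℝ) * (G.erase w).card * α n / (R n).ncard ≤
      2 * (G.card / (R n).ncard) := by
    rw [← mul_div_assoc]
    refine div_le_div_of_nonneg_right ?_ (by positivity)
    push_cast
    rw [one_mul, mul_comm]
    exact mul_le_mul h1.le h4 (by positivity) (by norm_num)
  push_cast at h5 h8 ⊢
  linarith

end HashSequence

/-! ### Exponential tail bounds for products of distributions -/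

section Tail

variable {U V : Type*} [Fintype U] [Fintype V]

theorem sum_prod_eq_prod_sum {n : ℕ} (K : Fin n → U → ℝ) :
    ∑ u : Fin n → U, ∏ i, K i (u i) = ∏ i, ∑ a, K i a := by
  classical
  rw [Finset.prod_univ_sum, Fintype.piFinset_univ]

/-- Exponential Markov inequality: on the event the weight `exp (t ∑ F)` is at least `1`. Sequences
of probability zero are exempt, which matters when `F` involves the logarithm of a vanishing
probability. -/
theorem sum_prod_ind_le {n : ℕ} (K F : Fin n → U → ℝ) (hK : ∀ i a, 0 ≤ K i a) {t : ℝ}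
    (ht : 0 ≤ t) (E : (Fin n → U) → Prop)
    (hE : ∀ u, E u → ∏ i, K i (u i) ≠ 0 → 0 ≤ ∑ i, F i (u i)) :
    ∑ u : Fin n → U, (∏ i, K i (u i)) * ind (E u) ≤ ∏ i, ∑ a, K i a * Real.exp (t * F i a) := by
  rw [← sum_prod_eq_prod_sum]
  refine Finset.sum_le_sum fun u _ => ?_
  rw [Finset.prod_mul_distrib, ← Real.exp_sum, ← Finset.mul_sum]
  by_cases h0 : ∏ i, K i (u i) = 0
  · rw [h0]; simp
  refine mul_le_mul_of_nonneg_left ?_ (Finset.prod_nonneg fun i _ => hK i _)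
  by_cases h : E u
  · rw [ind_true h]
    exact Real.one_le_exp (mul_nonneg ht (hE u h h0))
  · rw [ind_false h]
    exact (Real.exp_pos _).le

/-- On `|x| ≤ 1` one has `exp x ≤ 1 + x + x ^ 2`, and the linear term has mean zero. -/
theorem sum_mul_exp_le {k F : U → ℝ} (hk : k ∈ stdSimplex ℝ U) (hF : ∑ a, k a * F a = 0) {M t : ℝ}
    (hM : ∀ a, |F a| ≤ M) (ht : 0 ≤ t) (htM : t * M ≤ 1) :
    ∑ a, k a * Real.exp (t * F a) ≤ Real.exp (t ^ 2 * M ^ 2) := by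
  have h1 : ∀ a, k a * Real.exp (t * F a) ≤ k a * (1 + t ^ 2 * M ^ 2) + t * (k a * F a) := by
    intro a
    have h2 : |t * F a| ≤ t * M := by
      rw [abs_mul, abs_of_nonneg ht]; exact mul_le_mul_of_nonneg_left (hM a) ht
    have h3 := (abs_le.1 (Real.abs_exp_sub_one_sub_id_le (h2.trans htM))).2
    have h4 : (t * F a) ^ 2 ≤ (t * M) ^ 2 := sq_le_sq' (by linarith [(abs_le.1 h2).1])
      (abs_le.1 h2).2
    have := mul_le_mul_of_nonneg_left
      (show Real.exp (t * F a) ≤ 1 + t * F a + t ^ 2 * M ^ 2 by nlinarith) (hk.1 a)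
    linarith
  refine (Finset.sum_le_sum fun a _ => h1 a).trans ?_
  rw [Finset.sum_add_distrib, ← Finset.sum_mul, hk.2, ← Finset.mul_sum, hF]
  linarith [Real.add_one_le_exp (t ^ 2 * M ^ 2)]

theorem upper_tail_le {n : ℕ} {K F : Fin n → U → ℝ} (hK : ∀ i, K i ∈ stdSimplex ℝ U)
    (hF : ∀ i, ∑ a, K i a * F i a = 0) {M t ε : ℝ} (hM : ∀ i a, |F i a| ≤ M) (ht : 0 ≤ t)
    (htM : t * M ≤ 1) :
    ∑ u : Fin n → U, (∏ i, K i (u i)) * ind (n * ε ≤ ∑ i, F i (u i)) ≤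
      Real.exp (-(n * (t * ε - t ^ 2 * M ^ 2))) := by
  refine (sum_prod_ind_le K (fun i a => F i a - ε) (fun i a => (hK i).1 a) ht _ ?_).trans ?_
  · intro u hu _
    rw [Finset.sum_sub_distrib]
    simp only [Finset.sum_const, Finset.card_univ, Fintype.card_fin, nsmul_eq_mul]
    linarith
  · have h1 : ∀ i, ∑ a, K i a * Real.exp (t * (F i a - ε)) ≤
        Real.exp (-(t * ε - t ^ 2 * M ^ 2)) := by
      intro i
      have e : ∀ a, K i a * Real.exp (t * (F i a - ε)) =
          (K i a * Real.exp (t * F i a)) * Real.exp (-(t * ε)) := by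
        intro a
        rw [mul_assoc, ← Real.exp_add]; congr 2; ring
      simp only [e]
      rw [← Finset.sum_mul]
      calc _ ≤ Real.exp (t ^ 2 * M ^ 2) * Real.exp (-(t * ε)) :=
            mul_le_mul_of_nonneg_right (sum_mul_exp_le (hK i) (hF i) (hM i) ht htM)
              (Real.exp_pos _).le
        _ = _ := by rw [← Real.exp_add]; congr 1; ring
    refine (Finset.prod_le_prod (fun i _ => Finset.sum_nonneg fun a _ =>
      mul_nonneg ((hK i).1 a) (Real.exp_pos _).le) fun i _ => h1 i).trans ?_
    rw [Finset.prod_const, Finset.card_univ, Fintype.card_fin, ← Real.exp_nat_mul]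
    apply le_of_eq; congr 1; ring

theorem tail_le {n : ℕ} {K F : Fin n → U → ℝ} (hK : ∀ i, K i ∈ stdSimplex ℝ U)
    (hF : ∀ i, ∑ a, K i a * F i a = 0) {M t ε : ℝ} (hM : ∀ i a, |F i a| ≤ M) (ht : 0 ≤ t)
    (htM : t * M ≤ 1) :
    ∑ u : Fin n → U, (∏ i, K i (u i)) * ind (n * ε ≤ |∑ i, F i (u i)|) ≤
      2 * Real.exp (-(n * (t * ε - t ^ 2 * M ^ 2))) := by
  have h1 := upper_tail_le (ε := ε) hK hF hM ht htM
  have h2 := upper_tail_le (F := fun i a => -F i a) (ε := ε) hK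
    (fun i => by simp only [mul_neg, Finset.sum_neg_distrib, hF i, neg_zero])
    (fun i a => by rw [abs_neg]; exact hM i a) ht htM
  rw [two_mul]
  refine le_trans ?_ (add_le_add h1 h2)
  rw [← Finset.sum_add_distrib]
  refine Finset.sum_le_sum fun u _ => ?_
  rw [← mul_add]
  refine mul_le_mul_of_nonneg_left ?_ (Finset.prod_nonneg fun i _ => (hK i).1 _)
  by_cases h : n * ε ≤ |∑ i, F i (u i)|
  · rw [ind_true h]
    rcases le_abs.1 h with h' | h'
    · rw [ind_true h']; linarith [ind_nonneg (n * ε ≤ ∑ i, -F i (u i))]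
    · rw [← Finset.sum_neg_distrib] at h'
      rw [ind_true h']; linarith [ind_nonneg (n * ε ≤ ∑ i, F i (u i))]
  · rw [ind_false h]
    exact add_nonneg (ind_nonneg _) (ind_nonneg _)

theorem exists_tail_rate (K F : V → U → ℝ) {ε : ℝ} (hε : 0 < ε) :
    ∃ c : ℝ, 0 < c ∧ ∀ (n : ℕ) (v : Fin n → V), (∀ i, K (v i) ∈ stdSimplex ℝ U) →
      (∀ i, ∑ a, K (v i) a * F (v i) a = 0) →
      ∑ u : Fin n → U, (∏ i, K (v i) (u i)) * ind (n * ε ≤ |∑ i, F (v i) (u i)|) ≤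
        2 * Real.exp (-(n * c)) := by
  set M : ℝ := ∑ v, ∑ a, |F v a| + 1 with hM
  have hM1 : ∀ v a, |F v a| ≤ M := by
    intro v a
    have h1 := Finset.single_le_sum (f := fun a => |F v a|) (fun a _ => abs_nonneg _)
      (Finset.mem_univ a)
    have h2 := Finset.single_le_sum (f := fun v => ∑ a, |F v a|)
      (fun v _ => Finset.sum_nonneg fun a _ => abs_nonneg _) (Finset.mem_univ v)
    linarith
  have hM0 : 1 ≤ M := by
    have : 0 ≤ ∑ v, ∑ a, |F v a| :=
      Finset.sum_nonneg fun _ _ => Finset.sum_nonneg fun _ _ => abs_nonneg _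
    linarith
  -- With this `t` the exponent `t ε - t² M²` is at least `t ε / 2`, and `M` bounds `F` for all `v`
  -- at once, so the rate does not depend on the conditioning sequence.
  set t : ℝ := min (1 / M) (ε / (2 * M ^ 2)) with ht
  have ht0 : 0 < t := lt_min (by positivity) (by positivity)
  have ht1 : t * M ≤ 1 := by
    have := min_le_left (1 / M) (ε / (2 * M ^ 2))
    rw [← ht, le_div_iff₀ (by positivity)] at this
    exact this
  have ht2 : t * (2 * M ^ 2) ≤ ε := by
    have := min_le_right (1 / M) (ε / (2 * M ^ 2))
    rwa [← ht, le_div_iff₀ (by positivity)] at this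
  refine ⟨t * ε - t ^ 2 * M ^ 2, by nlinarith, fun n v hK hF => ?_⟩
  exact tail_le hK hF (fun i a => hM1 _ _) ht0.le ht1

open Filter

theorem eventually_exp_neg_lt {c σ : ℝ} (hc : 0 < c) (hσ : 0 < σ) :
    ∀ᶠ n : ℕ in atTop, Real.exp (-(n * c)) < σ := by
  have : Tendsto (fun n : ℕ => Real.exp (-(n * c))) atTop (nhds 0) := by
    refine Real.tendsto_exp_neg_atTop_nhds_zero.comp ?_
    exact tendsto_natCast_atTop_atTop.atTop_mul_const hc
  exact this.eventually (gt_mem_nhds hσ)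

/-- The entropy of a distribution, in nats. -/
noncomputable def natEntropy (k : U → ℝ) : ℝ := ∑ a, k a * Real.log (1 / k a)

theorem exp_neg_sum_log {n : ℕ} (r : Fin n → ℝ) (hr : ∀ i, 0 < r i) :
    ∏ i, r i = Real.exp (-∑ i, Real.log (1 / r i)) := by
  rw [← Finset.sum_neg_distrib, Real.exp_sum]
  refine Finset.prod_congr rfl fun i _ => ?_
  rw [one_div, Real.log_inv, neg_neg, Real.exp_log (hr i)]

/-- The conditional typical sets are uniformly large. -/
theorem eventually_exists_typical (K : V → U → ℝ) {ε : ℝ} (hε : 0 < ε) :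
    ∀ᶠ n : ℕ in atTop, ∀ v : Fin n → V, (∀ i, K (v i) ∈ stdSimplex ℝ U) →
      ∃ G : Finset (Fin n → U),
        (∀ u ∈ G, Real.exp (-(∑ i, natEntropy (K (v i)) + n * ε)) ≤ ∏ i, K (v i) (u i)) ∧
        Real.exp (∑ i, natEntropy (K (v i)) - n * ε) / 2 ≤ G.card := by
  classical
  obtain ⟨c, hc, hh⟩ := exists_tail_rate K
    (fun v a => Real.log (1 / K v a) - natEntropy (K v)) hε
  filter_upwards [eventually_exp_neg_lt hc (show (0 : ℝ) < 1 / 4 by norm_num)] with n hn v hv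
  have h1 := hh n v hv (fun i => by
    simp only [mul_sub, Finset.sum_sub_distrib, ← Finset.sum_mul, (hv i).2, natEntropy]; ring)
  set H : ℝ := ∑ i, natEntropy (K (v i)) with hH
  set P : (Fin n → U) → ℝ := fun u => ∏ i, K (v i) (u i) with hP
  set E : (Fin n → U) → Prop :=
    fun u => n * ε ≤ |∑ i, (Real.log (1 / K (v i) (u i)) - natEntropy (K (v i)))| with hE
  have hP0 : ∀ u, 0 ≤ P u := fun u => Finset.prod_nonneg fun i _ => (hv i).1 _
  have hsum : ∑ u, P u = 1 := by
    rw [hP, sum_prod_eq_prod_sum (fun i => K (v i))]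
    exact Finset.prod_eq_one fun i _ => (hv i).2
  have hval : ∀ u, P u ≠ 0 → ¬ E u →
      Real.exp (-(H + n * ε)) ≤ P u ∧ P u ≤ Real.exp (-(H - n * ε)) := by
    intro u hu hEu
    have hpos : ∀ i, 0 < K (v i) (u i) := fun i =>
      lt_of_le_of_ne ((hv i).1 _) (Ne.symm (Finset.prod_ne_zero_iff.1 hu i (Finset.mem_univ i)))
    have e := exp_neg_sum_log (fun i => K (v i) (u i)) hpos
    simp only [hE, Finset.sum_sub_distrib, not_le] at hEu
    have := abs_lt.1 hEu
    simp only [hP, e]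
    constructor <;> rw [Real.exp_le_exp] <;> linarith
  refine ⟨Finset.univ.filter (fun u => P u ≠ 0 ∧ ¬ E u), ?_, ?_⟩
  · intro u hu
    rw [Finset.mem_filter] at hu
    exact (hval u hu.2.1 hu.2.2).1
  -- The unit mass splits into the atypical part, of mass at most `1/2`, and the typical part, each
  -- of whose members is at most `exp (-(H - n ε))`; this bounds the number of members from below.
  · have h2 : (1 : ℝ) ≤ ∑ u, P u * ind (E u) +
        ∑ u ∈ Finset.univ.filter (fun u => P u ≠ 0 ∧ ¬ E u), Real.exp (-(H - n * ε)) := by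
      rw [Finset.sum_filter, ← Finset.sum_add_distrib]
      refine hsum.symm.le.trans ?_
      refine Finset.sum_le_sum fun u _ => ?_
      by_cases h0 : P u = 0
      · simp [h0]
      by_cases hEu : E u
      · simp [hEu, ind_true]
      · rw [if_pos ⟨h0, hEu⟩, ind_false hEu, mul_zero, zero_add]
        exact (hval u h0 hEu).2
    rw [Finset.sum_const, nsmul_eq_mul] at h2
    have h3 : (1 : ℝ) / 2 ≤ (Finset.univ.filter (fun u => P u ≠ 0 ∧ ¬ E u)).card *
        Real.exp (-(H - n * ε)) := by linarith
    have h4 := mul_le_mul_of_nonneg_right h3 (Real.exp_pos (H - n * ε)).le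
    rw [mul_assoc, ← Real.exp_add, neg_add_cancel, Real.exp_zero, mul_one] at h4
    linarith

/-- An independent and identically distributed sum is close to its mean. -/
theorem eventually_tail_lt {k F : U → ℝ} (hk : k ∈ stdSimplex ℝ U) {ε σ : ℝ} (hε : 0 < ε)
    (hσ : 0 < σ) : ∀ᶠ n : ℕ in atTop,
      ∑ u : Fin n → U, (∏ i, k (u i)) * ind (n * ε ≤ |∑ i, F (u i) - n * ∑ a, k a * F a|) < σ := by
  obtain ⟨c, hc, hh⟩ := exists_tail_rate (fun _ : Unit => k)
    (fun _ a => F a - ∑ a, k a * F a) hε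
  filter_upwards [eventually_exp_neg_lt hc (show (0 : ℝ) < σ / 2 by positivity)] with n hn
  have := hh n (fun _ => ()) (fun _ => hk) (fun _ => by
    simp only [mul_sub, Finset.sum_sub_distrib, ← Finset.sum_mul, hk.2]; ring)
  simp only [Finset.sum_sub_distrib, Finset.sum_const, Finset.card_univ, Fintype.card_fin,
    nsmul_eq_mul] at this
  linarith

end Tail

/-! ### Laws and conditional probabilities -/

section Laws

variable {Ω U V : Type*} [Fintype Ω] [Fintype U] [Fintype V] {p : Ω → ℝ}

theorem sum_mul_comp (p : Ω → ℝ) (S : Ω → U) (φ : U → ℝ) :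
    ∑ ω, p ω * φ (S ω) = ∑ u, law p S u * φ u := by
  classical
  unfold law
  simp only [Finset.sum_mul]
  rw [Finset.sum_comm]
  refine Finset.sum_congr rfl fun ω _ => ?_
  rw [Finset.sum_eq_single (S ω)]
  · simp
  · intro u _ hu; simp [hu.symm]
  · simp

omit [Fintype U] in
theorem law_nonneg (hp : ∀ ω, 0 ≤ p ω) (S : Ω → U) (u : U) : 0 ≤ law p S u := by
  unfold law
  exact Finset.sum_nonneg fun ω _ => by split_ifs <;> simp [hp ω]

theorem law_mem_stdSimplex (hp : p ∈ stdSimplex ℝ Ω) (S : Ω → U) : law p S ∈ stdSimplex ℝ U := by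
  refine ⟨law_nonneg hp.1 S, ?_⟩
  have := sum_mul_comp p S (fun _ => 1)
  simp only [mul_one] at this
  rw [← this, hp.2]

omit [Fintype V] in
theorem sum_law_pair (p : Ω → ℝ) (S : Ω → U) (T : Ω → V) (v : V) :
    ∑ u, law p (fun ω => (S ω, T ω)) (u, v) = law p T v := by
  classical
  unfold law
  rw [Finset.sum_comm]
  refine Finset.sum_congr rfl fun ω _ => ?_
  by_cases h : T ω = v
  · rw [Finset.sum_eq_single (S ω)] <;> simp [h]
    intro u hu hu'; exact absurd hu'.symm hu
  · rw [if_neg h]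
    exact Finset.sum_eq_zero fun u _ => by simp [h]

omit [Fintype V] in
theorem law_pair_le (hp : ∀ ω, 0 ≤ p ω) (S : Ω → U) (T : Ω → V) (u : U) (v : V) :
    law p (fun ω => (S ω, T ω)) (u, v) ≤ law p T v := by
  rw [← sum_law_pair p S T v]
  exact Finset.single_le_sum (f := fun u => law p (fun ω => (S ω, T ω)) (u, v))
    (fun u _ => law_nonneg hp _ _) (Finset.mem_univ u)

omit [Fintype U] [Fintype V] in
theorem condProb_nonneg (hp : ∀ ω, 0 ≤ p ω) (S : Ω → U) (T : Ω → V) (u : U) (v : V) :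
    0 ≤ condProb p S T u v :=
  div_nonneg (law_nonneg hp _ _) (law_nonneg hp _ _)

omit [Fintype V] in
theorem condProb_le_one (hp : ∀ ω, 0 ≤ p ω) (S : Ω → U) (T : Ω → V) (u : U) (v : V) :
    condProb p S T u v ≤ 1 :=
  div_le_one_of_le₀ (law_pair_le hp S T u v) (law_nonneg hp _ _)

omit [Fintype V] in
theorem condProb_mul_law (hp : ∀ ω, 0 ≤ p ω) (S : Ω → U) (T : Ω → V) (u : U) (v : V) :
    condProb p S T u v * law p T v = law p (fun ω => (S ω, T ω)) (u, v) := by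
  by_cases h : law p T v = 0
  · have h1 := law_pair_le hp S T u v
    have h2 := law_nonneg hp (fun ω => (S ω, T ω)) (u, v)
    rw [h] at h1
    rw [h, mul_zero, le_antisymm h1 h2]
  · exact div_mul_cancel₀ _ h

omit [Fintype V] in
theorem sum_condProb (p : Ω → ℝ) (S : Ω → U) (T : Ω → V) {v : V} (hv : law p T v ≠ 0) :
    ∑ u, condProb p S T u v = 1 := by
  unfold condProb
  rw [← Finset.sum_div, sum_law_pair, div_self hv]

omit [Fintype V] in
theorem condProb_mem_stdSimplex (hp : ∀ ω, 0 ≤ p ω) (S : Ω → U) (T : Ω → V) {v : V}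
    (hv : law p T v ≠ 0) : (fun u => condProb p S T u v) ∈ stdSimplex ℝ U :=
  ⟨fun u => condProb_nonneg hp S T u v, sum_condProb p S T hv⟩

omit [Fintype V] in
theorem sum_condProb_le (p : Ω → ℝ) (S : Ω → U) (T : Ω → V) (v : V) :
    ∑ u, condProb p S T u v ≤ 1 := by
  by_cases hv : law p T v = 0
  · simp [condProb, hv]
  · exact (sum_condProb p S T hv).le

omit [Fintype V] in
theorem condProb_pos (hp : ∀ ω, 0 ≤ p ω) (S : Ω → U) (T : Ω → V) {ω : Ω} (hω : 0 < p ω) :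
    0 < condProb p S T (S ω) (T ω) := by
  classical
  have h1 : 0 < law p (fun ω => (S ω, T ω)) (S ω, T ω) := by
    unfold law
    refine Finset.sum_pos' (fun ω' _ => by split_ifs <;> simp [hp ω']) ⟨ω, Finset.mem_univ _, ?_⟩
    rw [if_pos rfl]; exact hω
  exact div_pos h1 (h1.trans_le (law_pair_le hp S T _ _))

theorem sum_mul_comp_pair (hp : ∀ ω, 0 ≤ p ω) (S : Ω → U) (T : Ω → V) (φ : U → V → ℝ) :
    ∑ ω, p ω * φ (S ω) (T ω) = ∑ v, law p T v * ∑ u, condProb p S T u v * φ u v := by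
  rw [sum_mul_comp p (fun ω => (S ω, T ω)) (fun q => φ q.1 q.2), Fintype.sum_prod_type_right]
  refine Finset.sum_congr rfl fun v _ => ?_
  rw [Finset.mul_sum]
  refine Finset.sum_congr rfl fun u _ => ?_
  rw [← condProb_mul_law hp]; ring

/-- The conditional entropy in nats. -/
theorem condEntropy_mul_log (p : Ω → ℝ) (S : Ω → U) (T : Ω → V) :
    condEntropy p S T * Real.log 2 =
      ∑ v, law p T v * natEntropy (fun u => condProb p S T u v) := by
  unfold condEntropy natEntropy
  rw [Finset.sum_comm, Finset.sum_mul]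
  refine Finset.sum_congr rfl fun v _ => ?_
  rw [Finset.sum_mul, Finset.mul_sum]
  refine Finset.sum_congr rfl fun u _ => ?_
  unfold Real.logb
  have : Real.log 2 ≠ 0 := (Real.log_pos (by norm_num)).ne'
  field_simp

theorem natEntropy_nonneg {k : U → ℝ} (hk : k ∈ stdSimplex ℝ U) : 0 ≤ natEntropy k := by
  refine Finset.sum_nonneg fun a _ => mul_nonneg (hk.1 a) ?_
  have h1 : k a ≤ 1 := by
    rw [← hk.2]; exact Finset.single_le_sum (fun b _ => hk.1 b) (Finset.mem_univ a)
  rw [one_div, Real.log_inv]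
  linarith [Real.log_nonpos (hk.1 a) h1]

theorem natEntropy_le {k : U → ℝ} (hk : k ∈ stdSimplex ℝ U) :
    natEntropy k ≤ Real.log (Fintype.card U) := by
  have hne : Nonempty U := by
    by_contra h
    rw [not_nonempty_iff] at h
    have := hk.2
    simp at this
  have hc : (0 : ℝ) < Fintype.card U := by exact_mod_cast Fintype.card_pos
  have h1 : ∀ a, k a * Real.log (1 / k a) ≤
      k a * Real.log (Fintype.card U) + (1 / Fintype.card U - k a) := by
    intro a
    rcases (hk.1 a).eq_or_lt with h | h
    · rw [← h]; simp
    · have h2 := Real.log_le_sub_one_of_pos (show 0 < 1 / (k a * Fintype.card U) by positivity)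
      rw [one_div, Real.log_inv, Real.log_mul h.ne' hc.ne'] at h2
      rw [one_div, Real.log_inv]
      have h3 := mul_le_mul_of_nonneg_left h2 h.le
      have h4 : k a * ((k a * Fintype.card U)⁻¹ - 1) = 1 / Fintype.card U - k a := by
        field_simp
      linarith
  refine (Finset.sum_le_sum fun a _ => h1 a).trans ?_
  rw [Finset.sum_add_distrib, Finset.sum_sub_distrib, ← Finset.sum_mul, hk.2, Finset.sum_const,
    Finset.card_univ, nsmul_eq_mul]
  field_simp
  simp

theorem condEntropy_nonneg (hp : p ∈ stdSimplex ℝ Ω) (S : Ω → U) (T : Ω → V) :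
    0 ≤ condEntropy p S T := by
  have h2 : (0 : ℝ) < Real.log 2 := Real.log_pos (by norm_num)
  refine nonneg_of_mul_nonneg_left ?_ h2
  rw [condEntropy_mul_log]
  refine Finset.sum_nonneg fun v _ => ?_
  by_cases hv : law p T v = 0
  · rw [hv, zero_mul]
  · exact mul_nonneg (law_nonneg hp.1 T v)
      (natEntropy_nonneg (condProb_mem_stdSimplex hp.1 S T hv))

theorem condEntropy_le (hp : p ∈ stdSimplex ℝ Ω) (S : Ω → U) (T : Ω → V) :
    condEntropy p S T ≤ Real.logb 2 (Fintype.card U) := by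
  have h2 : (0 : ℝ) < Real.log 2 := Real.log_pos (by norm_num)
  rw [Real.logb, le_div_iff₀ h2, condEntropy_mul_log]
  have h3 : ∀ v, law p T v * natEntropy (fun u => condProb p S T u v) ≤
      law p T v * Real.log (Fintype.card U) := by
    intro v
    by_cases hv : law p T v = 0
    · rw [hv, zero_mul, zero_mul]
    · exact mul_le_mul_of_nonneg_left (natEntropy_le (condProb_mem_stdSimplex hp.1 S T hv))
        (law_nonneg hp.1 T v)
  refine (Finset.sum_le_sum fun v _ => h3 v).trans ?_
  rw [← Finset.sum_mul, (law_mem_stdSimplex hp T).2, one_mul]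

/-! ### Large deviations of the conditional information -/

theorem exp_le_one_add_add {u : ℝ} (hu : 0 ≤ u) : Real.exp u ≤ 1 + u + u ^ 2 * Real.exp u := by
  have h1 := Real.add_one_le_exp (-u)
  have h2 : Real.exp u * Real.exp (-u) = 1 := by rw [← Real.exp_add]; simp
  have h3 : Real.exp u - 1 ≤ u * Real.exp u := by
    nlinarith [mul_le_mul_of_nonneg_left h1 (Real.exp_pos u).le]
  nlinarith [mul_le_mul_of_nonneg_left h3 hu]

/-- The information `log (1 / q)` is unbounded, so it is cut at `L`. Below `L` the square is at most
`L ^ 2` and the exponential at most `2`. At `L + g` the probability `q = exp (-(L + g))` absorbs the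
exponential and the factor `(1 + g) ^ 2`, leaving a multiple of `exp (-L)` that can be summed over
the alphabet. -/
theorem mul_log_sq_mul_exp_le {q L t : ℝ} (hq : 0 ≤ q) (hq1 : q ≤ 1) (hL : 1 ≤ L) (ht : 0 ≤ t)
    (htL : t * L ≤ 1 / 8) :
    q * (Real.log (1 / q) ^ 2 * Real.exp (t * Real.log (1 / q))) ≤
      L ^ 2 * (2 * q + 6 * Real.exp (-L)) := by
  rcases hq.eq_or_lt with h0 | h0
  · rw [← h0]; simp only [zero_mul, mul_zero, zero_add]; positivity
  set f := Real.log (1 / q) with hf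
  have hf0 : 0 ≤ f := by
    rw [hf, one_div, Real.log_inv]; linarith [Real.log_nonpos hq hq1]
  have hqe : q = Real.exp (-f) := by
    rw [hf, one_div, Real.log_inv, neg_neg, Real.exp_log h0]
  have h8 : Real.exp (1 / 8) ≤ 1.140625 := by
    have := (abs_le.1 (Real.abs_exp_sub_one_sub_id_le (x := 1 / 8) (by norm_num [abs_of_pos]))).2
    norm_num at this ⊢
    linarith
  have ht8 : t ≤ 1 / 8 := by nlinarith
  rcases le_total f L with h | h
  · have h1 : f ^ 2 ≤ L ^ 2 := by gcongr
    have h2 : Real.exp (t * f) ≤ 2 := by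
      have h3 : t * f ≤ 1 / 8 := (mul_le_mul_of_nonneg_left h ht).trans htL
      exact (Real.exp_le_exp.2 h3).trans (h8.trans (by norm_num))
    have h4 : f ^ 2 * Real.exp (t * f) ≤ L ^ 2 * 2 :=
      mul_le_mul h1 h2 (Real.exp_pos _).le (by positivity)
    have h5 := mul_le_mul_of_nonneg_left h4 hq
    have h6 : 0 ≤ L ^ 2 * (6 * Real.exp (-L)) := by positivity
    linarith
  · set g := f - L with hg
    have hg0 : 0 ≤ g := sub_nonneg.2 h
    have h1 : f ^ 2 ≤ (L * (1 + g)) ^ 2 := by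
      have : f ≤ L * (1 + g) := by nlinarith
      gcongr
    have h2 : q * Real.exp (t * f) ≤ Real.exp (-L) * (Real.exp (1 / 8) * Real.exp (-(7 / 8 * g))) := by
      rw [hqe, ← Real.exp_add, ← Real.exp_add, ← Real.exp_add, Real.exp_le_exp]
      have : f = g + L := by rw [hg]; ring
      rw [this]
      nlinarith
    have h3 : (1 + g) ^ 2 ≤ (16 / 7) ^ 2 * Real.exp (7 / 8 * g) := by
      have h4 := Real.add_one_le_exp (7 / 16 * g)
      have h5 : (1 + g) ≤ 16 / 7 * Real.exp (7 / 16 * g) := by linarith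
      have h6 : Real.exp (7 / 8 * g) = Real.exp (7 / 16 * g) ^ 2 := by
        rw [← Real.exp_nat_mul]; congr 1; push_cast; ring
      rw [h6, ← mul_pow]
      gcongr
    have h7 : Real.exp (7 / 8 * g) * Real.exp (-(7 / 8 * g)) = 1 := by
      rw [← Real.exp_add]; simp
    calc q * (f ^ 2 * Real.exp (t * f)) = f ^ 2 * (q * Real.exp (t * f)) := by ring
      _ ≤ (L * (1 + g)) ^ 2 * (Real.exp (-L) * (Real.exp (1 / 8) * Real.exp (-(7 / 8 * g)))) :=
          mul_le_mul h1 h2 (by positivity) (by positivity)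
      _ = (L ^ 2 * Real.exp (-L) * Real.exp (1 / 8) * Real.exp (-(7 / 8 * g))) * (1 + g) ^ 2 := by
          ring
      _ ≤ (L ^ 2 * Real.exp (-L) * Real.exp (1 / 8) * Real.exp (-(7 / 8 * g))) *
          ((16 / 7) ^ 2 * Real.exp (7 / 8 * g)) := mul_le_mul_of_nonneg_left h3 (by positivity)
      _ = (L ^ 2 * Real.exp (-L)) * ((16 / 7) ^ 2 * Real.exp (1 / 8)) *
          (Real.exp (7 / 8 * g) * Real.exp (-(7 / 8 * g))) := by ring
      _ ≤ (L ^ 2 * Real.exp (-L)) * 6 := by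
          rw [h7, mul_one]
          refine mul_le_mul_of_nonneg_left ?_ (by positivity)
          norm_num at h8 ⊢
          linarith
      _ ≤ _ := by nlinarith [mul_nonneg (sq_nonneg L) hq]

/-- Summing the preceding bound over `U` gives a weighted second moment of at most `2 L² + 6 |U| exp
(-L) L² ≤ 5 L²`. With `t = s / (5 L)` the drift `t (2 s L) = 2 s² / 5` exceeds the quadratic term `5
t² L² = s² / 5` by the stated rate. -/
theorem exists_sum_mul_exp_le (hp : p ∈ stdSimplex ℝ Ω) (S : Ω → U) (T : Ω → V) {s L b : ℝ}
    (hs : 0 < s) (hs2 : s ≤ 1 / 2) (hL : 1 ≤ L) (hU : Fintype.card U * Real.exp (-L) ≤ 1 / 2)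
    (hb : condEntropy p S T * Real.log 2 + 2 * s * L ≤ b) :
    ∃ t : ℝ, 0 ≤ t ∧ ∑ ω, p ω * Real.exp (t * (Real.log (1 / condProb p S T (S ω) (T ω)) - b)) ≤
      Real.exp (-(s ^ 2 / 5)) := by
  set t : ℝ := s / (5 * L) with ht
  have hL0 : 0 < L := by linarith
  have ht0 : 0 ≤ t := by positivity
  have htL : t * L = s / 5 := by rw [ht]; field_simp
  set f : U → V → ℝ := fun u v => Real.log (1 / condProb p S T u v) with hf
  have hf0 : ∀ u v, 0 ≤ f u v := by
    intro u v
    simp only [hf, one_div, Real.log_inv]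
    linarith [Real.log_nonpos (condProb_nonneg hp.1 S T u v) (condProb_le_one hp.1 S T u v)]
  have h1 : ∑ ω, p ω * f (S ω) (T ω) = condEntropy p S T * Real.log 2 := by
    rw [sum_mul_comp_pair hp.1 S T f, condEntropy_mul_log]; rfl
  have h2 : ∑ ω, p ω * (f (S ω) (T ω) ^ 2 * Real.exp (t * f (S ω) (T ω))) ≤ 5 * L ^ 2 := by
    rw [sum_mul_comp_pair hp.1 S T (fun u v => f u v ^ 2 * Real.exp (t * f u v))]
    have h3 : ∀ v, ∑ u, condProb p S T u v * (f u v ^ 2 * Real.exp (t * f u v)) ≤ 5 * L ^ 2 := by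
      intro v
      refine (Finset.sum_le_sum fun u _ => mul_log_sq_mul_exp_le (condProb_nonneg hp.1 S T u v)
        (condProb_le_one hp.1 S T u v) hL ht0 (by rw [htL]; linarith)).trans ?_
      rw [← Finset.mul_sum, Finset.sum_add_distrib, ← Finset.mul_sum, Finset.sum_const,
        Finset.card_univ, nsmul_eq_mul]
      have := sum_condProb_le p S T v
      nlinarith [sq_nonneg L]
    refine (Finset.sum_le_sum fun v _ => mul_le_mul_of_nonneg_left (h3 v)
      (law_nonneg hp.1 T v)).trans ?_
    rw [← Finset.sum_mul, (law_mem_stdSimplex hp T).2, one_mul]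
  refine ⟨t, ht0, ?_⟩
  have h4 : ∀ ω, p ω * Real.exp (t * (f (S ω) (T ω) - b)) ≤
      (p ω + t * (p ω * f (S ω) (T ω)) +
        t ^ 2 * (p ω * (f (S ω) (T ω) ^ 2 * Real.exp (t * f (S ω) (T ω))))) *
        Real.exp (-(t * b)) := by
    intro ω
    have h5 := exp_le_one_add_add (mul_nonneg ht0 (hf0 (S ω) (T ω)))
    have h6 : Real.exp (t * (f (S ω) (T ω) - b)) =
        Real.exp (t * f (S ω) (T ω)) * Real.exp (-(t * b)) := by
      rw [← Real.exp_add]; congr 1; ring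
    rw [h6, ← mul_assoc]
    refine mul_le_mul_of_nonneg_right ?_ (Real.exp_pos _).le
    have := mul_le_mul_of_nonneg_left h5 (hp.1 ω)
    refine this.trans (le_of_eq ?_)
    ring
  refine (Finset.sum_le_sum fun ω _ => h4 ω).trans ?_
  rw [← Finset.sum_mul, Finset.sum_add_distrib, Finset.sum_add_distrib, ← Finset.mul_sum,
    ← Finset.mul_sum, hp.2, h1]
  set H := condEntropy p S T * Real.log 2 with hH
  have h7 : 1 + t * H + t ^ 2 * ∑ ω, p ω * (f (S ω) (T ω) ^ 2 * Real.exp (t * f (S ω) (T ω))) ≤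
      Real.exp (t * H + s ^ 2 / 5) := by
    have h8 := mul_le_mul_of_nonneg_left h2 (sq_nonneg t)
    have h9 : t ^ 2 * (5 * L ^ 2) = s ^ 2 / 5 := by
      have : t ^ 2 * (5 * L ^ 2) = 5 * (t * L) ^ 2 := by ring
      rw [this, htL]; ring
    linarith [Real.add_one_le_exp (t * H + s ^ 2 / 5)]
  refine (mul_le_mul_of_nonneg_right h7 (Real.exp_pos _).le).trans ?_
  rw [← Real.exp_add, Real.exp_le_exp]
  have h10 := mul_le_mul_of_nonneg_left hb ht0
  have h11 : t * (2 * s * L) = 2 * s ^ 2 / 5 := by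
    have : t * (2 * s * L) = 2 * s * (t * L) := by ring
    rw [this, htL]; ring
  linarith

/-- The probability that the conditional information is large is exponentially small. -/
theorem sum_prod_ind_condProb_lt_le (hp : p ∈ stdSimplex ℝ Ω) (S : Ω → U) (T : Ω → V) {s L b : ℝ}
    (hs : 0 < s) (hs2 : s ≤ 1 / 2) (hL : 1 ≤ L) (hU : Fintype.card U * Real.exp (-L) ≤ 1 / 2)
    (hb : condEntropy p S T * Real.log 2 + 2 * s * L ≤ b) (n : ℕ) :
    ∑ ω : Fin n → Ω, (∏ i, p (ω i)) *
      ind (∏ i, condProb p S T (S (ω i)) (T (ω i)) < Real.exp (-(n * b))) ≤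
      Real.exp (-(n * (s ^ 2 / 5))) := by
  obtain ⟨t, ht0, ht⟩ := exists_sum_mul_exp_le hp S T hs hs2 hL hU hb
  refine (sum_prod_ind_le (fun _ => p)
    (fun _ ω => Real.log (1 / condProb p S T (S ω) (T ω)) - b) (fun _ => hp.1) ht0 _ ?_).trans ?_
  · intro ω h h0
    have hpos : ∀ i, 0 < condProb p S T (S (ω i)) (T (ω i)) := fun i =>
      condProb_pos hp.1 S T (lt_of_le_of_ne (hp.1 _)
        (Ne.symm (Finset.prod_ne_zero_iff.1 h0 i (Finset.mem_univ i))))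
    rw [exp_neg_sum_log _ hpos, Real.exp_lt_exp] at h
    rw [Finset.sum_sub_distrib, Finset.sum_const, Finset.card_univ, Fintype.card_fin, nsmul_eq_mul]
    linarith
  · rw [Finset.prod_const, Finset.card_univ, Fintype.card_fin, ← mul_neg, Real.exp_nat_mul]
    exact pow_le_pow_left₀ (Finset.sum_nonneg fun ω _ => mul_nonneg (hp.1 ω) (Real.exp_pos _).le)
      ht n

end Laws

theorem sum_sum_arrow {α β : Type*} [Fintype α] [Fintype β] {n : ℕ}
    (φ : (Fin n → α) → (Fin n → β) → ℝ) :
    ∑ a, ∑ b, φ a b = ∑ v : Fin n → α × β, φ (fun i => (v i).1) (fun i => (v i).2) := by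
  rw [← Fintype.sum_prod_type']
  exact (Fintype.sum_equiv (Equiv.arrowProdEquivProdArrow (Fin n) (fun _ => α) (fun _ => β))
    _ _ fun v => rfl).symm

/-- Applied with `G` a typical set: an initial segment no larger than `G` inherits its likelihood
bound. -/
theorem exists_isBest_of_large {Ω : Type*} [Fintype Ω] {rank : Ω → ℕ}
    (hr : Function.Injective rank) {f : Ω → ℝ} {G : Finset Ω} {t : ℝ} (hG : ∀ u ∈ G, t ≤ f u)
    {N : ℕ} (hN : N ≤ G.card) :
    ∃ S : Finset Ω, S.card = N ∧ IsBest rank f S ∧ ∀ u ∈ S, t ≤ f u := by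
  obtain ⟨S, h1, h2⟩ := exists_isBest rank hr f N (hN.trans (Finset.card_le_univ G))
  exact ⟨S, h1, h2, fun u hu => h2.le_of_card_le hG (h1.le.trans hN) hu⟩

/-! ### Factorization of the joint law and its memoryless extension -/

section Joint

variable {X Y Z W : Type*} [Fintype X] [Fintype Y] [Fintype Z] [Fintype W]
  {μZ : Z → ℝ} {μXW : Z → X × W → ℝ} {μY : X → Z → Y → ℝ}

theorem law_joint_rvZ (hμXW : ∀ z, μXW z ∈ stdSimplex ℝ (X × W))
    (hμY : ∀ x z, μY x z ∈ stdSimplex ℝ Y) (z : Z) : law (joint μZ μXW μY) rvZ z = μZ z := by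
  classical
  unfold law joint rvZ
  simp only [Fintype.sum_prod_type]
  have h1 : ∀ x : X, ∀ y : Y, ∑ z' : Z, ∑ w : W,
      (if z' = z then μXW z' (x, w) * μY x z' y * μZ z' else 0) =
      (∑ w, μXW z (x, w)) * μY x z y * μZ z := by
    intro x y
    rw [Finset.sum_eq_single z]
    · simp [Finset.sum_mul]
    · intro z' _ hz'; simp [hz']
    · simp
  simp only [h1, ← Finset.sum_mul, ← Finset.mul_sum, (hμY _ _).2, mul_one]
  rw [← Fintype.sum_prod_type', (hμXW z).2, one_mul]

theorem joint_mem_stdSimplex (hμZ : μZ ∈ stdSimplex ℝ Z)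
    (hμXW : ∀ z, μXW z ∈ stdSimplex ℝ (X × W)) (hμY : ∀ x z, μY x z ∈ stdSimplex ℝ Y) :
    joint μZ μXW μY ∈ stdSimplex ℝ (X × Y × Z × W) := by
  refine ⟨fun ω => mul_nonneg (mul_nonneg ((hμXW _).1 _) ((hμY _ _).1 _)) (hμZ.1 _), ?_⟩
  have := sum_mul_comp (joint μZ μXW μY) rvZ (fun _ => 1)
  simp only [mul_one] at this
  rw [this]
  simp only [law_joint_rvZ hμXW hμY, hμZ.2]

theorem law_joint_rvXZW (hμY : ∀ x z, μY x z ∈ stdSimplex ℝ Y) (x : X) (z : Z) (w : W) :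
    law (joint μZ μXW μY) (fun ω => (rvX ω, rvZW ω)) (x, (z, w)) = μXW z (x, w) * μZ z := by
  classical
  unfold law joint rvX rvZW
  simp only [Fintype.sum_prod_type, Prod.mk.injEq]
  rw [Finset.sum_eq_single x]
  · have h1 : ∀ y : Y, ∑ z' : Z, ∑ w' : W,
        (if x = x ∧ z' = z ∧ w' = w then μXW z' (x, w') * μY x z' y * μZ z' else 0) =
        μXW z (x, w) * μY x z y * μZ z := by
      intro y
      rw [Finset.sum_eq_single z]
      · rw [Finset.sum_eq_single w]
        · simp
        · intro w' _ hw'; simp [hw']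
        · simp
      · intro z' _ hz'; simp [hz']
      · simp
    rw [Finset.sum_congr rfl fun y _ => h1 y, ← Finset.sum_mul, ← Finset.mul_sum, (hμY _ _).2,
      mul_one]
  · intro x' _ hx'; simp [hx']
  · simp

theorem law_rvZW (p : X × Y × Z × W → ℝ) (z : Z) (w : W) :
    law p rvZW (z, w) = law p (fun ω => (rvW ω, rvZ ω)) (w, z) := by
  classical
  unfold law rvZW rvW rvZ
  refine Finset.sum_congr rfl fun ω _ => ?_
  simp only [Prod.mk.injEq, and_comm]

theorem law_rvZW_eq (hμZ : μZ ∈ stdSimplex ℝ Z)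
    (hμXW : ∀ z, μXW z ∈ stdSimplex ℝ (X × W)) (hμY : ∀ x z, μY x z ∈ stdSimplex ℝ Y)
    (z : Z) (w : W) :
    law (joint μZ μXW μY) rvZW (z, w) = μZ z * condProb (joint μZ μXW μY) rvW rvZ w z := by
  rw [law_rvZW, ← condProb_mul_law (joint_mem_stdSimplex hμZ hμXW hμY).1, law_joint_rvZ hμXW hμY,
    mul_comm]

theorem joint_eq (hμZ : μZ ∈ stdSimplex ℝ Z)
    (hμXW : ∀ z, μXW z ∈ stdSimplex ℝ (X × W)) (hμY : ∀ x z, μY x z ∈ stdSimplex ℝ Y)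
    (x : X) (y : Y) (z : Z) (w : W) :
    joint μZ μXW μY (x, y, z, w) = μZ z * condProb (joint μZ μXW μY) rvW rvZ w z *
      condProb (joint μZ μXW μY) rvX rvZW x (z, w) * μY x z y := by
  rw [← law_rvZW_eq hμZ hμXW hμY, mul_comm (law _ _ _),
    condProb_mul_law (joint_mem_stdSimplex hμZ hμXW hμY).1, law_joint_rvXZW hμY]
  unfold joint
  ring

/-- The left side is summed in the order in which the code acts, state, word, input, output, so that
the changes of measure for `w` and `x` end in a single memoryless probability. -/
theorem sum_seq_joint {n : ℕ} (hμZ : μZ ∈ stdSimplex ℝ Z)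
    (hμXW : ∀ z, μXW z ∈ stdSimplex ℝ (X × W)) (hμY : ∀ x z, μY x z ∈ stdSimplex ℝ Y)
    (φ : (Fin n → W) → (Fin n → Y) → ℝ) :
    ∑ z : Fin n → Z, (∏ i, μZ (z i)) * ∑ w : Fin n → W,
      condProbSeq (joint μZ μXW μY) rvW rvZ z w * ∑ x : Fin n → X,
        condProbSeq (joint μZ μXW μY) rvX rvZW (fun i => (z i, w i)) x *
          ∑ y : Fin n → Y, (∏ i, μY (x i) (z i) (y i)) * φ w y =
    ∑ ω : Fin n → X × Y × Z × W, (∏ i, joint μZ μXW μY (ω i)) *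
      φ (fun i => rvW (ω i)) (fun i => rvY (ω i)) := by
  have e : ∀ (x : Fin n → X) (y : Fin n → Y) (z : Fin n → Z) (w : Fin n → W),
      (∏ i, μZ (z i)) * (condProbSeq (joint μZ μXW μY) rvW rvZ z w *
        (condProbSeq (joint μZ μXW μY) rvX rvZW (fun i => (z i, w i)) x *
          ((∏ i, μY (x i) (z i) (y i)) * φ w y))) =
      (∏ i, joint μZ μXW μY (x i, y i, z i, w i)) * φ w y := by
    intro x y z w
    simp only [joint_eq hμZ hμXW hμY, Finset.prod_mul_distrib, condProbSeq]
    ring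
  have r : ∑ ω : Fin n → X × Y × Z × W, (∏ i, joint μZ μXW μY (ω i)) *
      φ (fun i => rvW (ω i)) (fun i => rvY (ω i)) =
      ∑ x : Fin n → X, ∑ y : Fin n → Y, ∑ z : Fin n → Z, ∑ w : Fin n → W,
        (∏ i, joint μZ μXW μY (x i, y i, z i, w i)) * φ w y := by
    refine (sum_sum_arrow (fun (x : Fin n → X) (v : Fin n → Y × Z × W) =>
      (∏ i, joint μZ μXW μY (x i, v i)) * φ (fun i => (v i).2.2) (fun i => (v i).1))).symm.trans ?_
    refine Finset.sum_congr rfl fun x _ => ?_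
    refine (sum_sum_arrow (fun (y : Fin n → Y) (v : Fin n → Z × W) =>
      (∏ i, joint μZ μXW μY (x i, y i, v i)) * φ (fun i => (v i).2) y)).symm.trans ?_
    refine Finset.sum_congr rfl fun y _ => ?_
    exact (sum_sum_arrow (fun (z : Fin n → Z) (w : Fin n → W) =>
      (∏ i, joint μZ μXW μY (x i, y i, z i, w i)) * φ w y)).symm
  rw [r]
  simp only [Finset.mul_sum, e]
  have c1 : ∀ z : Fin n → Z, ∑ w : Fin n → W, ∑ x : Fin n → X, ∑ y : Fin n → Y,
      (∏ i, joint μZ μXW μY (x i, y i, z i, w i)) * φ w y = ∑ x : Fin n → X, ∑ y : Fin n → Y,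
      ∑ w : Fin n → W, (∏ i, joint μZ μXW μY (x i, y i, z i, w i)) * φ w y := by
    intro z
    rw [Finset.sum_comm]
    exact Finset.sum_congr rfl fun x _ => Finset.sum_comm
  simp only [c1]
  rw [Finset.sum_comm]
  exact Finset.sum_congr rfl fun x _ => Finset.sum_comm

theorem condProbSeq_nonneg {Ω U V : Type*} [Fintype Ω] [Fintype U] [Fintype V] {p : Ω → ℝ}
    (hp : ∀ ω, 0 ≤ p ω) (S : Ω → U) (T : Ω → V) {n : ℕ} (v : Fin n → V) (u : Fin n → U) :
    0 ≤ condProbSeq p S T v u :=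
  Finset.prod_nonneg fun _ _ => condProb_nonneg hp S T _ _

theorem sum_condProbSeq_le {Ω U V : Type*} [Fintype Ω] [Fintype U] [Fintype V] {p : Ω → ℝ}
    (hp : ∀ ω, 0 ≤ p ω) (S : Ω → U) (T : Ω → V) {n : ℕ} (v : Fin n → V) :
    ∑ u : Fin n → U, condProbSeq p S T v u ≤ 1 := by
  unfold condProbSeq
  rw [sum_prod_eq_prod_sum (fun i u => condProb p S T u (v i))]
  exact Finset.prod_le_one (fun i _ => Finset.sum_nonneg fun u _ => condProb_nonneg hp S T u _)
    fun i _ => sum_condProb_le p S T (v i)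

/-- Few sequences are at least as likely as a given likely sequence. -/
theorem card_le_of_le_condProbSeq {Ω U V : Type*} [Fintype Ω] [Fintype U] [Fintype V] {p : Ω → ℝ}
    (hp : ∀ ω, 0 ≤ p ω) (S : Ω → U) (T : Ω → V) {n : ℕ} (v : Fin n → V) {x : ℝ}
    (G : Finset (Fin n → U)) (hG : ∀ u ∈ G, Real.exp (-x) ≤ condProbSeq p S T v u) :
    (G.card : ℝ) ≤ Real.exp x := by
  have h1 : (G.card : ℝ) * Real.exp (-x) ≤ 1 := by
    rw [← nsmul_eq_mul, ← Finset.sum_const]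
    refine (Finset.sum_le_sum hG).trans ((Finset.sum_le_univ_sum_of_nonneg fun u =>
      condProbSeq_nonneg hp S T v u).trans (sum_condProbSeq_le hp S T v))
  have h2 := mul_le_mul_of_nonneg_right h1 (Real.exp_pos x).le
  rwa [mul_assoc, ← Real.exp_add, neg_add_cancel, Real.exp_zero, mul_one, one_mul] at h2

omit [Fintype X] in
theorem errorProb_eq {n l : ℕ} (ℬ : Ensemble (Fin n → W) (Fin l → W))
    (enc : (Fin l → W) → (Fin n → Z) → (Fin n → X)) (dec : (Fin n → Y) → (Fin l → W)) :
    errorProb μZ μY ℬ.image enc dec = ∑ m, ℬ.unif m * ∑ z : Fin n → Z, (∏ i, μZ (z i)) *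
      ∑ y : Fin n → Y, (∏ i, μY (enc m z i) (z i) (y i)) * ind (dec y ≠ m) := by
  classical
  unfold errorProb
  refine Finset.sum_congr rfl fun m _ => ?_
  rw [Finset.sum_comm, Finset.mul_sum]
  refine Finset.sum_congr rfl fun z _ => ?_
  rw [Finset.mul_sum, Finset.mul_sum]
  refine Finset.sum_congr rfl fun y _ => ?_
  have h1 : ℬ.unif m = if m ∈ ℬ.image then 1 / (ℬ.image.ncard : ℝ) else 0 := by
    unfold Ensemble.unif ind
    split_ifs <;> simp
  have h2 : ind (dec y ≠ m) = if dec y ≠ m then 1 else 0 := by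
    unfold ind
    by_cases h : dec y ≠ m <;> simp [h]
  rw [h1, h2]
  ring

end Joint

/-! ### The coding theorem with abstract exponents -/

section Coding

variable {X Y Z W : Type*} [Fintype X] [Fintype Y] [Fintype Z] [Fintype W]
  {μZ : Z → ℝ} {μXW : Z → X × W → ℝ} {μY : X → Z → Y → ℝ}

/-- The entropy in nats of `X` given the values of `Z` and `W`. -/
noncomputable def entX (μZ : Z → ℝ) (μXW : Z → X × W → ℝ) (μY : X → Z → Y → ℝ) (v : Z × W) : ℝ :=
  natEntropy (fun x => condProb (joint μZ μXW μY) rvX rvZW x v)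

/-- The entropy in nats of `W` given the value of `Z`. -/
noncomputable def entW (μZ : Z → ℝ) (μXW : Z → X × W → ℝ) (μY : X → Z → Y → ℝ) (z : Z) : ℝ :=
  natEntropy (fun w => condProb (joint μZ μXW μY) rvW rvZ w z)

theorem missProb_eq_zero_of_subsingleton {Ω V : Type*} [Fintype Ω] [Fintype V] [Subsingleton V]
    (E : Ensemble Ω V) {S : Finset Ω} (hS : S.Nonempty) : missProb E S = 0 := by
  unfold missProb Ensemble.avg
  refine Finset.sum_eq_zero fun i _ => ?_
  obtain ⟨u, hu⟩ := hS
  have h0 : ind (∀ u ∈ S, i.1 u ≠ i.2) = 0 := ind_false fun h => h u hu (Subsingleton.elim _ _)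
  simp only [h0, mul_zero]

theorem ceil_mul_le {K r : ℝ} (hK : 0 ≤ K) (hr : 1 ≤ r) : (⌈K * r⌉₊ : ℝ) ≤ (K + 1) * r := by
  have := Nat.ceil_lt_add_one (mul_nonneg hK (zero_le_one.trans hr))
  linarith

open Filter

variable (hμZ : μZ ∈ stdSimplex ℝ Z) (hμXW : ∀ z, μXW z ∈ stdSimplex ℝ (X × W))
  (hμY : ∀ x z, μY x z ∈ stdSimplex ℝ Y)

include hμZ hμXW hμY

/-- Change of measure for the auxiliary word. -/
theorem sum_state_word_le {n : ℕ} {T : (Fin n → Z) → Finset (Fin n → W)} {r C : ℝ}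
    (good : (Fin n → Z) → Prop) (hC : 0 ≤ C)
    (hT : ∀ z, good z → ∀ w ∈ T z, 1 / r ≤ C * condProbSeq (joint μZ μXW μY) rvW rvZ z w)
    (ψ : (Fin n → Z) → (Fin n → W) → ℝ) (hψ : ∀ z w, 0 ≤ ψ z w) :
    ∑ z : Fin n → Z, (∏ i, μZ (z i)) * (ind (good z) * ((∑ w ∈ T z, ψ z w) / r)) ≤
      C * ∑ z : Fin n → Z, (∏ i, μZ (z i)) * ∑ w,
        condProbSeq (joint μZ μXW μY) rvW rvZ z w * ψ z w := by
  have hp := (joint_mem_stdSimplex hμZ hμXW hμY).1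
  rw [Finset.mul_sum]
  refine Finset.sum_le_sum fun z _ => ?_
  rw [mul_left_comm C]
  refine mul_le_mul_of_nonneg_left ?_ (Finset.prod_nonneg fun i _ => hμZ.1 _)
  have h0 : ∀ w, 0 ≤ condProbSeq (joint μZ μXW μY) rvW rvZ z w * ψ z w := fun w =>
    mul_nonneg (condProbSeq_nonneg hp _ _ _ _) (hψ z w)
  by_cases hz : good z
  · rw [ind_true hz, one_mul, Finset.sum_div, Finset.mul_sum]
    refine le_trans ?_ (Finset.sum_le_univ_sum_of_nonneg (s := T z)
      fun w => mul_nonneg hC (h0 w))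
    refine Finset.sum_le_sum fun w hw => ?_
    rw [div_eq_mul_one_div, mul_comm (ψ z w), ← mul_assoc]
    exact mul_le_mul_of_nonneg_right (hT z hz w hw) (hψ z w)
  · rw [ind_false hz, zero_mul]
    exact mul_nonneg hC (Finset.sum_nonneg fun w _ => h0 w)

/-- Change of measure for the channel input. -/
theorem sum_input_le {n : ℕ} (z : Fin n → Z) (w : Fin n → W) {S : Finset (Fin n → X)} {r C : ℝ}
    (hC : 0 ≤ C)
    (hS : ∀ x ∈ S, 1 / r ≤ C * condProbSeq (joint μZ μXW μY) rvX rvZW (fun i => (z i, w i)) x)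
    (ψ : (Fin n → X) → ℝ) (hψ : ∀ x, 0 ≤ ψ x) :
    (∑ x ∈ S, ψ x) / r ≤ C * ∑ x, condProbSeq (joint μZ μXW μY) rvX rvZW (fun i => (z i, w i)) x
      * ψ x := by
  have hp := (joint_mem_stdSimplex hμZ hμXW hμY).1
  rw [Finset.sum_div, Finset.mul_sum]
  refine le_trans ?_ (Finset.sum_le_univ_sum_of_nonneg (s := S)
      fun x => mul_nonneg hC (mul_nonneg (condProbSeq_nonneg hp _ _ _ _) (hψ x)))
  refine Finset.sum_le_sum fun x hx => ?_
  rw [div_eq_mul_one_div, mul_comm (ψ x), ← mul_assoc]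
  exact mul_le_mul_of_nonneg_right (hS x hx) (hψ x)

theorem sum_state_word_eq {n : ℕ} (ψ : (Fin n → Z × W) → ℝ) :
    ∑ z : Fin n → Z, (∏ i, μZ (z i)) * ∑ w,
        condProbSeq (joint μZ μXW μY) rvW rvZ z w * ψ (fun i => (z i, w i)) =
      ∑ v : Fin n → Z × W, (∏ i, law (joint μZ μXW μY) rvZW (v i)) * ψ v := by
  simp only [Finset.mul_sum]
  rw [sum_sum_arrow (fun (z : Fin n → Z) (w : Fin n → W) => (∏ i, μZ (z i)) *
    (condProbSeq (joint μZ μXW μY) rvW rvZ z w * ψ (fun i => (z i, w i))))]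
  refine Finset.sum_congr rfl fun v _ => ?_
  have : ∀ i, law (joint μZ μXW μY) rvZW (v i) =
      μZ (v i).1 * condProb (joint μZ μXW μY) rvW rvZ (v i).2 (v i).1 := fun i =>
    law_rvZW_eq hμZ hμXW hμY (v i).1 (v i).2
  simp only [this, Finset.prod_mul_distrib, condProbSeq]
  ring

set_option maxHeartbeats 1000000 in
/-- The coding theorem for ensembles whose numbers of bins and exponents are suitable; all
quantities are in nats. -/
theorem eventually_existsCode {lA lB lA' : ℕ → ℕ}
    {𝒜 : ∀ n, Ensemble (Fin n → W) (Fin (lA n) → W)}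
    {ℬ : ∀ n, Ensemble (Fin n → W) (Fin (lB n) → W)}
    {𝒜' : ∀ n, Ensemble (Fin n → X) (Fin (lA' n) → X)}
    (h𝒜 : HasHashProperty 𝒜) (h𝒜ℬ : HasJointHashProperty 𝒜 ℬ) (h𝒜' : HasHashProperty 𝒜')
    {HZ HY HX e Δ a a' θ ρ₁ ρ₂ : ℝ}
    (hHZ : HZ = ∑ z, μZ z * entW μZ μXW μY z)
    (he : 0 < e) (hΔ : 4 * e ≤ Δ) (ha' : θ + 4 * e ≤ a') (hρ₁ : Δ + 4 * e ≤ ρ₁)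
    (hρ₂ : Δ + a' + θ + 6 * e ≤ ρ₂)
    (tail₁ : ∀ n : ℕ, ∑ v : Fin n → Z × W, (∏ i, law (joint μZ μXW μY) rvZW (v i)) *
      ind (n * θ ≤ |∑ i, entX μZ μXW μY (v i) - n * HX|) ≤ 2 * Real.exp (-(n * ρ₁)))
    (tail₂ : ∀ n : ℕ, ∑ ω : Fin n → X × Y × Z × W, (∏ i, joint μZ μXW μY (ω i)) *
      ind (∏ i, condProb (joint μZ μXW μY) rvW rvY (rvW (ω i)) (rvY (ω i)) <
        Real.exp (-(n * (HY + a - 3 * e)))) ≤ Real.exp (-(n * ρ₂)))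
    (size₁ : ∀ᶠ n : ℕ in atTop, Real.exp (n * (HY + a - e)) ≤ (𝒜 n).image.ncard)
    (size₂ : ∀ᶠ n : ℕ in atTop, Real.exp (n * (HZ - Δ - e)) ≤
      ((𝒜 n).image.ncard : ℝ) * (ℬ n).image.ncard)
    (size₃ : ∀ᶠ n : ℕ in atTop, ((𝒜 n).image.ncard : ℝ) * (ℬ n).image.ncard ≤
      Real.exp (n * (HZ - Δ + e)))
    (size₄ : ∀ᶠ n : ℕ in atTop, Real.exp (n * (HX - a' - e)) ≤ (𝒜' n).image.ncard)
    (size₅ : ∀ᶠ n : ℕ in atTop, lA' n = 0 ∨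
      ((𝒜' n).image.ncard : ℝ) ≤ Real.exp (n * (HX - a' + e)))
    {δ : ℝ} (hδ : 0 < δ) :
    ∀ᶠ n : ℕ in atTop, ∀ (rankW : (Fin n → W) → ℕ) (rankX : (Fin n → X) → ℕ),
      Function.Injective rankW → Function.Injective rankX →
      ∀ ρ ≤ rate (ℬ n), ExistsCode μZ μXW μY (𝒜 n) (ℬ n) (𝒜' n) rankW rankX ρ δ := by
  set p := joint μZ μXW μY with hpdef
  have hp : p ∈ stdSimplex ℝ _ := joint_mem_stdSimplex hμZ hμXW hμY
  have hneZ : Nonempty Z := by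
    by_contra h
    rw [not_nonempty_iff] at h
    simpa using hμZ.2
  have hneXW : Nonempty (X × W) := by
    by_contra h
    rw [not_nonempty_iff] at h
    simpa using (hμXW (Classical.arbitrary Z)).2
  have hneX : Nonempty X := hneXW.map Prod.fst
  have hneW : Nonempty W := hneXW.map Prod.snd
  -- constants
  set σ : ℝ := min δ 1 / 12 with hσ
  have hδ1 : 0 < min δ 1 := lt_min hδ one_pos
  have hσ0 : 0 < σ := by positivity
  have hσ1 : σ ≤ 1 / 12 := by
    rw [hσ]; linarith [min_le_right δ 1]
  set K : ℝ := 3 / σ with hK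
  have hK1 : 1 ≤ K := by rw [hK, le_div_iff₀ hσ0]; linarith
  have hKσ : 3 / K = σ := by rw [hK]; field_simp
  set K' : ℝ := 3 * (K + 1) / σ with hK'
  have hK'1 : 1 ≤ K' := by rw [hK', le_div_iff₀ hσ0]; linarith
  have hK'σ : (K + 1) * (3 / K') = σ := by rw [hK']; field_simp
  set σ₅ : ℝ := σ / ((K + 1) * (K' + 1)) with hσ₅
  have hσ₅0 : 0 < σ₅ := by positivity
  -- eventual facts
  have hWimg : ∀ n, ∀ f ∈ ((𝒜 n).prod (ℬ n)).carrier, ∀ u,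
      f u ∈ (𝒜 n).image ×ˢ (ℬ n).image := fun n f hf u =>
    ⟨(𝒜 n).mem_image_of_mem hf.1 u, (ℬ n).mem_image_of_mem hf.2 u⟩
  have hposA : ∀ n, 0 < (𝒜 n).image.ncard := fun n => by exact_mod_cast (𝒜 n).ncard_image_pos
  have hposB : ∀ n, 0 < (ℬ n).image.ncard := fun n => by exact_mod_cast (ℬ n).ncard_image_pos
  have hposX : ∀ n, 0 < (𝒜' n).image.ncard := fun n => by exact_mod_cast (𝒜' n).ncard_image_pos
  have ev_missT := HashPropertyOn.eventually_missProbOn_le h𝒜ℬ hWimg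
    (fun n => by rw [Set.ncard_prod]; exact Nat.mul_pos (hposA n) (hposB n)) hK1
  have ev_missS := HashPropertyOn.eventually_missProbOn_le h𝒜'
    (fun n f hf u => (𝒜' n).mem_image_of_mem hf u) hposX hK'1
  have ev_coll := HashPropertyOn.eventually_collision_le h𝒜 (half_pos hσ₅0)
  have ev_typW := eventually_exists_typical (fun (z : Z) w => condProb p rvW rvZ w z) he
  have ev_typX := eventually_exists_typical (fun (v : Z × W) x => condProb p rvX rvZW x v) he
  have ev_z := eventually_tail_lt (F := entW μZ μXW μY) hμZ he hσ0
  have ev_e : ∀ᶠ n : ℕ in atTop, Real.exp (-(n * e)) < min (1 / (2 * (K + 1)))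
      (min (1 / (2 * (K' + 1))) (min (σ / 2) (σ₅ / 4))) :=
    eventually_exp_neg_lt he (by positivity)
  filter_upwards [ev_missT, ev_missS, ev_coll, ev_typW, ev_typX, ev_z, ev_e, size₁, size₂, size₃,
    size₄, size₅] with n missT missS coll typW typX tz he' s1 s2 s3 s4 s5 rankW rankX hrW hrX ρ hρ
  rw [lt_min_iff, lt_min_iff, lt_min_iff] at he'
  obtain ⟨heK, heK', heσ, heσ₅⟩ := he'
  have hn0 : (0 : ℝ) ≤ n := Nat.cast_nonneg n
  set rA : ℝ := ((𝒜 n).image.ncard : ℝ) with hrA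
  set rB : ℝ := ((ℬ n).image.ncard : ℝ) with hrB
  set rX : ℝ := ((𝒜' n).image.ncard : ℝ) with hrXd
  have hrA0 : 0 < rA := (𝒜 n).ncard_image_pos
  have hrB0 : 0 < rB := (ℬ n).ncard_image_pos
  have hrX0 : 0 < rX := (𝒜' n).ncard_image_pos
  have hrA1 : 1 ≤ rA := by rw [hrA]; exact_mod_cast hposA n
  have hrB1 : 1 ≤ rB := by rw [hrB]; exact_mod_cast hposB n
  have hrX1 : 1 ≤ rX := by rw [hrXd]; exact_mod_cast hposX n
  have hr1 : 1 ≤ rA * rB := by nlinarith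
  -- the bad events
  set bz : (Fin n → Z) → Prop := fun z => (∃ i, μZ (z i) = 0) ∨
    n * e ≤ |∑ i, entW μZ μXW μY (z i) - n * HZ| with hbz
  set b1 : (Fin n → Z) → (Fin n → W) → Prop := fun z w =>
    n * θ ≤ |∑ i, entX μZ μXW μY (z i, w i) - n * HX| with hb1
  set b2 : (Fin n → W) → (Fin n → Y) → Prop := fun w y =>
    condProbSeq p rvW rvY y w < Real.exp (-(n * (HY + a - 3 * e))) with hb2
  set NT : ℕ := ⌈K * (rA * rB)⌉₊ with hNT
  -- If `Â` has no output symbols, possibly because `H(X|Z,W)` is below its slack, there might not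
  -- be enough likely inputs for `K'` of them. Then there is a single bin, and one input already
  -- meets it.
  set NS : ℕ := if lA' n = 0 then 1 else ⌈K' * rX⌉₊ with hNS
  have hK0 : 0 ≤ K := by linarith
  have hK'0 : 0 ≤ K' := by linarith
  -- the words
  have exT : ∀ z, ∃ T : Finset (Fin n → W), ¬ bz z → T.card = NT ∧
      IsBest rankW (condProbSeq p rvW rvZ z) T ∧
      ∀ w ∈ T, Real.exp (-(n * (HZ + 2 * e))) ≤ condProbSeq p rvW rvZ z w := by
    intro z
    by_cases hz : bz z
    · exact ⟨∅, fun h => absurd hz h⟩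
    have hz' := hz
    simp only [hbz, not_or, not_exists, not_le] at hz'
    obtain ⟨hz1, hz2⟩ := hz'
    obtain ⟨G, hG1, hG2⟩ := typW z fun i => condProb_mem_stdSimplex hp.1 rvW rvZ
      (by rw [hpdef, law_joint_rvZ hμXW hμY]; exact hz1 i)
    have hab := abs_lt.1 hz2
    have hsum : ∑ i, natEntropy (fun w => condProb p rvW rvZ w (z i)) =
        ∑ i, entW μZ μXW μY (z i) := rfl
    rw [hsum] at hG1 hG2
    have hG3 : ∀ w ∈ G, Real.exp (-(n * (HZ + 2 * e))) ≤ condProbSeq p rvW rvZ z w := by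
      intro w hw
      refine le_trans ?_ (hG1 w hw)
      rw [Real.exp_le_exp]; linarith
    have hcard : NT ≤ G.card := by
      have h1 : (NT : ℝ) ≤ (K + 1) * (rA * rB) := ceil_mul_le hK0 hr1
      have h2 : (K + 1) * (rA * rB) ≤ (K + 1) * Real.exp (n * (HZ - Δ + e)) :=
        mul_le_mul_of_nonneg_left s3 (by positivity)
      have h3 : Real.exp (n * (HZ - Δ + e)) ≤ Real.exp (-(n * e)) *
          Real.exp (∑ i, entW μZ μXW μY (z i) - n * e) := by
        rw [← Real.exp_add, Real.exp_le_exp]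
        have := mul_le_mul_of_nonneg_left hΔ hn0
        linarith
      have h4 : (K + 1) * Real.exp (-(n * e)) ≤ 1 / 2 := by
        rw [lt_div_iff₀ (by positivity)] at heK
        linarith
      have h5 : (NT : ℝ) ≤ G.card := by
        calc (NT : ℝ) ≤ (K + 1) * (Real.exp (-(n * e)) *
              Real.exp (∑ i, entW μZ μXW μY (z i) - n * e)) :=
              h1.trans (h2.trans (mul_le_mul_of_nonneg_left h3 (by positivity)))
          _ = ((K + 1) * Real.exp (-(n * e))) *
              Real.exp (∑ i, entW μZ μXW μY (z i) - n * e) := by ring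
          _ ≤ 1 / 2 * Real.exp (∑ i, entW μZ μXW μY (z i) - n * e) :=
              mul_le_mul_of_nonneg_right h4 (Real.exp_pos _).le
          _ ≤ G.card := by linarith
      exact_mod_cast h5
    obtain ⟨T, hT1, hT2, hT3⟩ := exists_isBest_of_large hrW hG3 hcard
    exact ⟨T, fun _ => ⟨hT1, hT2, hT3⟩⟩
  choose T hT using exT
  have exS : ∀ z w, ∃ S : Finset (Fin n → X), w ∈ T z → ¬ bz z → ¬ b1 z w → S.card = NS ∧
      IsBest rankX (condProbSeq p rvX rvZW (fun i => (z i, w i))) S ∧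
      ∀ x ∈ S, Real.exp (-(n * (HX + θ + e))) ≤
        condProbSeq p rvX rvZW (fun i => (z i, w i)) x := by
    intro z w
    by_cases hzw : w ∈ T z ∧ ¬ bz z ∧ ¬ b1 z w
    swap
    · exact ⟨∅, fun h1 h2 h3 => absurd ⟨h1, h2, h3⟩ hzw⟩
    obtain ⟨hw, hz, hb⟩ := hzw
    have hz' := hz
    simp only [hbz, not_or, not_exists, not_le] at hz'
    have hb' := hb
    simp only [hb1, not_le] at hb'
    have hab := abs_lt.1 hb'
    have hcpos : 0 < condProbSeq p rvW rvZ z w := (Real.exp_pos _).trans_le ((hT z hz).2.2 w hw)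
    obtain ⟨G, hG1, hG2⟩ := typX (fun i => (z i, w i)) fun i =>
      condProb_mem_stdSimplex hp.1 rvX rvZW (by
        rw [hpdef, law_rvZW_eq hμZ hμXW hμY]
        exact mul_ne_zero (hz'.1 i)
          (Finset.prod_ne_zero_iff.1 hcpos.ne' i (Finset.mem_univ i)))
    have hsum : ∑ i, natEntropy (fun x => condProb p rvX rvZW x (z i, w i)) =
        ∑ i, entX μZ μXW μY (z i, w i) := rfl
    rw [hsum] at hG1 hG2
    have hG3 : ∀ x ∈ G, Real.exp (-(n * (HX + θ + e))) ≤
        condProbSeq p rvX rvZW (fun i => (z i, w i)) x := by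
      intro x hx
      refine le_trans ?_ (hG1 x hx)
      rw [Real.exp_le_exp]; linarith
    have hcard : NS ≤ G.card := by
      rw [hNS]
      split_ifs with h0
      · have : (0 : ℝ) < G.card := lt_of_lt_of_le (by positivity) hG2
        exact_mod_cast this
      have h1 : (⌈K' * rX⌉₊ : ℝ) ≤ (K' + 1) * rX := ceil_mul_le hK'0 hrX1
      have h2 : (K' + 1) * rX ≤ (K' + 1) * Real.exp (n * (HX - a' + e)) :=
        mul_le_mul_of_nonneg_left (s5.resolve_left h0) (by positivity)
      have h3 : Real.exp (n * (HX - a' + e)) ≤ Real.exp (-(n * e)) *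
          Real.exp (∑ i, entX μZ μXW μY (z i, w i) - n * e) := by
        rw [← Real.exp_add, Real.exp_le_exp]
        have := mul_le_mul_of_nonneg_left ha' hn0
        have h9 : 0 ≤ (n : ℝ) * e := by positivity
        linarith
      have h4 : (K' + 1) * Real.exp (-(n * e)) ≤ 1 / 2 := by
        rw [lt_div_iff₀ (by positivity)] at heK'
        linarith
      have h5 : (⌈K' * rX⌉₊ : ℝ) ≤ G.card := by
        calc (⌈K' * rX⌉₊ : ℝ) ≤ (K' + 1) * (Real.exp (-(n * e)) *
              Real.exp (∑ i, entX μZ μXW μY (z i, w i) - n * e)) :=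
              h1.trans (h2.trans (mul_le_mul_of_nonneg_left h3 (by positivity)))
          _ = ((K' + 1) * Real.exp (-(n * e))) *
              Real.exp (∑ i, entX μZ μXW μY (z i, w i) - n * e) := by ring
          _ ≤ 1 / 2 * Real.exp (∑ i, entX μZ μXW μY (z i, w i) - n * e) :=
              mul_le_mul_of_nonneg_right h4 (Real.exp_pos _).le
          _ ≤ G.card := by linarith
      exact_mod_cast h5
    obtain ⟨S, hS1, hS2, hS3⟩ := exists_isBest_of_large hrX hG3 hcard
    exact ⟨S, fun _ _ _ => ⟨hS1, hS2, hS3⟩⟩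
  choose S hS using exS
  set PZ : (Fin n → Z) → ℝ := fun z => ∏ i, μZ (z i) with hPZ
  set PY : (Fin n → X) → (Fin n → Z) → (Fin n → Y) → ℝ :=
    fun x z y => ∏ i, μY (x i) (z i) (y i) with hPY
  have hPZ0 : ∀ z, 0 ≤ PZ z := fun z => Finset.prod_nonneg fun i _ => hμZ.1 _
  have hPZ1 : ∑ z, PZ z = 1 := by
    rw [hPZ, sum_prod_eq_prod_sum (fun _ => μZ)]
    exact Finset.prod_eq_one fun _ _ => hμZ.2
  have hPY0 : ∀ x z y, 0 ≤ PY x z y := fun x z y =>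
    Finset.prod_nonneg fun i _ => (hμY _ _).1 _
  have hPY1 : ∀ x z, ∑ y, PY x z y = 1 := by
    intro x z
    rw [hPY, sum_prod_eq_prod_sum (fun i => μY (x i) (z i))]
    exact Finset.prod_eq_one fun _ _ => (hμY _ _).2
  -- change of measure
  have cmW : ∀ z, ¬ bz z → ∀ w ∈ T z, 1 / (rA * rB) ≤
      Real.exp (n * (Δ + 3 * e)) * condProbSeq p rvW rvZ z w := by
    intro z hz w hw
    have h1 : 1 / (rA * rB) ≤ Real.exp (-(n * (HZ - Δ - e))) := by
      rw [Real.exp_neg, one_div]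
      exact inv_anti₀ (Real.exp_pos _) s2
    refine h1.trans (le_trans (le_of_eq ?_) (mul_le_mul_of_nonneg_left ((hT z hz).2.2 w hw)
      (Real.exp_pos _).le))
    rw [← Real.exp_add]; congr 1; ring
  have cmX : ∀ z w, w ∈ T z → ¬ bz z → ¬ b1 z w → ∀ x ∈ S z w, 1 / rX ≤
      Real.exp (n * (a' + θ + 2 * e)) * condProbSeq p rvX rvZW (fun i => (z i, w i)) x := by
    intro z w hw hz hb x hx
    have h1 : 1 / rX ≤ Real.exp (-(n * (HX - a' - e))) := by
      rw [Real.exp_neg, one_div]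
      exact inv_anti₀ (Real.exp_pos _) s4
    refine h1.trans (le_trans (le_of_eq ?_) (mul_le_mul_of_nonneg_left ((hS z w hw hz hb).2.2 x hx)
      (Real.exp_pos _).le))
    rw [← Real.exp_add]; congr 1; ring
  -- the hypotheses of the one-shot bound
  have h0 : ∑ z, PZ z * ind (bz z) ≤ σ := by
    refine le_trans (Finset.sum_le_sum fun z _ => ?_) tz.le
    by_cases hz : ∃ i, μZ (z i) = 0
    · obtain ⟨i, hi⟩ := hz
      have : PZ z = 0 := Finset.prod_eq_zero (Finset.mem_univ i) hi
      have h' : ∏ i, μZ (z i) = 0 := this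
      rw [this, h', zero_mul, zero_mul]
    · refine mul_le_mul_of_nonneg_left (ind_mono fun h => ?_) (hPZ0 z)
      rw [← hHZ]
      exact h.resolve_left hz
  have h1 : ∀ z, ¬ bz z → jointMissProb (𝒜 n) (ℬ n) (T z) ≤ σ := by
    intro z hz
    rw [jointMissProb_eq, ← hKσ]
    refine missT (T z) ?_
    rw [(hT z hz).1, Set.ncard_prod]
    push_cast
    exact Nat.le_ceil _
  have h2 : ∀ z, ∀ w ∈ T z, ¬ bz z → ¬ b1 z w → missProb (𝒜' n) (S z w) ≤ 3 / K' := by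
    intro z w hw hz hb
    have hc := (hS z w hw hz hb).1
    by_cases hl : lA' n = 0
    · have : Subsingleton (Fin (lA' n) → X) := by rw [hl]; infer_instance
      rw [missProb_eq_zero_of_subsingleton]
      · positivity
      · rw [← Finset.card_pos, hc, hNS, if_pos hl]; exact one_pos
    · rw [missProb_eq]
      refine missS (S z w) ?_
      rw [hc, hNS, if_neg hl]
      exact Nat.le_ceil _
  have h3 : ∑ z, PZ z * (ind (¬ bz z) * ((∑ w ∈ T z, ind (b1 z w)) / (rA * rB))) ≤ σ := by
    refine (sum_state_word_le hμZ hμXW hμY (fun z => ¬ bz z) (Real.exp_pos _).le cmW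
      (fun z w => ind (b1 z w)) fun z w => ind_nonneg _).trans ?_
    have h4 := sum_state_word_eq hμZ hμXW hμY
      (fun v : Fin n → Z × W => ind (n * θ ≤ |∑ i, entX μZ μXW μY (v i) - n * HX|))
    have h5 := tail₁ n
    rw [← h4] at h5
    refine (mul_le_mul_of_nonneg_left h5 (Real.exp_pos _).le).trans ?_
    have h6 : Real.exp (n * (Δ + 3 * e)) * Real.exp (-(n * ρ₁)) ≤ Real.exp (-(n * e)) := by
      rw [← Real.exp_add, Real.exp_le_exp]
      have := mul_le_mul_of_nonneg_left hρ₁ hn0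
      linarith
    linarith
  have h4 : ∑ z, PZ z * (ind (¬ bz z) * ((∑ w ∈ T z, ind (¬ b1 z w) * ((∑ x ∈ S z w, ∑ y,
      PY x z y * ind (b2 w y)) / rX)) / (rA * rB))) ≤ σ := by
    set C := Real.exp (n * (a' + θ + 2 * e)) with hC
    set ψ : (Fin n → Z) → (Fin n → W) → ℝ := fun z w => C * ∑ x,
      condProbSeq p rvX rvZW (fun i => (z i, w i)) x * ∑ y, PY x z y * ind (b2 w y) with hψ
    have hy0 : ∀ x z w, 0 ≤ ∑ y, PY x z y * ind (b2 w y) := fun x z w =>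
      Finset.sum_nonneg fun y _ => mul_nonneg (hPY0 x z y) (ind_nonneg _)
    have hψ0 : ∀ z w, 0 ≤ ψ z w := fun z w => mul_nonneg (Real.exp_pos _).le
      (Finset.sum_nonneg fun x _ => mul_nonneg (condProbSeq_nonneg hp.1 _ _ _ _) (hy0 x z w))
    have step : ∑ z, PZ z * (ind (¬ bz z) * ((∑ w ∈ T z, ind (¬ b1 z w) * ((∑ x ∈ S z w, ∑ y,
        PY x z y * ind (b2 w y)) / rX)) / (rA * rB))) ≤
        ∑ z, PZ z * (ind (¬ bz z) * ((∑ w ∈ T z, ψ z w) / (rA * rB))) := by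
      refine Finset.sum_le_sum fun z _ => mul_le_mul_of_nonneg_left ?_ (hPZ0 z)
      by_cases hz : bz z
      · rw [ind_false (not_not.2 hz), zero_mul, zero_mul]
      rw [ind_true hz, one_mul, one_mul]
      refine div_le_div_of_nonneg_right (Finset.sum_le_sum fun w hw => ?_) (by positivity)
      by_cases hb : b1 z w
      · rw [ind_false (not_not.2 hb), zero_mul]; exact hψ0 z w
      rw [ind_true hb, one_mul]
      exact sum_input_le hμZ hμXW hμY z w (Real.exp_pos _).le (cmX z w hw hz hb)
        (fun x => ∑ y, PY x z y * ind (b2 w y)) fun x => hy0 x z w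
    -- Both changes of measure are composed; their exponents `Δ + 3 e` and `a' + θ + 2 e` must stay
    -- below `ρ₂`, with `e` to spare.
    refine step.trans ((sum_state_word_le hμZ hμXW hμY (fun z => ¬ bz z) (Real.exp_pos _).le cmW
      ψ hψ0).trans ?_)
    have h5 := sum_seq_joint (n := n) hμZ hμXW hμY (fun w y => ind (b2 w y))
    have h6 : ∑ z : Fin n → Z, (∏ i, μZ (z i)) * ∑ w,
        condProbSeq (joint μZ μXW μY) rvW rvZ z w * ψ z w =
        C * ∑ ω : Fin n → X × Y × Z × W, (∏ i, p (ω i)) *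
          ind (b2 (fun i => rvW (ω i)) (fun i => rvY (ω i))) := by
      rw [← h5, Finset.mul_sum]
      refine Finset.sum_congr rfl fun z _ => ?_
      rw [mul_left_comm C]
      congr 1
      rw [Finset.mul_sum]
      refine Finset.sum_congr rfl fun w _ => ?_
      rw [hψ]
      ring
    rw [h6]
    have h7 := tail₂ n
    have h8 : Real.exp (n * (Δ + 3 * e)) * (C * Real.exp (-(n * ρ₂))) ≤ Real.exp (-(n * e)) := by
      rw [hC, ← Real.exp_add, ← Real.exp_add, Real.exp_le_exp]
      have := mul_le_mul_of_nonneg_left hρ₂ hn0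
      linarith
    refine le_trans (mul_le_mul_of_nonneg_left (mul_le_mul_of_nonneg_left h7 (Real.exp_pos _).le)
      (Real.exp_pos _).le) (h8.trans ?_)
    linarith
  have h5 : ∀ w y, ¬ b2 w y → (𝒜 n).expect
      (fun f => ind (Confusable (condProbSeq p rvW rvY) f w y)) ≤ σ₅ := by
    classical
    intro w y hb
    simp only [hb2, not_lt] at hb
    -- Outside `b2` the set `G` has at most `exp (n (HY + a - 3 e))` members, against at least `exp
    -- (n (HY + a - e))` bins.
    set G : Finset (Fin n → W) := Finset.univ.filter
      (fun w' => condProbSeq p rvW rvY y w ≤ condProbSeq p rvW rvY y w') with hG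
    refine (coll G w (fun w' => condProbSeq p rvW rvY y w ≤ condProbSeq p rvW rvY y w')
      fun w' hw' => Finset.mem_filter.2 ⟨Finset.mem_univ _, hw'⟩).trans ?_
    have hc := card_le_of_le_condProbSeq hp.1 rvW rvY y G
      (fun u hu => hb.trans (Finset.mem_filter.1 hu).2)
    have h6 : (G.card : ℝ) / rA ≤ Real.exp (-(n * e)) := by
      rw [div_le_iff₀ hrA0]
      refine hc.trans (le_trans ?_ (mul_le_mul_of_nonneg_left s1 (Real.exp_pos _).le))
      rw [← Real.exp_add, Real.exp_le_exp]
      have h9 : 0 ≤ (n : ℝ) * e := by positivity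
      linarith
    linarith
  have hNTle : ∀ z, ¬ bz z → ((T z).card : ℝ) ≤ (K + 1) * (rA * rB) := by
    intro z hz
    rw [(hT z hz).1]
    exact ceil_mul_le hK0 hr1
  have hNSle : ∀ z, ∀ w ∈ T z, ¬ bz z → ¬ b1 z w → ((S z w).card : ℝ) ≤ (K' + 1) * rX := by
    intro z w hw hz hb
    rw [(hS z w hw hz hb).1, hNS]
    split_ifs
    · push_cast; nlinarith
    · exact ceil_mul_le hK'0 hrX1
  have hfin : σ + σ + σ + (K + 1) * (3 / K' + (K' + 1) * σ₅) + σ < min δ 1 := by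
    have h6 : (K + 1) * (3 / K' + (K' + 1) * σ₅) = σ + σ := by
      rw [mul_add, hK'σ, hσ₅]
      congr 1
      field_simp
    rw [h6]
    have : min δ 1 = 12 * σ := by rw [hσ]; ring
    linarith
  obtain ⟨A, hA, c, B, hB, A', hA', c', hcost⟩ := exists_code_of_bounds PY
    (condProbSeq p rvW rvY) T S bz b1 b2 PZ hPZ0 hPZ1 hPY0 hPY1 (𝒜 n) (ℬ n) (𝒜' n)
    h0 h1 h2 h3 h4 h5 hσ0.le (by positivity) hσ₅0.le (by positivity) (by positivity)
    hNTle hNSle hfin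
  obtain ⟨hc, hc', herr⟩ := error_lt_of_cost_lt PY (condProbSeq p rvW rvY) T S bz b1 b2 PZ hPZ0
    hPZ1 hPY0 hPY1 (ℬ n) (condProbSeq p rvW rvZ)
    (fun z w => condProbSeq p rvX rvZW (fun i => (z i, w i))) rankW rankX
    (fun z hz => (hT z hz).2.1) (fun z w hw hz hb => (hS z w hw hz hb).2.1)
    (min_le_right δ 1) hcost
  refine ⟨A, hA, B, hB, A', hA', c, hc, c', hc', hρ, fun gAB gA' gA hg1 hg2 hg3 => ?_⟩
  rw [errorProb_eq]
  exact lt_of_lt_of_le (herr gAB gA' gA hg1 hg2 hg3) (min_le_left δ 1)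

end Coding

open Filter

/-! ### Numbers of bins -/

theorem log_two_bounds : (0.69 : ℝ) < Real.log 2 ∧ Real.log 2 < 0.694 :=
  ⟨by linarith [Real.log_two_gt_d9], by linarith [Real.log_two_lt_d9]⟩

theorem HashPropertyOn.eventually_log {Ω V : ℕ → Type*} [∀ n, Fintype (Ω n)] [∀ n, Fintype (V n)]
    {E : ∀ n, Ensemble (Ω n) (V n)} {R : ∀ n, Set (V n)} (h : HashPropertyOn E R)
    (hr : ∀ n, 0 < (R n).ncard) {ε : ℝ} (hε : 0 < ε) :
    ∀ᶠ n : ℕ in atTop,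
      Real.log (Fintype.card (V n)) - n * ε ≤ Real.log (R n).ncard := by
  have hl2 : (0 : ℝ) < Real.log 2 := Real.log_pos (by norm_num)
  filter_upwards [h.1.eventually (gt_mem_nhds (show (0 : ℝ) < ε / Real.log 2 by positivity)),
    eventually_gt_atTop 0] with n h1 h2
  have hn : (0 : ℝ) < n := by exact_mod_cast h2
  have hR : (0 : ℝ) < (R n).ncard := by exact_mod_cast hr n
  have hne : Nonempty (V n) := by
    obtain ⟨v, _⟩ := Set.nonempty_of_ncard_ne_zero (hr n).ne'
    exact ⟨v⟩
  have hV : (0 : ℝ) < Fintype.card (V n) := by exact_mod_cast Fintype.card_pos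
  rw [Real.logb, Real.log_div hV.ne' hR.ne', div_lt_iff₀ hn, div_lt_iff₀ hl2] at h1
  have : ε / Real.log 2 * n * Real.log 2 = n * ε := by field_simp
  linarith

theorem log_ncard_le {V : Type*} [Fintype V] {R : Set V} (hr : 0 < R.ncard) :
    Real.log R.ncard ≤ Real.log (Fintype.card V) := by
  refine Real.log_le_log (by exact_mod_cast hr) ?_
  rw [← Nat.card_eq_fintype_card, ← Set.ncard_univ]
  exact_mod_cast Set.ncard_le_ncard (Set.subset_univ R)

theorem IsRounding.sub_one_le {l : ℕ} {x : ℝ} (h : IsRounding l x) : x - 1 ≤ l := by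
  rcases h with rfl | rfl
  · linarith [Nat.lt_floor_add_one x]
  · linarith [Nat.le_ceil x]

theorem IsRounding.le_add_one {l : ℕ} {x : ℝ} (h : IsRounding l x) (hx : 0 ≤ x) :
    (l : ℝ) ≤ x + 1 := by
  rcases h with rfl | rfl
  · linarith [Nat.floor_le hx]
  · linarith [Nat.ceil_lt_add_one hx]

theorem IsRounding.eq_zero {l : ℕ} {x : ℝ} (h : IsRounding l x) (hx : x ≤ 0) : l = 0 := by
  rcases h with rfl | rfl
  · exact Nat.floor_of_nonpos hx
  · exact Nat.ceil_eq_zero.2 hx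

section Lengths

variable {l n k : ℕ} {h : ℝ}

theorem IsRounding.le_mul_log (hl : IsRounding l (n * h / Real.logb 2 k)) (hk : 1 < k) :
    n * (h * Real.log 2) - Real.log k ≤ l * Real.log k := by
  have hlk : 0 < Real.log k := Real.log_pos (by exact_mod_cast hk)
  have hl2 : (0 : ℝ) < Real.log 2 := Real.log_pos (by norm_num)
  have h1 := mul_le_mul_of_nonneg_right hl.sub_one_le hlk.le
  have h2 : n * h / Real.logb 2 k * Real.log k = n * (h * Real.log 2) := by
    unfold Real.logb; field_simp
  rw [sub_mul, h2, one_mul] at h1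
  exact h1

theorem IsRounding.mul_log_le (hl : IsRounding l (n * h / Real.logb 2 k)) (hk : 1 < k)
    (hh : 0 ≤ h) : l * Real.log k ≤ n * (h * Real.log 2) + Real.log k := by
  have hlk : 0 < Real.log k := Real.log_pos (by exact_mod_cast hk)
  have hl2 : (0 : ℝ) < Real.log 2 := Real.log_pos (by norm_num)
  have h0 : 0 ≤ n * h / Real.logb 2 k := by unfold Real.logb; positivity
  have h1 := mul_le_mul_of_nonneg_right (hl.le_add_one h0) hlk.le
  have h2 : n * h / Real.logb 2 k * Real.log k = n * (h * Real.log 2) := by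
    unfold Real.logb; field_simp
  rw [add_mul, h2, one_mul] at h1
  exact h1

theorem IsRounding.eq_zero_of_nonpos (hl : IsRounding l (n * h / Real.logb 2 k)) (hh : h ≤ 0) :
    l = 0 := by
  refine hl.eq_zero (div_nonpos_of_nonpos_of_nonneg
    (mul_nonpos_of_nonneg_of_nonpos (Nat.cast_nonneg n) hh) ?_)
  rcases Nat.eq_zero_or_pos k with rfl | hk
  · simp
  · exact Real.logb_nonneg (by norm_num) (by exact_mod_cast hk)

end Lengths

theorem log_card_fun (l : ℕ) (U : Type*) [Fintype U] :
    Real.log (Fintype.card (Fin l → U)) = l * Real.log (Fintype.card U) := by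
  rw [Fintype.card_fun, Fintype.card_fin]
  push_cast
  rw [Real.log_pow]

theorem eventually_le_mul (a : ℝ) {ε : ℝ} (hε : 0 < ε) : ∀ᶠ n : ℕ in atTop, a ≤ n * ε :=
  (tendsto_natCast_atTop_atTop.atTop_mul_const hε).eventually_ge_atTop a

/-! ### The conditions on the parameters -/

/-- In nats and with `s = √(12 ε)`, the penalty contains `2 s L` for `L = log (k / s)`, which is the
margin required in `sum_prod_ind_condProb_lt_le`. -/
theorem zeta_mul_log {k : ℕ} (hk : 0 < k) {ε : ℝ} (hε : 0 < ε) :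
    2 * zeta k (6 * ε) * Real.log 2 = 12 * ε * Real.log 2 +
      2 * Real.sqrt (12 * ε) * Real.log (k / Real.sqrt (12 * ε)) := by
  have hl2 : Real.log 2 ≠ 0 := (Real.log_pos (by norm_num)).ne'
  have hs : 0 < Real.sqrt (12 * ε) := Real.sqrt_pos.2 (by positivity)
  have hk' : (0 : ℝ) < k := by exact_mod_cast hk
  unfold zeta Real.logb
  rw [show 2 * (6 * ε) = 12 * ε by ring, Real.log_div hs.ne' hk'.ne', Real.log_div hk'.ne' hs.ne']
  field_simp
  ring

/-- The condition reads `s² log 2 + 2 s (log k - log s) < log k`. For `1/2 < s ≤ 1` the term `2 s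
log k` is already too large; for `s ≥ 1` the tangent of the logarithm at `4` shows that `2 log s`
exceeds `s log 2` by at most `0.6`, less than `log k`. -/
theorem sqrt_le_half_of_zeta_lt {k : ℕ} (hk : 2 ≤ k) {ε : ℝ} (hε : 0 < ε)
    (h : 2 * zeta k (6 * ε) < Real.logb 2 k) : Real.sqrt (12 * ε) ≤ 1 / 2 := by
  obtain ⟨hl1, hl2⟩ := log_two_bounds
  have h1 := mul_lt_mul_of_pos_right h (show 0 < Real.log 2 by linarith)
  rw [zeta_mul_log (by omega) hε, Real.logb, div_mul_cancel₀ _ (by linarith : Real.log 2 ≠ 0)] at h1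
  set s := Real.sqrt (12 * ε) with hs
  have hs0 : 0 < s := Real.sqrt_pos.2 (by positivity)
  have hs2 : s ^ 2 = 12 * ε := Real.sq_sqrt (by positivity)
  have hk' : (0 : ℝ) < k := by positivity
  rw [← hs2, Real.log_div hk'.ne' hs0.ne'] at h1
  have hlk : Real.log 2 ≤ Real.log k := Real.log_le_log (by norm_num) (by exact_mod_cast hk)
  by_contra hc
  rw [not_le] at hc
  rcases le_total s 1 with h2 | h2
  · have h3 : Real.log s ≤ 0 := Real.log_nonpos hs0.le h2
    nlinarith [mul_pos hs0 hs0]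
  · have h3 : Real.log s ≤ s / 4 - 1 + 2 * Real.log 2 := by
      have h4 := Real.log_le_sub_one_of_pos (show 0 < s / 4 by positivity)
      rw [Real.log_div hs0.ne' (by norm_num), show (4 : ℝ) = 2 ^ 2 by norm_num, Real.log_pow] at h4
      push_cast at h4
      linarith
    have h5 : s * (s * Real.log 2 + 2 * (Real.log k - Real.log s)) < Real.log k := by
      linarith
    have h6 : 2 * Real.log k - 0.6 ≤ s * Real.log 2 + 2 * (Real.log k - Real.log s) := by
      nlinarith
    nlinarith

theorem exists_admissible {x y w : ℕ} (hx : 1 < x) (hyw : 0 < y * w) {ε₀ : ℝ} (hε₀ : 0 < ε₀) :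
    ∃ εA εB εA' : ℝ, Admissible x y w εA εB εA' ∧ εB < ε₀ := by
  have hl2 : (0 : ℝ) < Real.log 2 := Real.log_pos (by norm_num)
  have hk : (0 : ℝ) < ((y * w : ℕ) : ℝ) := by exact_mod_cast hyw
  set φ : ℝ → ℝ := fun ε => 12 * ε * Real.log 2 +
      2 * (Real.sqrt (12 * ε) * Real.log (y * w : ℕ)
        - Real.sqrt (12 * ε) * Real.log (Real.sqrt (12 * ε))) with hφ
  have hcont : Continuous φ := by
    have h1 : Continuous fun ε : ℝ => Real.sqrt (12 * ε) := by fun_prop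
    have h2 := Real.continuous_mul_log.comp h1
    simp only [Function.comp_def] at h2
    fun_prop
  have hφ0 : φ 0 = 0 := by simp [hφ]
  have h1 : ∀ᶠ ε in nhdsWithin (0 : ℝ) (Set.Ioi 0), φ ε < ε₀ / 4 * Real.log 2 := by
    have := hcont.tendsto 0
    rw [hφ0] at this
    exact (this.mono_left nhdsWithin_le_nhds).eventually (gt_mem_nhds (by positivity))
  obtain ⟨ε, hε1, hε⟩ := (h1.and self_mem_nhdsWithin).exists
  have hε : 0 < ε := hε
  have hs : 0 < Real.sqrt (12 * ε) := Real.sqrt_pos.2 (by positivity)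
  have hz : 2 * zeta (y * w) (6 * ε) < ε₀ / 4 := by
    have h2 := zeta_mul_log hyw hε
    rw [Real.log_div hk.ne' hs.ne'] at h2
    have h3 : 2 * zeta (y * w) (6 * ε) * Real.log 2 = φ ε := by rw [h2, hφ]; ring
    rw [← h3] at hε1
    exact lt_of_mul_lt_mul_right hε1 hl2.le
  have hlx : 1 ≤ Real.logb 2 x := by
    rw [Real.le_logb_iff_rpow_le (by norm_num) (by positivity), Real.rpow_one]
    exact_mod_cast hx
  have hlx0 : 0 < Real.logb 2 x := by linarith
  -- Here `d = εB - εA` is chosen last: `d ≤ 1` gives `d ≤ √(6 d)`, and the last term makes `√(6 d)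
  -- log₂ x` at most `ε / 2`.
  set d : ℝ := min (min 1 (ε₀ / 4)) ((ε / (2 * Real.logb 2 x)) ^ 2 / 6) with hd
  have hd0 : 0 < d := by positivity
  have hd1 : d ≤ 1 := (min_le_left _ _).trans (min_le_left _ _)
  have hd2 : d ≤ ε₀ / 4 := (min_le_left _ _).trans (min_le_right _ _)
  have hd3 : 6 * d ≤ (ε / (2 * Real.logb 2 x)) ^ 2 := by
    have : d ≤ (ε / (2 * Real.logb 2 x)) ^ 2 / 6 := min_le_right _ _
    linarith
  refine ⟨ε₀ / 4, ε₀ / 4 + d, ε, ⟨by positivity, by positivity, hε, by linarith, ?_, ?_, hz⟩,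
    by linarith⟩
  · rw [add_sub_cancel_left]
    have h2 : d ≤ Real.sqrt (6 * d) := Real.le_sqrt_of_sq_le (by nlinarith)
    nlinarith [Real.sqrt_nonneg (6 * d)]
  · rw [add_sub_cancel_left]
    have h2 : Real.sqrt (6 * d) ≤ ε / (2 * Real.logb 2 x) :=
      Real.sqrt_le_iff.2 ⟨by positivity, hd3⟩
    calc Real.sqrt (6 * d) * Real.logb 2 x ≤ ε / (2 * Real.logb 2 x) * Real.logb 2 x :=
          mul_le_mul_of_nonneg_right h2 hlx0.le
      _ = ε / 2 := by field_simp
      _ < ε := by linarith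

/-! ### The actual exponents and the degenerate cases -/

section Final

variable {X Y Z W : Type*} [Fintype X] [Fintype Y] [Fintype Z] [Fintype W]
  {μZ : Z → ℝ} {μXW : Z → X × W → ℝ} {μY : X → Z → Y → ℝ}

theorem ExistsCode.mono {n lA lB lA' : ℕ}
    {𝒜 : Ensemble (Fin n → W) (Fin lA → W)} {ℬ : Ensemble (Fin n → W) (Fin lB → W)}
    {𝒜' : Ensemble (Fin n → X) (Fin lA' → X)}
    {rankW : (Fin n → W) → ℕ} {rankX : (Fin n → X) → ℕ} {ρ ρ' δ δ' : ℝ}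
    (h : ExistsCode μZ μXW μY 𝒜 ℬ 𝒜' rankW rankX ρ δ) (hρ : ρ' ≤ ρ) (hδ : δ ≤ δ') :
    ExistsCode μZ μXW μY 𝒜 ℬ 𝒜' rankW rankX ρ' δ' := by
  obtain ⟨A, hA, B, hB, A', hA', c, hc, c', hc', hr, h⟩ := h
  exact ⟨A, hA, B, hB, A', hA', c, hc, c', hc', hρ.trans hr,
    fun gAB gA' gA h1 h2 h3 => (h gAB gA' gA h1 h2 h3).trans_le hδ⟩

/-- With no output symbols of `B` there is only one message, and the decoder cannot err. -/
theorem existsCode_of_subsingleton [Nonempty X] [Nonempty W] {n lA lB lA' : ℕ}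
    (hl : lB = 0) (𝒜 : Ensemble (Fin n → W) (Fin lA → W))
    (ℬ : Ensemble (Fin n → W) (Fin lB → W)) (𝒜' : Ensemble (Fin n → X) (Fin lA' → X))
    (rankW : (Fin n → W) → ℕ) (rankX : (Fin n → X) → ℕ) {ρ δ : ℝ} (hρ : ρ ≤ 0) (hδ : 0 < δ) :
    ExistsCode μZ μXW μY 𝒜 ℬ 𝒜' rankW rankX ρ δ := by
  obtain ⟨A, hA⟩ := 𝒜.carrier_nonempty
  obtain ⟨B, hB⟩ := ℬ.carrier_nonempty
  obtain ⟨A', hA'⟩ := 𝒜'.carrier_nonempty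
  have hs : Subsingleton (Fin lB → W) := by rw [hl]; infer_instance
  refine ⟨A, hA, B, hB, A', hA', A (Classical.arbitrary _), ⟨_, rfl⟩,
    A' (Classical.arbitrary _), ⟨_, rfl⟩, ?_, fun gAB gA' gA _ _ _ => ?_⟩
  · refine hρ.trans (div_nonneg (Real.logb_nonneg (by norm_num) ?_) (Nat.cast_nonneg n))
    have := ℬ.ncard_image_pos
    exact_mod_cast this
  · rw [errorProb_eq]
    refine lt_of_le_of_lt (le_of_eq ?_) hδ
    refine Finset.sum_eq_zero fun m _ => ?_
    have h0 : ∀ y : Fin n → Y, ind (B (gA y) ≠ m) = 0 := fun y =>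
      ind_false (not_not.2 (Subsingleton.elim _ _))
    simp only [h0, mul_zero, Finset.sum_const_zero]

theorem gain_eq : gain μZ μXW μY = condEntropy (joint μZ μXW μY) rvW rvZ
    - condEntropy (joint μZ μXW μY) rvW rvY := by
  unfold gain mutualInfo
  ring

theorem entX_bounds {p : X × Y × Z × W → ℝ} (hp : p ∈ stdSimplex ℝ (X × Y × Z × W)) [Nonempty X]
    (v : Z × W) : 0 ≤ natEntropy (fun x => condProb p rvX rvZW x v) ∧
      natEntropy (fun x => condProb p rvX rvZW x v) ≤ Real.log (Fintype.card X) := by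
  by_cases hv : law p rvZW v = 0
  · have h0 : natEntropy (fun x => condProb p rvX rvZW x v) = 0 := by
      simp [natEntropy, condProb, hv]
    rw [h0]
    exact ⟨le_rfl, Real.log_natCast_nonneg _⟩
  · have := condProb_mem_stdSimplex hp.1 rvX rvZW hv
    exact ⟨natEntropy_nonneg this, natEntropy_le this⟩

/-- The conditional entropy along a random sequence concentrates. -/
theorem tail_entX_le [Nonempty X] (hμZ : μZ ∈ stdSimplex ℝ Z)
    (hμXW : ∀ z, μXW z ∈ stdSimplex ℝ (X × W)) (hμY : ∀ x z, μY x z ∈ stdSimplex ℝ Y)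
    (hX : 1 < Fintype.card X) {r : ℝ} (hr : 0 ≤ r) (hr2 : r ≤ 2) (n : ℕ) :
    ∑ v : Fin n → Z × W, (∏ i, law (joint μZ μXW μY) rvZW (v i)) *
      ind (n * (r * Real.log (Fintype.card X)) ≤ |∑ i, entX μZ μXW μY (v i) -
        n * (condEntropy (joint μZ μXW μY) rvX rvZW * Real.log 2)|) ≤
      2 * Real.exp (-(n * (r ^ 2 / 4))) := by
  set p := joint μZ μXW μY with hpdef
  have hp : p ∈ stdSimplex ℝ _ := joint_mem_stdSimplex hμZ hμXW hμY
  have hlaw := law_mem_stdSimplex hp rvZW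
  set M := Real.log (Fintype.card X) with hM
  have hM0 : 0 < M := Real.log_pos (by exact_mod_cast hX)
  set HX := condEntropy p rvX rvZW * Real.log 2 with hHX
  have hHXeq : HX = ∑ v, law p rvZW v * entX μZ μXW μY v := condEntropy_mul_log p rvX rvZW
  have hb : ∀ v, 0 ≤ entX μZ μXW μY v ∧ entX μZ μXW μY v ≤ M := fun v => entX_bounds hp v
  have hHX0 : 0 ≤ HX := by
    rw [hHXeq]
    exact Finset.sum_nonneg fun v _ => mul_nonneg (hlaw.1 v) (hb v).1
  have hHX1 : HX ≤ M := by
    rw [hHXeq]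
    calc _ ≤ ∑ v, law p rvZW v * M :=
          Finset.sum_le_sum fun v _ => mul_le_mul_of_nonneg_left (hb v).2 (hlaw.1 v)
      _ = M := by rw [← Finset.sum_mul, hlaw.2, one_mul]
  -- The centred entropy is bounded by `M`; `t = r / (2 M)` is optimal and makes the exponent `r² /
  -- 2 - r² / 4`.
  have h1 := tail_le (n := n) (K := fun _ => law p rvZW) (F := fun _ v => entX μZ μXW μY v - HX)
    (M := M) (t := r / (2 * M)) (ε := r * M) (fun _ => hlaw)
    (fun _ => by
      simp only [mul_sub, Finset.sum_sub_distrib, ← Finset.sum_mul, hlaw.2]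
      rw [← hHXeq]; ring)
    (fun _ v => abs_le.2 ⟨by linarith [(hb v).1], by linarith [(hb v).2]⟩) (by positivity)
    (by
      have : r / (2 * M) * M = r / 2 := by field_simp
      rw [this]; linarith)
  have h2 : r / (2 * M) * (r * M) - (r / (2 * M)) ^ 2 * M ^ 2 = r ^ 2 / 4 := by
    field_simp
    ring
  rw [h2] at h1
  simpa only [Finset.sum_sub_distrib, Finset.sum_const, Finset.card_univ, Fintype.card_fin,
    nsmul_eq_mul] using h1

set_option maxHeartbeats 1000000 in
theorem eventually_existsCode_of_admissible (hμZ : μZ ∈ stdSimplex ℝ Z)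
    (hμXW : ∀ z, μXW z ∈ stdSimplex ℝ (X × W)) (hμY : ∀ x z, μY x z ∈ stdSimplex ℝ Y)
    {εA εB εA' : ℝ}
    (hadm : Admissible (Fintype.card X) (Fintype.card Y) (Fintype.card W) εA εB εA')
    {lA lB lA' : ℕ → ℕ} (hlen : IsLengths μZ μXW μY εA εB εA' lA lB lA')
    {𝒜 : ∀ n, Ensemble (Fin n → W) (Fin (lA n) → W)}
    {ℬ : ∀ n, Ensemble (Fin n → W) (Fin (lB n) → W)}
    {𝒜' : ∀ n, Ensemble (Fin n → X) (Fin (lA' n) → X)}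
    (h𝒜 : HasHashProperty 𝒜) (h𝒜ℬ : HasJointHashProperty 𝒜 ℬ) (h𝒜' : HasHashProperty 𝒜')
    {δ : ℝ} (hδ : 0 < δ) :
    ∀ᶠ n : ℕ in atTop, ∀ (rankW : (Fin n → W) → ℕ) (rankX : (Fin n → X) → ℕ),
      Function.Injective rankW → Function.Injective rankX →
      ExistsCode μZ μXW μY (𝒜 n) (ℬ n) (𝒜' n) rankW rankX (gain μZ μXW μY - εB - δ) δ := by
  set p := joint μZ μXW μY with hpdef
  have hp : p ∈ stdSimplex ℝ _ := joint_mem_stdSimplex hμZ hμXW hμY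
  obtain ⟨hlo, hhi⟩ := log_two_bounds
  have hl2 : 0 < Real.log 2 := by linarith
  have hneZ : Nonempty Z := by
    by_contra h
    rw [not_nonempty_iff] at h
    simpa using hμZ.2
  have hneXW : Nonempty (X × W) := by
    by_contra h
    rw [not_nonempty_iff] at h
    simpa using (hμXW (Classical.arbitrary Z)).2
  have hneX : Nonempty X := hneXW.map Prod.fst
  have hneW : Nonempty W := hneXW.map Prod.snd
  have hneY : Nonempty Y := by
    by_contra h
    rw [not_nonempty_iff] at h
    simpa using (hμY (Classical.arbitrary X) (Classical.arbitrary Z)).2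
  -- If the gain does not exceed `εB`, then `lB n = 0` and the required rate is negative. Otherwise
  -- `εA < εB < H(W|Z) ≤ log |W|`, which bounds `ζ` and makes `s ≤ 1/2` available.
  rcases le_or_gt (gain μZ μXW μY) εB with hg | hg
  · refine Eventually.of_forall fun n rankW rankX _ _ => ?_
    exact existsCode_of_subsingleton ((hlen n).2.1.eq_zero_of_nonpos (by linarith)) _ _ _ _ _
      (by linarith) hδ
  obtain ⟨hA0, hB0, hA'0, hd0, hd1, hd2, hζ⟩ := hadm
  set d := εB - εA with hd
  set HZ := condEntropy p rvW rvZ with hHZ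
  set HY := condEntropy p rvW rvY with hHY
  set HX := condEntropy p rvX rvZW with hHX
  have hgain : gain μZ μXW μY = HZ - HY := gain_eq
  have hHY0 : 0 ≤ HY := condEntropy_nonneg hp _ _
  have hHX0 : 0 ≤ HX := condEntropy_nonneg hp _ _
  have hHZ1 : HZ ≤ Real.logb 2 (Fintype.card W) := condEntropy_le hp _ _
  have hW : 1 < Fintype.card W := by
    by_contra h
    have h1 : Fintype.card W = 1 := le_antisymm (not_lt.1 h) Fintype.card_pos
    rw [h1] at hHZ1
    simp at hHZ1
    linarith
  have hX : 1 < Fintype.card X := by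
    by_contra h
    have h1 : Fintype.card X = 1 := le_antisymm (not_lt.1 h) Fintype.card_pos
    rw [h1] at hd1
    simp at hd1
    linarith
  set k : ℕ := Fintype.card Y * Fintype.card W with hk
  have hWk : Fintype.card W ≤ k := Nat.le_mul_of_pos_left _ Fintype.card_pos
  have hk2 : 2 ≤ k := le_trans hW hWk
  have hk0 : (0 : ℝ) < k := by positivity
  set s := Real.sqrt (12 * εA') with hs
  have hs0 : 0 < s := Real.sqrt_pos.2 (by positivity)
  have hs2 : s ^ 2 = 12 * εA' := Real.sq_sqrt (by positivity)
  have hshalf : s ≤ 1 / 2 := by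
    refine sqrt_le_half_of_zeta_lt hk2 hA'0 ?_
    have : Real.logb 2 (Fintype.card W) ≤ Real.logb 2 k :=
      Real.logb_le_logb_of_le (by norm_num) (by exact_mod_cast Fintype.card_pos)
        (by exact_mod_cast hWk)
    linarith
  have hζ' := mul_lt_mul_of_pos_right hζ hl2
  rw [zeta_mul_log (by omega) hA'0] at hζ'
  set L := Real.log (k / s) with hL
  have hL1 : 1 ≤ L := by
    have h1 : (4 : ℝ) ≤ k / s := by
      rw [le_div_iff₀ hs0]
      have : (2 : ℝ) ≤ k := by exact_mod_cast hk2
      linarith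
    have h2 := Real.log_le_log (by norm_num) h1
    rw [show (4 : ℝ) = 2 ^ 2 by norm_num, Real.log_pow] at h2
    push_cast at h2
    linarith
  have hUL : Fintype.card W * Real.exp (-L) ≤ 1 / 2 := by
    rw [Real.exp_neg, hL, Real.exp_log (by positivity), inv_div]
    have h1 : (Fintype.card W : ℝ) ≤ k := by exact_mod_cast hWk
    calc (Fintype.card W : ℝ) * (s / k) ≤ k * (s / k) :=
          mul_le_mul_of_nonneg_right h1 (by positivity)
      _ = s := by field_simp
      _ ≤ 1 / 2 := hshalf
  have hA'small : εA' ≤ 1 / 48 := by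
    have := pow_le_pow_left₀ hs0.le hshalf 2
    linarith
  set r := Real.sqrt (6 * d) with hr
  have hr0 : 0 ≤ r := Real.sqrt_nonneg _
  have hr2 : r ^ 2 = 6 * d := Real.sq_sqrt (by positivity)
  set M := Real.log (Fintype.card X) with hM
  have hlogb : Real.logb 2 (Fintype.card X) * Real.log 2 = M := div_mul_cancel₀ _ hl2.ne'
  have hθd : d * Real.log 2 ≤ r * M := by
    rw [← hlogb, ← mul_assoc]; exact mul_le_mul_of_nonneg_right hd1 hl2.le
  have hθ : r * M < εA' * Real.log 2 := by
    rw [← hlogb, ← mul_assoc]; exact mul_lt_mul_of_pos_right hd2 hl2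
  have hd48 : d ≤ 1 / 48 := by linarith
  have hr1 : r ≤ 2 := Real.sqrt_le_iff.2 ⟨by norm_num, by linarith⟩
  -- the slack
  set e : ℝ := min (d / 8) (min ((εA' * Real.log 2 - r * M) / 4)
    ((εA * Real.log 2 - (12 * εA' * Real.log 2 + 2 * s * L)) / 3)) with hedef
  have he : 0 < e := lt_min (by positivity) (lt_min (by linarith) (by linarith))
  have he1 : e ≤ d / 8 := min_le_left _ _
  have he2 : e ≤ (εA' * Real.log 2 - r * M) / 4 := (min_le_right _ _).trans (min_le_left _ _)
  have he3 : e ≤ (εA * Real.log 2 - (12 * εA' * Real.log 2 + 2 * s * L)) / 3 :=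
    (min_le_right _ _).trans (min_le_right _ _)
  have hdl : d / 2 ≤ d * Real.log 2 := by
    linarith [mul_le_mul_of_nonneg_left hlo.le hd0.le]
  have hdl' : d * Real.log 2 ≤ d := by linarith [mul_le_mul_of_nonneg_left hhi.le hd0.le]
  have hA'l : εA' * Real.log 2 ≤ 0.7 * εA' := by
    linarith [mul_le_mul_of_nonneg_left hhi.le hA'0.le]
  have hA'l0 : 0 < εA' * Real.log 2 := by positivity
  -- sizes
  have hposA : ∀ n, 0 < (𝒜 n).image.ncard := fun n => by exact_mod_cast (𝒜 n).ncard_image_pos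
  have hposB : ∀ n, 0 < (ℬ n).image.ncard := fun n => by exact_mod_cast (ℬ n).ncard_image_pos
  have hposX : ∀ n, 0 < (𝒜' n).image.ncard := fun n => by exact_mod_cast (𝒜' n).ncard_image_pos
  have hrealA : ∀ n, (0 : ℝ) < (𝒜 n).image.ncard := fun n => (𝒜 n).ncard_image_pos
  have hrealB : ∀ n, (0 : ℝ) < (ℬ n).image.ncard := fun n => (ℬ n).ncard_image_pos
  have hrealX : ∀ n, (0 : ℝ) < (𝒜' n).image.ncard := fun n => (𝒜' n).ncard_image_pos
  set lw := Real.log (Fintype.card W) with hlw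
  have sizeA : ∀ {ε : ℝ}, 0 < ε → ∀ᶠ n : ℕ in atTop,
      lA n * lw - n * ε ≤ Real.log (𝒜 n).image.ncard := by
    intro ε hε
    filter_upwards [HashPropertyOn.eventually_log h𝒜 hposA hε] with n h
    rwa [log_card_fun] at h
  have sizeX : ∀ {ε : ℝ}, 0 < ε → ∀ᶠ n : ℕ in atTop,
      lA' n * M - n * ε ≤ Real.log (𝒜' n).image.ncard := by
    intro ε hε
    filter_upwards [HashPropertyOn.eventually_log h𝒜' hposX hε] with n h
    rwa [log_card_fun] at h
  have sizeAB : ∀ {ε : ℝ}, 0 < ε → ∀ᶠ n : ℕ in atTop,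
      (lA n + lB n) * lw - n * ε ≤
        Real.log (𝒜 n).image.ncard + Real.log (ℬ n).image.ncard := by
    intro ε hε
    filter_upwards [HashPropertyOn.eventually_log h𝒜ℬ (fun n => by
      rw [Set.ncard_prod]; exact Nat.mul_pos (hposA n) (hposB n)) hε] with n h
    have hcW : ∀ l : ℕ, (Fintype.card (Fin l → W) : ℝ) ≠ 0 := fun l => by
      exact_mod_cast Fintype.card_ne_zero
    rw [Fintype.card_prod, Set.ncard_prod, Nat.cast_mul, Nat.cast_mul, Real.log_mul (hcW _) (hcW _),
      Real.log_mul (hrealA n).ne' (hrealB n).ne', log_card_fun, log_card_fun] at h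
    linarith
  have upA : ∀ n, Real.log (𝒜 n).image.ncard ≤ lA n * lw := fun n => by
    rw [hlw, ← log_card_fun]; exact log_ncard_le (hposA n)
  have upB : ∀ n, Real.log (ℬ n).image.ncard ≤ lB n * lw := fun n => by
    rw [hlw, ← log_card_fun]; exact log_ncard_le (hposB n)
  have upX : ∀ n, Real.log (𝒜' n).image.ncard ≤ lA' n * M := fun n => by
    rw [hM, ← log_card_fun]; exact log_ncard_le (hposX n)
  -- The first exponent is `r² / 4 = 3 d / 2`, above `Δ + 4 e ≤ 0.694 d + d / 2`. The second is `s²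
  -- / 5 = 12 εA' / 5`; since `Δ ≤ θ < a'` and `e ≤ (a' - θ) / 4`, the sum `Δ + a' + θ + 6 e` is at
  -- most `3 a' ≤ 2.1 εA'`.
  have hmain := eventually_existsCode (HZ := HZ * Real.log 2) (HY := HY * Real.log 2)
    (HX := HX * Real.log 2) (e := e) (Δ := d * Real.log 2) (a := εA * Real.log 2)
    (a' := εA' * Real.log 2) (θ := r * M) (ρ₁ := r ^ 2 / 4) (ρ₂ := s ^ 2 / 5) hμZ hμXW hμY
    h𝒜 h𝒜ℬ h𝒜' (by
      rw [hHZ, condEntropy_mul_log]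
      refine Finset.sum_congr rfl fun z _ => ?_
      rw [hpdef, law_joint_rvZ hμXW hμY]; rfl) he (by linarith) (by linarith)
    (by rw [hr2]; linarith) (by rw [hs2]; linarith)
    (tail_entX_le hμZ hμXW hμY hX hr0 hr1)
    (sum_prod_ind_condProb_lt_le hp rvW rvY hs0 hshalf hL1 hUL (by linarith))
    (by
      filter_upwards [sizeA (half_pos he), eventually_le_mul lw (half_pos he)] with n h1 h2
      rw [← Real.le_log_iff_exp_le (hrealA n)]
      have h3 := (hlen n).1.le_mul_log hW
      linarith)
    (by
      filter_upwards [sizeAB (half_pos he), eventually_le_mul (2 * lw) (half_pos he)] with n h1 h2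
      rw [← Real.le_log_iff_exp_le (mul_pos (hrealA n) (hrealB n)),
        Real.log_mul (hrealA n).ne' (hrealB n).ne']
      have h3 := (hlen n).1.le_mul_log hW
      have h4 := (hlen n).2.1.le_mul_log hW
      rw [hgain] at h4
      linarith)
    (by
      filter_upwards [eventually_le_mul (2 * lw) he] with n h2
      rw [← Real.log_le_iff_le_exp (mul_pos (hrealA n) (hrealB n)),
        Real.log_mul (hrealA n).ne' (hrealB n).ne']
      have h3 := (hlen n).1.mul_log_le hW (by linarith)
      have h4 := (hlen n).2.1.mul_log_le hW (by linarith)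
      rw [hgain] at h4
      have h5 := upA n
      have h6 := upB n
      linarith)
    (by
      filter_upwards [sizeX (half_pos he), eventually_le_mul M (half_pos he)] with n h1 h2
      rw [← Real.le_log_iff_exp_le (hrealX n)]
      have h3 := (hlen n).2.2.le_mul_log hX
      linarith)
    (by
      filter_upwards [eventually_le_mul M he] with n h2
      rcases le_or_gt (HX - εA') 0 with h | h
      · exact Or.inl ((hlen n).2.2.eq_zero_of_nonpos h)
      · right
        rw [← Real.log_le_iff_le_exp (hrealX n)]
        have h3 := (hlen n).2.2.mul_log_le hX h.le
        have h4 := upX n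
        linarith)
    hδ
  have hδl : 0 < δ * Real.log 2 / 2 := by positivity
  filter_upwards [hmain, sizeAB hδl, eventually_le_mul lw hδl, eventually_gt_atTop 0]
    with n hn h1 h2 h3 rankW rankX hrW hrX
  refine hn rankW rankX hrW hrX _ ?_
  have hn0 : (0 : ℝ) < n := by exact_mod_cast h3
  unfold rate Real.logb
  rw [le_div_iff₀ hn0, le_div_iff₀ hl2]
  -- The size of `Im ℬ` comes from the joint hash property: `|Im 𝒜| |Im ℬ|` is nearly `|W| ^ (lA +
  -- lB)`, while `|Im 𝒜|` is at most `|W| ^ lA`.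
  have h4 := (hlen n).2.1.le_mul_log hW
  have h5 := upA n
  linarith

end Final

end GP

/-! ### The coding theorem and the approach to capacity -/

theorem mainTheorem4 {X Y Z W : Type*} [Fintype X] [Fintype Y] [Fintype Z] [Fintype W]
    (μZ : Z → ℝ) (hμZ : μZ ∈ stdSimplex ℝ Z)
    (μXW : Z → X × W → ℝ) (hμXW : ∀ z, μXW z ∈ stdSimplex ℝ (X × W))
    (μY : X → Z → Y → ℝ) (hμY : ∀ x z, μY x z ∈ stdSimplex ℝ Y) :
    (∀ εA εB εA' : ℝ,
      GP.Admissible (Fintype.card X) (Fintype.card Y) (Fintype.card W) εA εB εA' →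
      ∀ lA lB lA' : ℕ → ℕ, GP.IsLengths μZ μXW μY εA εB εA' lA lB lA' →
      ∀ (𝒜 : ∀ n, GP.Ensemble (Fin n → W) (Fin (lA n) → W))
        (ℬ : ∀ n, GP.Ensemble (Fin n → W) (Fin (lB n) → W))
        (𝒜' : ∀ n, GP.Ensemble (Fin n → X) (Fin (lA' n) → X)),
      GP.HasHashProperty 𝒜 → GP.HasJointHashProperty 𝒜 ℬ → GP.HasHashProperty 𝒜' →
      ∀ δ : ℝ, 0 < δ → ∀ᶠ n : ℕ in Filter.atTop,
        ∀ (rankW : (Fin n → W) → ℕ) (rankX : (Fin n → X) → ℕ),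
          Function.Injective rankW → Function.Injective rankX →
          GP.ExistsCode μZ μXW μY (𝒜 n) (ℬ n) (𝒜' n) rankW rankX
            (GP.mutualInfo (GP.joint μZ μXW μY) GP.rvW GP.rvY
              - GP.mutualInfo (GP.joint μZ μXW μY) GP.rvW GP.rvZ - εB - δ) δ) ∧
    (GP.gain μZ μXW μY = GP.capacity μZ μY →
      (1 < Fintype.card X → ∀ ε₀ : ℝ, 0 < ε₀ → ∃ εA εB εA' : ℝ,
        GP.Admissible (Fintype.card X) (Fintype.card Y) (Fintype.card W) εA εB εA' ∧ εB < ε₀) ∧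
      ∀ η : ℝ, 0 < η → ∃ ε₀ : ℝ, 0 < ε₀ ∧ ∀ εA εB εA' : ℝ,
        GP.Admissible (Fintype.card X) (Fintype.card Y) (Fintype.card W) εA εB εA' → εB < ε₀ →
        ∀ lA lB lA' : ℕ → ℕ, GP.IsLengths μZ μXW μY εA εB εA' lA lB lA' →
        ∀ (𝒜 : ∀ n, GP.Ensemble (Fin n → W) (Fin (lA n) → W))
          (ℬ : ∀ n, GP.Ensemble (Fin n → W) (Fin (lB n) → W))
          (𝒜' : ∀ n, GP.Ensemble (Fin n → X) (Fin (lA' n) → X)),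
        GP.HasHashProperty 𝒜 → GP.HasJointHashProperty 𝒜 ℬ → GP.HasHashProperty 𝒜' →
        ∀ᶠ n : ℕ in Filter.atTop,
          ∀ (rankW : (Fin n → W) → ℕ) (rankX : (Fin n → X) → ℕ),
            Function.Injective rankW → Function.Injective rankX →
            GP.ExistsCode μZ μXW μY (𝒜 n) (ℬ n) (𝒜' n) rankW rankX
              (GP.capacity μZ μY - η) η) := by
  refine ⟨fun εA εB εA' hadm lA lB lA' hlen 𝒜 ℬ 𝒜' h1 h2 h3 δ hδ =>
    GP.eventually_existsCode_of_admissible hμZ hμXW hμY hadm hlen h1 h2 h3 hδ, fun hcap => ⟨?_, ?_⟩⟩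
  · intro hX ε₀ hε₀
    have hneZ : Nonempty Z := by
      by_contra h
      rw [not_nonempty_iff] at h
      simpa using hμZ.2
    have hneXW : Nonempty (X × W) := by
      by_contra h
      rw [not_nonempty_iff] at h
      simpa using (hμXW (Classical.arbitrary Z)).2
    have hneW : Nonempty W := hneXW.map Prod.snd
    have hneY : Nonempty Y := by
      by_contra h
      rw [not_nonempty_iff] at h
      simpa using (hμY (Classical.arbitrary (X × W)).1 (Classical.arbitrary Z)).2
    exact GP.exists_admissible hX (Nat.mul_pos Fintype.card_pos Fintype.card_pos) hε₀
  · intro η hη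
    refine ⟨η / 2, half_pos hη, fun εA εB εA' hadm hε lA lB lA' hlen 𝒜 ℬ 𝒜' h1 h2 h3 => ?_⟩
    filter_upwards [GP.eventually_existsCode_of_admissible hμZ hμXW hμY hadm hlen h1 h2 h3
      (half_pos hη)] with n hn rankW rankX hrW hrX
    exact (hn rankW rankX hrW hrX).mono (by rw [← hcap]; linarith) (by linarith)
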